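/- Let $(A,\Delta)$ be a regular weak multiplier Hopf algebra over $\mathbb C$ in the sense of Van Daele and Wang, with antipode $S$. Let $\varepsilon_t(A)$ and $\varepsilon_s(A)$ be the target and source algebras, i.e. the images in the multiplier algebra $M(A)$ of $\varepsilon_t(a)=\sum a_{(1)}S(a_{(2)})$ and $\varepsilon_s(a)=\sum S(a_{(1)})a_{(2)}$, and let $A_t,A_s\subseteq M(A)$ be their multiplier algebras, viewed inside $M(A)$. A left integral is a non-zero linear functional $\varphi:A\to\mathbb C$ such that $(\iota\otimes\varphi)\Delta(a)\in A_t$ for all $a\in A$; a right integral is a non-zero linear functional $\psi:A\to\mathbb C$ such that $(\psi\otimes\iota)\Delta(a)\in A_s$ for all $a\in A$. Assume that $(A,\Delta)$ has a faithful set of integrals: if $x\in A$ and $\varphi(xa)=0$ for all left integrals $\varphi$ and all $a\in A$, then $x=0$; and if $x\in A$ and $\varphi(ax)=0$ for all left integrals $\varphi$ and all $a\in A$, then $x=0$. Let $\widehat A$ be the linear span, in the space of all linear functionals on $A$, of the functionals $\varphi(\,\cdot\,a)\colon x\mapsto\varphi(xa)$ with $\varphi$ a left integral and $a\in A$. Then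 for every left integral $\varphi$, every right integral $\psi$ and every $a\in A$, the functionals $\varphi(\,\cdot\,a)$, $\varphi(a\,\cdot\,)$, $\psi(\,\cdot\,a)$ and $\psi(a\,\cdot\,)$ all lie in $\widehat A$. Moreover, $\widehat A$ is equal to the linear span of the functionals of any single one of these four types: of all $\varphi(\,\cdot\,a)$, of all $\varphi(a\,\cdot\,)$, of all $\psi(\,\cdot\,a)$, and of all $\psi(a\,\cdot\,)$, where $\varphi$ runs over all left integrals, $\psi$ over all right integrals, and $a$ over $A$. -/

import Mathlib

open scoped TensorProduct

noncomputable section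

namespace WMHA

/-! ### Multiplier algebras -/

section Multipliers

set_option linter.unusedSectionVars false

variable (A : Type*) [NonUnitalRing A] [Module ℂ A] [IsScalarTower ℂ A A] [SMulCommClass ℂ A A]

/-- The product of `A` is non-degenerate. -/
def IsNondegenerate : Prop :=
  (∀ a : A, (∀ b : A, a * b = 0) → a = 0) ∧ (∀ a : A, (∀ b : A, b * a = 0) → a = 0)

/-- `A` is idempotent: `A ^ 2 = A`, where `A ^ 2` is the linear span of all products. -/
def IsIdempotentAlgebra : Prop :=
  Submodule.span ℂ {x : A | ∃ a b : A, x = a * b} = ⊤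

/-- The multiplier algebra `M(A)`: pairs of a left action `b ↦ m b` and a right action `a ↦ a m`
with `(a m) b = a (m b)`. -/
def multiplierAlgebra : Subalgebra ℂ (Module.End ℂ A × (Module.End ℂ A)ᵐᵒᵖ) where
  carrier := {m | ∀ a b : A, m.2.unop a * b = a * m.1 b}
  mul_mem' := by
    intro m n hm hn a b
    simp only [Set.mem_ofPred_eq] at hm hn
    simp [hm, hn]
  add_mem' := by
    intro m n hm hn a b
    simp only [Set.mem_ofPred_eq] at hm hn
    simp [add_mul, mul_add, hm, hn]
  algebraMap_mem' := by
    intro r a b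
    change (r • a) * b = a * (r • b)
    rw [smul_mul_assoc, mul_smul_comm]

/-- The type of multipliers of `A`. -/
abbrev Multiplier : Type _ := multiplierAlgebra A

variable {A}

namespace Multiplier

/-- The left action `b ↦ m b` of a multiplier `m`. -/
def left (m : Multiplier A) : A →ₗ[ℂ] A := m.1.1

/-- The right action `a ↦ a m` of a multiplier `m`. -/
def right (m : Multiplier A) : A →ₗ[ℂ] A := m.1.2.unop

theorem right_mul_eq (m : Multiplier A) (a b : A) : m.right a * b = a * m.left b := m.2 a b

/-- Construct a multiplier from its left and right actions. -/
def mk (l r : A →ₗ[ℂ] A) (h : ∀ a b : A, r a * b = a * l b) : Multiplier A :=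
  ⟨(l, MulOpposite.op r), h⟩

@[simp] theorem left_mk (l r : A →ₗ[ℂ] A) (h : ∀ a b : A, r a * b = a * l b) :
    (mk l r h).left = l := rfl

@[simp] theorem right_mk (l r : A →ₗ[ℂ] A) (h : ∀ a b : A, r a * b = a * l b) :
    (mk l r h).right = r := rfl

theorem ext' {m n : Multiplier A} (hl : m.left = n.left) (hr : m.right = n.right) : m = n := by
  apply Subtype.ext
  apply Prod.ext hl
  exact MulOpposite.unop_injective hr

@[simp] theorem left_add (m n : Multiplier A) : (m + n).left = m.left + n.left := rfl
@[simp] theorem right_add (m n : Multiplier A) : (m + n).right = m.right + n.right := rfl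
@[simp] theorem left_smul (c : ℂ) (m : Multiplier A) : (c • m).left = c • m.left := rfl
@[simp] theorem right_smul (c : ℂ) (m : Multiplier A) : (c • m).right = c • m.right := rfl

/-- The canonical map `A → M(A)`. -/
def incl : A →ₗ[ℂ] Multiplier A where
  toFun a := mk (LinearMap.mulLeft ℂ a) (LinearMap.mulRight ℂ a) (fun x y => by
    simp [mul_assoc])
  map_add' a b := by
    apply ext'
    · ext x; exact add_mul a b x
    · ext x; exact mul_add x a b
  map_smul' c a := by
    apply ext'
    · ext x; exact smul_mul_assoc c a x
    · ext x; exact mul_smul_comm c x a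

variable {B : Type*} [NonUnitalRing B] [Module ℂ B] [IsScalarTower ℂ B B] [SMulCommClass ℂ B B]

/-- The multiplier `m ⊗ n` of `A ⊗ B`, for multipliers `m` of `A` and `n` of `B`. -/
def tmul (m : Multiplier A) (n : Multiplier B) : Multiplier (A ⊗[ℂ] B) :=
  mk (TensorProduct.map m.left n.left) (TensorProduct.map m.right n.right) (fun x y => by
    induction x using TensorProduct.induction_on with
    | zero => simp
    | add x₁ x₂ h₁ h₂ => simp only [map_add, add_mul, h₁, h₂]
    | tmul a b =>
      induction y using TensorProduct.induction_on with
      | zero => simp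
      | add y₁ y₂ h₁ h₂ => simp only [map_add, mul_add, h₁, h₂]
      | tmul c d => simp [right_mul_eq])

/-- Transport of multipliers along an isomorphism of algebras. -/
def transport (e : A ≃ₗ[ℂ] B) (he : ∀ x y : A, e (x * y) = e x * e y) (m : Multiplier A) :
    Multiplier B :=
  mk (e.toLinearMap ∘ₗ m.left ∘ₗ e.symm.toLinearMap)
    (e.toLinearMap ∘ₗ m.right ∘ₗ e.symm.toLinearMap) (fun x y => by
      obtain ⟨x, rfl⟩ := e.surjective x
      obtain ⟨y, rfl⟩ := e.surjective y
      simp [← he, right_mul_eq])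

theorem comm_mul (x y : A ⊗[ℂ] B) :
    TensorProduct.comm ℂ A B (x * y) = TensorProduct.comm ℂ A B x * TensorProduct.comm ℂ A B y := by
  induction x using TensorProduct.induction_on with
  | zero => simp
  | add x₁ x₂ h₁ h₂ => simp only [map_add, add_mul, h₁, h₂]
  | tmul a b =>
    induction y using TensorProduct.induction_on with
    | zero => simp
    | add y₁ y₂ h₁ h₂ => simp only [map_add, mul_add, h₁, h₂]
    | tmul c d => simp

/-- The flip on multipliers of `A ⊗ A`. -/
def flip (m : Multiplier (A ⊗[ℂ] A)) : Multiplier (A ⊗[ℂ] A) :=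
  transport (TensorProduct.comm ℂ A A) comm_mul m

variable {C : Type*} [NonUnitalRing C] [Module ℂ C] [IsScalarTower ℂ C C] [SMulCommClass ℂ C C]

theorem assoc_symm_mul (x y : A ⊗[ℂ] (B ⊗[ℂ] C)) :
    (TensorProduct.assoc ℂ A B C).symm (x * y) =
      (TensorProduct.assoc ℂ A B C).symm x * (TensorProduct.assoc ℂ A B C).symm y := by
  induction x using TensorProduct.induction_on with
  | zero => simp
  | add x₁ x₂ h₁ h₂ => simp only [map_add, add_mul, h₁, h₂]
  | tmul a u =>
    induction u using TensorProduct.induction_on with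
    | zero => simp
    | add u₁ u₂ h₁ h₂ => simp only [TensorProduct.tmul_add, map_add, add_mul, h₁, h₂]
    | tmul b c =>
      induction y using TensorProduct.induction_on with
      | zero => simp
      | add y₁ y₂ h₁ h₂ => simp only [map_add, mul_add, h₁, h₂]
      | tmul a' v =>
        induction v using TensorProduct.induction_on with
        | zero => simp
        | add v₁ v₂ h₁ h₂ => simp only [TensorProduct.tmul_add, map_add, mul_add, h₁, h₂]
        | tmul b' c' => simp

/-- `m ⊗ 1` on `(A ⊗ A) ⊗ A`, for a multiplier `m` of `A ⊗ A`. -/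
def leg12 (m : Multiplier (A ⊗[ℂ] A)) : Multiplier ((A ⊗[ℂ] A) ⊗[ℂ] A) := tmul m 1

/-- `1 ⊗ m` on `(A ⊗ A) ⊗ A`, for a multiplier `m` of `A ⊗ A`. -/
def leg23 (m : Multiplier (A ⊗[ℂ] A)) : Multiplier ((A ⊗[ℂ] A) ⊗[ℂ] A) :=
  transport (TensorProduct.assoc ℂ A A A).symm assoc_symm_mul (tmul 1 m)

/-- Let `f : A → M(B)` be a homomorphism and `e` an idempotent of `M(B)` with `f(A) B = e B` and
`B f(A) = B e`. Then `f` has a unique extension to a homomorphism `M(A) → M(B)` that maps `1`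
to `e`. The predicate says that `x` is the value of this extension at `m`. -/
def IsExtensionValue (f : A →ₗ[ℂ] Multiplier B) (e : Multiplier B) (m : Multiplier A)
    (x : Multiplier B) : Prop :=
  e * x = x ∧ x * e = x ∧ ∀ a : A, x * f a = f (m.left a) ∧ f a * x = f (m.right a)

end Multiplier

/-- The map `ω ⊗ ι : A ⊗ A → A`. -/
def sliceLeft (ω : Module.Dual ℂ A) : A ⊗[ℂ] A →ₗ[ℂ] A :=
  (TensorProduct.lid ℂ A).toLinearMap ∘ₗ TensorProduct.map ω LinearMap.id

/-- The map `ι ⊗ ω : A ⊗ A → A`. -/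
def sliceRight (ω : Module.Dual ℂ A) : A ⊗[ℂ] A →ₗ[ℂ] A :=
  (TensorProduct.rid ℂ A).toLinearMap ∘ₗ TensorProduct.map LinearMap.id ω

end Multipliers

/-! ### Coproducts and weak multiplier Hopf algebras -/

open Multiplier

/-- A coproduct on `A`: a homomorphism `Δ : A → M(A ⊗ A)` such that `Δ(a)(1 ⊗ b)` and
`(c ⊗ 1)Δ(a)` lie in `A ⊗ A`, and that is coassociative. The maps `T₁` and `T₂` record these
elements of `A ⊗ A` (they are determined by `Δ` because the product is non-degenerate). -/
structure Coproduct (A : Type*) [NonUnitalRing A] [Module ℂ A] [IsScalarTower ℂ A A]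
    [SMulCommClass ℂ A A] where
  /-- the algebra is non-degenerate -/
  nondegenerate : IsNondegenerate A
  /-- the algebra is idempotent -/
  idempotent : IsIdempotentAlgebra A
  /-- the homomorphism `Δ` -/
  comul : A →ₙₐ[ℂ] Multiplier (A ⊗[ℂ] A)
  /-- `T₁ (a ⊗ b) = Δ(a)(1 ⊗ b)` -/
  T₁ : A ⊗[ℂ] A →ₗ[ℂ] A ⊗[ℂ] A
  /-- `T₂ (c ⊗ a) = (c ⊗ 1)Δ(a)` -/
  T₂ : A ⊗[ℂ] A →ₗ[ℂ] A ⊗[ℂ] A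
  T₁_spec : ∀ a b : A, incl (T₁ (a ⊗ₜ b)) = comul a * tmul 1 (incl b)
  T₂_spec : ∀ c a : A, incl (T₂ (c ⊗ₜ a)) = tmul (incl c) 1 * comul a
  /-- `(a ⊗ 1 ⊗ 1)(Δ ⊗ ι)(Δ(b)(1 ⊗ c)) = (ι ⊗ Δ)((a ⊗ 1)Δ(b))(1 ⊗ 1 ⊗ c)`, where
  `(a ⊗ 1 ⊗ 1)(Δ ⊗ ι)(p ⊗ q) = T₂ (a ⊗ p) ⊗ q` and
  `(ι ⊗ Δ)(p ⊗ q)(1 ⊗ 1 ⊗ c) = p ⊗ T₁ (q ⊗ c)` -/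
  coassoc : ∀ a b c : A,
    TensorProduct.assoc ℂ A A A
        (TensorProduct.map T₂ LinearMap.id
          ((TensorProduct.assoc ℂ A A A).symm (a ⊗ₜ T₁ (b ⊗ₜ c)))) =
      TensorProduct.map LinearMap.id T₁ (TensorProduct.assoc ℂ A A A (T₂ (a ⊗ₜ b) ⊗ₜ c))

namespace Coproduct

variable {A : Type*} [NonUnitalRing A] [Module ℂ A] [IsScalarTower ℂ A A] [SMulCommClass ℂ A A]
  (D : Coproduct A)

/-- The coproduct is full: its left and right leg are all of `A`. -/
def IsFull : Prop :=
  (∀ V : Submodule ℂ A,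
    (∀ a b : A, D.T₁ (a ⊗ₜ b) ∈ LinearMap.range
      (TensorProduct.map V.subtype (LinearMap.id : A →ₗ[ℂ] A))) → V = ⊤) ∧
  (∀ W : Submodule ℂ A,
    (∀ c a : A, D.T₂ (c ⊗ₜ a) ∈ LinearMap.range
      (TensorProduct.map (LinearMap.id : A →ₗ[ℂ] A) W.subtype)) → W = ⊤)

/-- The homomorphism `Δ ⊗ ι : A ⊗ A → M(A ⊗ A ⊗ A)`. -/
def comulId : A ⊗[ℂ] A →ₗ[ℂ] Multiplier ((A ⊗[ℂ] A) ⊗[ℂ] A) :=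
  TensorProduct.lift (LinearMap.mk₂ ℂ (fun p q : A => tmul (D.comul p) (incl q))
    (fun p p' q => by
      apply ext' <;> simp [tmul, TensorProduct.map_add_left])
    (fun c p q => by
      apply ext' <;> simp [tmul, TensorProduct.map_smul_left])
    (fun p q q' => by
      apply ext' <;> simp [tmul, TensorProduct.map_add_right])
    (fun c p q => by
      apply ext' <;> simp [tmul, TensorProduct.map_smul_right]))

/-- The map `a ⊗ (b ⊗ c) ↦ Δ₁₃(a)(1 ⊗ b ⊗ c)`. -/
def T₁OnLegs13 : A ⊗[ℂ] (A ⊗[ℂ] A) →ₗ[ℂ] A ⊗[ℂ] (A ⊗[ℂ] A) :=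
  (TensorProduct.leftComm ℂ A A A).toLinearMap ∘ₗ
    TensorProduct.map LinearMap.id D.T₁ ∘ₗ (TensorProduct.leftComm ℂ A A A).toLinearMap

/-- The map `(a ⊗ b) ⊗ c ↦ (a ⊗ b ⊗ 1)Δ₁₃(c)`. -/
def T₂OnLegs13 : (A ⊗[ℂ] A) ⊗[ℂ] A →ₗ[ℂ] (A ⊗[ℂ] A) ⊗[ℂ] A :=
  (TensorProduct.rightComm ℂ A A A).toLinearMap ∘ₗ
    TensorProduct.map D.T₂ LinearMap.id ∘ₗ (TensorProduct.rightComm ℂ A A A).toLinearMap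

end Coproduct

/-- A weak multiplier Hopf algebra: a full coproduct with a counit `ε` and an idempotent
`E ∈ M(A ⊗ A)` that determines the ranges and the kernels of the canonical maps `T₁` and `T₂`.
The data `ε`, `E`, `G₁`, `G₂` are uniquely determined by the coproduct. -/
structure WeakMultiplierHopfAlgebra (A : Type*) [NonUnitalRing A] [Module ℂ A]
    [IsScalarTower ℂ A A] [SMulCommClass ℂ A A] extends Coproduct A where
  full : toCoproduct.IsFull
  /-- the counit -/
  counit : Module.Dual ℂ A
  counit_left : ∀ a b : A, sliceLeft counit (T₁ (a ⊗ₜ b)) = a * b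
  counit_right : ∀ c a : A, sliceRight counit (T₂ (c ⊗ₜ a)) = c * a
  /-- the canonical idempotent -/
  E : Multiplier (A ⊗[ℂ] A)
  E_idem : E * E = E
  /-- `Δ(A)(1 ⊗ A) = E(A ⊗ A)` -/
  range_T₁ : LinearMap.range T₁ = LinearMap.range E.left
  /-- `(A ⊗ 1)Δ(A) = (A ⊗ A)E` -/
  range_T₂ : LinearMap.range T₂ = LinearMap.range E.right
  /-- `(E ⊗ 1)(1 ⊗ E) = (1 ⊗ E)(E ⊗ 1)` -/
  E_comm : leg12 E * leg23 E = leg23 E * leg12 E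
  /-- `(Δ ⊗ ι)(E) = (E ⊗ 1)(1 ⊗ E)`, for the extension of `Δ ⊗ ι` with value `E ⊗ 1` at `1` -/
  comul_E : IsExtensionValue toCoproduct.comulId (leg12 E) E (leg12 E * leg23 E)
  /-- the map with `(G₁ ⊗ ι)(Δ₁₃(a)(1 ⊗ b ⊗ c)) = Δ₁₃(a)(1 ⊗ E)(1 ⊗ b ⊗ c)` -/
  G₁ : A ⊗[ℂ] A →ₗ[ℂ] A ⊗[ℂ] A
  G₁_spec : ∀ a b c : A,
    TensorProduct.map G₁ LinearMap.id
        ((TensorProduct.assoc ℂ A A A).symm (toCoproduct.T₁OnLegs13 (a ⊗ₜ (b ⊗ₜ c)))) =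
      (TensorProduct.assoc ℂ A A A).symm (toCoproduct.T₁OnLegs13 (a ⊗ₜ E.left (b ⊗ₜ c)))
  /-- the map with `(ι ⊗ G₂)((a ⊗ b ⊗ 1)Δ₁₃(c)) = (a ⊗ b ⊗ 1)(E ⊗ 1)Δ₁₃(c)` -/
  G₂ : A ⊗[ℂ] A →ₗ[ℂ] A ⊗[ℂ] A
  G₂_spec : ∀ a b c : A,
    TensorProduct.map LinearMap.id G₂
        (TensorProduct.assoc ℂ A A A (toCoproduct.T₂OnLegs13 ((a ⊗ₜ b) ⊗ₜ c))) =
      TensorProduct.assoc ℂ A A A (toCoproduct.T₂OnLegs13 (E.right (a ⊗ₜ b) ⊗ₜ c))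
  /-- `Ker T₁ = (1 - G₁)(A ⊗ A)` -/
  ker_T₁ : LinearMap.ker T₁ = LinearMap.range (LinearMap.id - G₁)
  /-- `Ker T₂ = (1 - G₂)(A ⊗ A)` -/
  ker_T₂ : LinearMap.ker T₂ = LinearMap.range (LinearMap.id - G₂)

namespace WeakMultiplierHopfAlgebra

variable {A : Type*} [NonUnitalRing A] [Module ℂ A] [IsScalarTower ℂ A A] [SMulCommClass ℂ A A]
  (H : WeakMultiplierHopfAlgebra A)

/-- `(A, Δ)` is regular: the coproduct obtained from `Δ` by the flip again makes `A` into a weak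
multiplier Hopf algebra (in particular `Δ(a)(b ⊗ 1)` and `(1 ⊗ c)Δ(a)` lie in `A ⊗ A`). -/
def IsRegular : Prop :=
  ∃ H' : WeakMultiplierHopfAlgebra A, ∀ a : A, H'.comul a = flip (H.comul a)

/-- `R₁` is the generalized inverse of `T₁` with `T₁ R₁ = E ·` and `R₁ T₁ = G₁`. -/
def IsInverse₁ (R₁ : A ⊗[ℂ] A →ₗ[ℂ] A ⊗[ℂ] A) : Prop :=
  H.T₁ ∘ₗ R₁ = H.E.left ∧ R₁ ∘ₗ H.T₁ = H.G₁ ∧ R₁ ∘ₗ H.T₁ ∘ₗ R₁ = R₁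

/-- `R₂` is the generalized inverse of `T₂` with `T₂ R₂ = · E` and `R₂ T₂ = G₂`. -/
def IsInverse₂ (R₂ : A ⊗[ℂ] A →ₗ[ℂ] A ⊗[ℂ] A) : Prop :=
  H.T₂ ∘ₗ R₂ = H.E.right ∧ R₂ ∘ₗ H.T₂ = H.G₂ ∧ R₂ ∘ₗ H.T₂ ∘ₗ R₂ = R₂

/-- `S` is the antipode: `S(a) b = (ε ⊗ ι) R₁(a ⊗ b)` and `b S(a) = (ι ⊗ ε) R₂(b ⊗ a)`. -/
def IsAntipode (S : A →ₗ[ℂ] A) : Prop :=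
  (∃ R₁, H.IsInverse₁ R₁ ∧ ∀ a b : A, S a * b = sliceLeft H.counit (R₁ (a ⊗ₜ b))) ∧
  (∃ R₂, H.IsInverse₂ R₂ ∧ ∀ a b : A, b * S a = sliceRight H.counit (R₂ (b ⊗ₜ a)))

open Classical in
/-- The antipode of a regular weak multiplier Hopf algebra, a linear map from `A` to itself. -/
def antipode : A →ₗ[ℂ] A :=
  if h : ∃ S : A →ₗ[ℂ] A, H.IsAntipode S then h.choose else 0

/-- The target algebra `ε_t(A)` in `M(A)`, where `ε_t(a) = ∑ a₍₁₎ S(a₍₂₎)` is the multiplier with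
`c ε_t(a) = ∑ c a₍₁₎ S(a₍₂₎)` for all `c`. -/
def targetAlgebra : Set (Multiplier A) :=
  {x | ∃ a : A, ∀ c : A,
    x.right c = LinearMap.mul' ℂ A (TensorProduct.map LinearMap.id H.antipode (H.T₂ (c ⊗ₜ a)))}

/-- The source algebra `ε_s(A)` in `M(A)`, where `ε_s(a) = ∑ S(a₍₁₎) a₍₂₎` is the multiplier with
`ε_s(a) c = ∑ S(a₍₁₎) a₍₂₎ c` for all `c`. -/
def sourceAlgebra : Set (Multiplier A) :=
  {y | ∃ a : A, ∀ c : A,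
    y.left c = LinearMap.mul' ℂ A (TensorProduct.map H.antipode LinearMap.id (H.T₁ (a ⊗ₜ c)))}

/-- The multiplier algebra of `ε_t(A)`, embedded in `M(A)`. As `ε_t(A)` is a subalgebra of `M(A)`
with `ε_t(A) A = A = A ε_t(A)`, it consists of the multipliers of `A` that multiply `ε_t(A)` into
itself from both sides. -/
def At : Set (Multiplier A) :=
  {x | ∀ y ∈ H.targetAlgebra, x * y ∈ H.targetAlgebra ∧ y * x ∈ H.targetAlgebra}

/-- The multiplier algebra of `ε_s(A)`, embedded in `M(A)`. -/
def As : Set (Multiplier A) :=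
  {x | ∀ y ∈ H.sourceAlgebra, x * y ∈ H.sourceAlgebra ∧ y * x ∈ H.sourceAlgebra}

/-- `x` is the multiplier `(ι ⊗ ω)Δ(a)`: `x b = (ι ⊗ ω)(Δ(a)(b ⊗ 1))` and
`b x = (ι ⊗ ω)((b ⊗ 1)Δ(a))` for all `b`. -/
def IsRightSlice (ω : Module.Dual ℂ A) (a : A) (x : Multiplier A) : Prop :=
  ∀ (b : A) (t : A ⊗[ℂ] A),
    (incl t = H.comul a * tmul (incl b) 1 → x.left b = sliceRight ω t) ∧
    (incl t = tmul (incl b) 1 * H.comul a → x.right b = sliceRight ω t)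

/-- `x` is the multiplier `(ω ⊗ ι)Δ(a)`: `x b = (ω ⊗ ι)(Δ(a)(1 ⊗ b))` and
`b x = (ω ⊗ ι)((1 ⊗ b)Δ(a))` for all `b`. -/
def IsLeftSlice (ω : Module.Dual ℂ A) (a : A) (x : Multiplier A) : Prop :=
  ∀ (b : A) (t : A ⊗[ℂ] A),
    (incl t = H.comul a * tmul 1 (incl b) → x.left b = sliceLeft ω t) ∧
    (incl t = tmul 1 (incl b) * H.comul a → x.right b = sliceLeft ω t)

/-- A left integral: a non-zero functional `φ` with `(ι ⊗ φ)Δ(a) ∈ A_t` for all `a`. -/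
def IsLeftIntegral (φ : Module.Dual ℂ A) : Prop :=
  φ ≠ 0 ∧ ∀ a : A, ∃ x ∈ H.At, H.IsRightSlice φ a x

/-- A right integral: a non-zero functional `ψ` with `(ψ ⊗ ι)Δ(a) ∈ A_s` for all `a`. -/
def IsRightIntegral (ψ : Module.Dual ℂ A) : Prop :=
  ψ ≠ 0 ∧ ∀ a : A, ∃ x ∈ H.As, H.IsLeftSlice ψ a x

/-- There is a faithful set of integrals. -/
def HasFaithfulIntegrals : Prop :=
  (∀ x : A, (∀ φ, H.IsLeftIntegral φ → ∀ a : A, φ (x * a) = 0) → x = 0) ∧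
  (∀ x : A, (∀ φ, H.IsLeftIntegral φ → ∀ a : A, φ (a * x) = 0) → x = 0)

end WeakMultiplierHopfAlgebra

section Functionals

variable {A : Type*} [NonUnitalRing A] [Module ℂ A] [IsScalarTower ℂ A A] [SMulCommClass ℂ A A]

/-- The functional `ω(· a)`, that is `x ↦ ω(x a)`. -/
def mulRightFunctional (ω : Module.Dual ℂ A) (a : A) : Module.Dual ℂ A :=
  ω ∘ₗ LinearMap.mulRight ℂ a

/-- The functional `ω(a ·)`, that is `x ↦ ω(a x)`. -/
def mulLeftFunctional (ω : Module.Dual ℂ A) (a : A) : Module.Dual ℂ A :=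
  ω ∘ₗ LinearMap.mulLeft ℂ a

/-- The dual space `Â`: the span of the functionals `φ(· a)`, with `φ` a left integral. -/
def WeakMultiplierHopfAlgebra.dualSpace (H : WeakMultiplierHopfAlgebra A) :
    Submodule ℂ (Module.Dual ℂ A) :=
  Submodule.span ℂ {ω | ∃ φ, H.IsLeftIntegral φ ∧ ∃ a : A, ω = mulRightFunctional φ a}

end Functionals

end WMHA

end

set_option linter.unusedSectionVars false

/-! Write S for the antipode of `H`, and H' for the weak multiplier Hopf algebra with the flipped
coproduct, which regularity provides. Its antipode S' turns out to be the inverse of S, and its left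
integrals are the right integrals of `H` (`isRightIntegral_iff`), so each statement has a mirror
image under exchange of `H` and H'.

The pivot is the formula S'((ι ⊗ φ)((1 ⊗ x)Δ(a))) = (ι ⊗ φ)(Δ(x)(1 ⊗ a)) for a left integral φ
(`antipode_slL`). With its mirror image for a right integral ψ, the number (ψ ⊗ φ)(Δ(x)(p ⊗ q)) can
be written both as φ(xc) and as ψ(xc'), with c and c' independent of x (`apply_mul_slL_antipode`).
In the same way (ψ ⊗ φ)((p ⊗ 1)Δ(x)(1 ⊗ q)) is both φ(xc) and ψ(c'x) (`apply_mul_slR_antipode`). The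
elements c and c' are slices of the coproduct by integrals composed with S or S'. Such slices span A
when the functionals are faithful (`span_slL_T₂`, `span_slR_T₁`), so the spans of the functionals
agree.

This requires faithfulness for H' too, and for that φ ∘ S' must be a right integral
(`isRightIntegral_comp`), so S' must reverse the coproduct. The pivot formula proves this reversal
on the elements (ι ⊗ φ)((1 ⊗ x)Δ(a)), which span A by faithfulness (`lam_antipode`).

The antipode itself has to be built from the axioms. Identities are tested by the slices `lam` and
`rho` of Δ with functionals ω(d · e), which take values in A. An operator on A ⊗ A that commutes
with every rho ⊗ ι (`Comm1`) commutes on three legs with T₂ ⊗ ι (`Comm1.op`). The maps T₁, E and G₁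
are of this kind, hence so is the generalized inverse R₁. Commutation of R₂ ⊗ ι with ι ⊗ T₁ and ι ⊗
E makes S(a) a multiplier (`mul_S₁`). It is anti-multiplicative in a (`S₁_mul_left`), and S(S'(v)u)
= S(u)v (`S₁_S₁`) then shows that S(a) lies in A and that S and S' are inverse to each other.
Finally A_t consists of the multipliers commuting with all `lam` (`mem_At`). This is the form in
which the integral property enters the pivot formula. -/

namespace WMHA

/-! ### Slices of tensors -/

section Slices

variable {M N P : Type*} [AddCommGroup M] [Module ℂ M] [AddCommGroup N] [Module ℂ N]
  [AddCommGroup P] [Module ℂ P]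

/-- The map `ω ⊗ ι : M ⊗ N → N`. -/
noncomputable def slL (ω : Module.Dual ℂ M) : M ⊗[ℂ] N →ₗ[ℂ] N :=
  (TensorProduct.lid ℂ N).toLinearMap ∘ₗ TensorProduct.map ω LinearMap.id

/-- The map `ι ⊗ ω : M ⊗ N → M`. -/
noncomputable def slR (ω : Module.Dual ℂ N) : M ⊗[ℂ] N →ₗ[ℂ] M :=
  (TensorProduct.rid ℂ M).toLinearMap ∘ₗ TensorProduct.map LinearMap.id ω

@[simp] theorem slL_tmul (ω : Module.Dual ℂ M) (m : M) (n : N) : slL ω (m ⊗ₜ[ℂ] n) = ω m • n := by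
  simp [slL]

@[simp] theorem slR_tmul (ω : Module.Dual ℂ N) (m : M) (n : N) : slR ω (m ⊗ₜ[ℂ] n) = ω n • m := by
  simp [slR]

theorem eq_zero_of_slL {t : M ⊗[ℂ] N} (h : ∀ ω : Module.Dual ℂ M, slL ω t = 0) : t = 0 := by
  classical
  let b := Module.Basis.ofVectorSpace ℂ M
  apply (TensorProduct.equivFinsuppOfBasisLeft (N := N) b).injective
  ext i
  rw [TensorProduct.equivFinsuppOfBasisLeft_apply]
  simpa [slL, LinearMap.rTensor] using h (b.coord i)

theorem eq_zero_of_slR {t : M ⊗[ℂ] N} (h : ∀ ω : Module.Dual ℂ N, slR ω t = 0) : t = 0 := by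
  classical
  let b := Module.Basis.ofVectorSpace ℂ N
  apply (TensorProduct.equivFinsuppOfBasisRight (M := M) b).injective
  ext i
  rw [TensorProduct.equivFinsuppOfBasisRight_apply]
  simpa [slR, LinearMap.lTensor] using h (b.coord i)

theorem slL_rTensor (ω : Module.Dual ℂ P) (f : M →ₗ[ℂ] P) (t : M ⊗[ℂ] N) :
    slL ω (LinearMap.rTensor N f t) = slL (ω ∘ₗ f) t := by
  induction t using TensorProduct.induction_on with
  | zero => simp
  | tmul x y => simp
  | add x y hx hy => simp [hx, hy]

theorem slR_lTensor (ω : Module.Dual ℂ P) (f : N →ₗ[ℂ] P) (t : M ⊗[ℂ] N) :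
    slR ω (LinearMap.lTensor M f t) = slR (ω ∘ₗ f) t := by
  induction t using TensorProduct.induction_on with
  | zero => simp
  | tmul x y => simp
  | add x y hx hy => simp [hx, hy]

theorem slL_lTensor (ω : Module.Dual ℂ M) (f : N →ₗ[ℂ] P) (t : M ⊗[ℂ] N) :
    slL ω (LinearMap.lTensor M f t) = f (slL ω t) := by
  induction t using TensorProduct.induction_on with
  | zero => simp
  | tmul x y => simp
  | add x y hx hy => simp [hx, hy]

theorem slR_rTensor (ω : Module.Dual ℂ N) (f : M →ₗ[ℂ] P) (t : M ⊗[ℂ] N) :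
    slR ω (LinearMap.rTensor N f t) = f (slR ω t) := by
  induction t using TensorProduct.induction_on with
  | zero => simp
  | tmul x y => simp
  | add x y hx hy => simp [hx, hy]

@[simp] theorem slL_comm (ω : Module.Dual ℂ N) (t : M ⊗[ℂ] N) :
    slL ω (TensorProduct.comm ℂ M N t) = slR ω t := by
  induction t using TensorProduct.induction_on with
  | zero => simp
  | tmul x y => simp
  | add x y hx hy => simp [hx, hy]

@[simp] theorem slR_comm (ω : Module.Dual ℂ M) (t : M ⊗[ℂ] N) :
    slR ω (TensorProduct.comm ℂ M N t) = slL ω t := by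
  induction t using TensorProduct.induction_on with
  | zero => simp
  | tmul x y => simp
  | add x y hx hy => simp [hx, hy]

theorem apply_slL_comm (ω : Module.Dual ℂ M) (κ : Module.Dual ℂ N) (t : M ⊗[ℂ] N) :
    κ (slL ω t) = ω (slR κ t) := by
  induction t using TensorProduct.induction_on with
  | zero => simp
  | tmul x y => simp [mul_comm]
  | add x y hx hy => simp [hx, hy]

/-- The image of t in (M/V) ⊗ N has only zero slices, and right exactness of the tensor product does
the rest. Fullness of the coproduct, stated through ranges, thereby becomes a statement about
functionals. -/
theorem mem_range_of_slR {V : Submodule ℂ M} {t : M ⊗[ℂ] N}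
    (h : ∀ ω : Module.Dual ℂ N, slR ω t ∈ V) :
    t ∈ LinearMap.range (TensorProduct.map V.subtype (LinearMap.id : N →ₗ[ℂ] N)) := by
  have hex : Function.Exact V.subtype V.mkQ := by
    intro x; simp
  have := (rTensor_exact N hex V.mkQ_surjective) t
  change t ∈ Set.range (LinearMap.rTensor N V.subtype)
  rw [← this]
  apply eq_zero_of_slR
  intro ω
  rw [slR_rTensor]
  simpa using h ω

theorem mem_range_of_slL {V : Submodule ℂ N} {t : M ⊗[ℂ] N}
    (h : ∀ ω : Module.Dual ℂ M, slL ω t ∈ V) :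
    t ∈ LinearMap.range (TensorProduct.map (LinearMap.id : M →ₗ[ℂ] M) V.subtype) := by
  have hex : Function.Exact V.subtype V.mkQ := by
    intro x; simp
  have := (lTensor_exact M hex V.mkQ_surjective) t
  change t ∈ Set.range (LinearMap.lTensor M V.subtype)
  rw [← this]
  apply eq_zero_of_slL
  intro ω
  rw [slL_lTensor]
  simpa using h ω

/-- A linear functional vanishing on a subspace only if it is zero forces the subspace to be
everything. -/
theorem submodule_eq_top_of_dual {V : Submodule ℂ M}
    (h : ∀ κ : Module.Dual ℂ M, (∀ v ∈ V, κ v = 0) → κ = 0) : V = ⊤ := by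
  by_contra hV
  obtain ⟨f, hf, hfV⟩ := Submodule.exists_le_ker_of_lt_top V (lt_top_iff_ne_top.2 hV)
  exact hf (h f fun v hv => hfV hv)

end Slices

/-! ### Multiplication operators and non-degeneracy -/

section Algebra

variable {A : Type*} [NonUnitalRing A] [Module ℂ A] [IsScalarTower ℂ A A] [SMulCommClass ℂ A A]
variable {B : Type*} [NonUnitalRing B] [Module ℂ B] [IsScalarTower ℂ B B] [SMulCommClass ℂ B B]
variable {N : Type*} [AddCommGroup N] [Module ℂ N]

/-- Left multiplication by `d`. -/
noncomputable abbrev mL (d : A) : A →ₗ[ℂ] A := LinearMap.mulLeft ℂ d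

/-- Right multiplication by `d`. -/
noncomputable abbrev mR (d : A) : A →ₗ[ℂ] A := LinearMap.mulRight ℂ d

theorem eq_zero_of_rTensor_mL (hA : IsNondegenerate A) {t : A ⊗[ℂ] N}
    (h : ∀ d : A, LinearMap.rTensor N (mL d) t = 0) : t = 0 := by
  apply eq_zero_of_slR
  intro ω
  apply hA.2
  intro d
  have := slR_rTensor ω (mL d) t
  rw [h d, map_zero] at this
  simpa using this.symm

theorem eq_zero_of_rTensor_mR (hA : IsNondegenerate A) {t : A ⊗[ℂ] N}
    (h : ∀ d : A, LinearMap.rTensor N (mR d) t = 0) : t = 0 := by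
  apply eq_zero_of_slR
  intro ω
  apply hA.1
  intro d
  have := slR_rTensor ω (mR d) t
  rw [h d, map_zero] at this
  simpa using this.symm

theorem eq_zero_of_lTensor_mL (hA : IsNondegenerate A) {t : N ⊗[ℂ] A}
    (h : ∀ d : A, LinearMap.lTensor N (mL d) t = 0) : t = 0 := by
  apply eq_zero_of_slL
  intro ω
  apply hA.2
  intro d
  have := slL_lTensor ω (mL d) t
  rw [h d, map_zero] at this
  simpa using this.symm

theorem eq_zero_of_lTensor_mR (hA : IsNondegenerate A) {t : N ⊗[ℂ] A}
    (h : ∀ d : A, LinearMap.lTensor N (mR d) t = 0) : t = 0 := by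
  apply eq_zero_of_slL
  intro ω
  apply hA.1
  intro d
  have := slL_lTensor ω (mR d) t
  rw [h d, map_zero] at this
  simpa using this.symm

theorem mul_tmul_eq (t : A ⊗[ℂ] B) (x : A) (y : B) :
    t * (x ⊗ₜ y) = LinearMap.rTensor B (mR x) (LinearMap.lTensor A (mR y) t) := by
  induction t using TensorProduct.induction_on with
  | zero => simp
  | tmul a b => simp
  | add a b ha hb => simp [ha, hb, add_mul]

theorem tmul_mul_eq (t : A ⊗[ℂ] B) (x : A) (y : B) :
    (x ⊗ₜ y) * t = LinearMap.rTensor B (mL x) (LinearMap.lTensor A (mL y) t) := by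
  induction t using TensorProduct.induction_on with
  | zero => simp
  | tmul a b => simp
  | add a b ha hb => simp [ha, hb, mul_add]

theorem eq_of_mul_tmul (hA : IsNondegenerate A) (hB : IsNondegenerate B) {s t : A ⊗[ℂ] B}
    (h : ∀ x y, s * (x ⊗ₜ y) = t * (x ⊗ₜ y)) : s = t := by
  rw [← sub_eq_zero]
  apply eq_zero_of_lTensor_mR hB
  intro y
  apply eq_zero_of_rTensor_mR hA
  intro x
  rw [← mul_tmul_eq, sub_mul, h, sub_self]

theorem eq_of_tmul_mul (hA : IsNondegenerate A) (hB : IsNondegenerate B) {s t : A ⊗[ℂ] B}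
    (h : ∀ x y, (x ⊗ₜ y) * s = (x ⊗ₜ y) * t) : s = t := by
  rw [← sub_eq_zero]
  apply eq_zero_of_lTensor_mL hB
  intro y
  apply eq_zero_of_rTensor_mL hA
  intro x
  rw [← tmul_mul_eq, mul_sub, h, sub_self]

theorem IsNondegenerate.tensor (hA : IsNondegenerate A) (hB : IsNondegenerate B) :
    IsNondegenerate (A ⊗[ℂ] B) :=
  ⟨fun t h => eq_of_mul_tmul hA hB fun x y => by rw [h, zero_mul],
    fun t h => eq_of_tmul_mul hA hB fun x y => by rw [h, mul_zero]⟩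

theorem IsNondegenerate.eq_of_mul_right (hA : IsNondegenerate A) {s t : A}
    (h : ∀ x, s * x = t * x) : s = t :=
  sub_eq_zero.1 (hA.1 _ fun x => by rw [sub_mul, h, sub_self])

theorem IsNondegenerate.eq_of_mul_left (hA : IsNondegenerate A) {s t : A}
    (h : ∀ x, x * s = x * t) : s = t :=
  sub_eq_zero.1 (hA.2 _ fun x => by rw [mul_sub, h, sub_self])

/-- No closure under scalars is assumed: c • (ab) = (c • a)b is again a product. -/
theorem IsIdempotentAlgebra.induction (hA : IsIdempotentAlgebra A) {p : A → Prop}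
    (h0 : p 0) (hmul : ∀ a b, p (a * b)) (hadd : ∀ a b, p a → p b → p (a + b)) (a : A) : p a := by
  have ha : a ∈ Submodule.span ℂ {x : A | ∃ a b : A, x = a * b} := by
    rw [hA]; trivial
  induction ha using Submodule.span_induction with
  | mem x hx => obtain ⟨a, b, rfl⟩ := hx; exact hmul a b
  | zero => exact h0
  | add x y _ _ hx hy => exact hadd x y hx hy
  | smul c x hx ih =>
    have : ∀ x ∈ Submodule.span ℂ {x : A | ∃ a b : A, x = a * b}, ∀ c : ℂ, p (c • x) := by
      intro x hx
      induction hx using Submodule.span_induction with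
      | mem x hx =>
        obtain ⟨a, b, rfl⟩ := hx
        intro c; rw [← smul_mul_assoc]; exact hmul _ _
      | zero => intro c; rw [smul_zero]; exact h0
      | add x y _ _ hx hy => intro c; rw [smul_add]; exact hadd _ _ (hx c) (hy c)
      | smul d x _ ih => intro c; rw [smul_smul]; exact ih _
    exact this x hx c

theorem IsIdempotentAlgebra.hom_ext (hA : IsIdempotentAlgebra A) {f g : A →ₗ[ℂ] N}
    (h : ∀ a b, f (a * b) = g (a * b)) : f = g := by
  ext a
  exact hA.induction (p := fun a => f a = g a) (by simp) h (fun a b ha hb => by simp [ha, hb]) a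

namespace Multiplier

theorem left_mul_right (hA : IsNondegenerate A) (m : Multiplier A) (x y : A) :
    m.left (x * y) = m.left x * y := by
  apply hA.eq_of_mul_left
  intro z
  rw [← right_mul_eq, ← mul_assoc, ← mul_assoc, ← right_mul_eq]

theorem right_mul_left (hA : IsNondegenerate A) (m : Multiplier A) (x y : A) :
    m.right (x * y) = x * m.right y := by
  apply hA.eq_of_mul_right
  intro z
  rw [right_mul_eq, mul_assoc, mul_assoc, right_mul_eq]

theorem ext_left (hA : IsNondegenerate A) {m n : Multiplier A} (h : ∀ x, m.left x = n.left x) :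
    m = n := by
  apply ext'
  · ext x; exact h x
  · ext x
    apply hA.eq_of_mul_right
    intro z
    rw [right_mul_eq, right_mul_eq, h]

theorem ext_right (hA : IsNondegenerate A) {m n : Multiplier A} (h : ∀ x, m.right x = n.right x) :
    m = n := by
  apply ext'
  · ext x
    apply hA.eq_of_mul_left
    intro z
    rw [← right_mul_eq, ← right_mul_eq, h]
  · ext x; exact h x

theorem mul_left (m n : Multiplier A) (x : A) : (m * n).left x = m.left (n.left x) := rfl

theorem mul_right (m n : Multiplier A) (x : A) : (m * n).right x = n.right (m.right x) := rfl

theorem one_left (x : A) : (1 : Multiplier A).left x = x := rfl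

theorem one_right (x : A) : (1 : Multiplier A).right x = x := rfl

theorem incl_left (a x : A) : (incl a).left x = a * x := rfl

theorem incl_right (a x : A) : (incl a).right x = x * a := rfl

theorem tmul_left (m : Multiplier A) (n : Multiplier B) :
    (tmul m n).left = TensorProduct.map m.left n.left := rfl

theorem tmul_right (m : Multiplier A) (n : Multiplier B) :
    (tmul m n).right = TensorProduct.map m.right n.right := rfl

theorem incl_injective (hA : IsNondegenerate A) :
    Function.Injective (incl : A →ₗ[ℂ] Multiplier A) := by
  intro s t h
  apply hA.eq_of_mul_right
  intro x
  rw [← incl_left, h, incl_left]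

theorem flip_left (m : Multiplier (A ⊗[ℂ] A)) (x : A ⊗[ℂ] A) :
    (flip m).left x = TensorProduct.comm ℂ A A (m.left (TensorProduct.comm ℂ A A x)) := rfl

theorem flip_right (m : Multiplier (A ⊗[ℂ] A)) (x : A ⊗[ℂ] A) :
    (flip m).right x = TensorProduct.comm ℂ A A (m.right (TensorProduct.comm ℂ A A x)) := rfl

theorem flip_flip (m : Multiplier (A ⊗[ℂ] A)) : flip (flip m) = m := by
  apply ext'
  · ext x y; simp [flip_left]
  · ext x y; simp [flip_right]

end Multiplier

end Algebra

end WMHA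

namespace WMHA

open Multiplier

variable {A : Type*} [NonUnitalRing A] [Module ℂ A] [IsScalarTower ℂ A A] [SMulCommClass ℂ A A]

theorem rTensor_lTensor_apply {M N P Q : Type*} [AddCommGroup M] [Module ℂ M] [AddCommGroup N]
    [Module ℂ N] [AddCommGroup P] [Module ℂ P] [AddCommGroup Q] [Module ℂ Q]
    (f : M →ₗ[ℂ] P) (g : N →ₗ[ℂ] Q) (t : M ⊗[ℂ] N) :
    LinearMap.rTensor Q f (LinearMap.lTensor M g t) =
      LinearMap.lTensor P g (LinearMap.rTensor N f t) := by
  induction t using TensorProduct.induction_on with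
  | zero => simp
  | tmul x y => simp
  | add x y hx hy => simp only [map_add, hx, hy]

section MulTensor

variable {B : Type*} [NonUnitalRing B] [Module ℂ B] [IsScalarTower ℂ B B] [SMulCommClass ℂ B B]

theorem rTensor_mR_mul (t : A ⊗[ℂ] B) (x u : A) (v : B) :
    LinearMap.rTensor B (mR x) t * (u ⊗ₜ v) = t * ((x * u) ⊗ₜ v) := by
  induction t using TensorProduct.induction_on with
  | zero => simp
  | tmul a b => simp [mul_assoc]
  | add a b ha hb => simp only [map_add, add_mul, ha, hb]

theorem lTensor_mR_mul (t : A ⊗[ℂ] B) (u : A) (y v : B) :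
    LinearMap.lTensor A (mR y) t * (u ⊗ₜ v) = t * (u ⊗ₜ (y * v)) := by
  induction t using TensorProduct.induction_on with
  | zero => simp
  | tmul a b => simp [mul_assoc]
  | add a b ha hb => simp only [map_add, add_mul, ha, hb]

theorem mul_rTensor_mL (t : A ⊗[ℂ] B) (x u : A) (v : B) :
    (u ⊗ₜ v) * LinearMap.rTensor B (mL x) t = ((u * x) ⊗ₜ v) * t := by
  induction t using TensorProduct.induction_on with
  | zero => simp
  | tmul a b => simp [mul_assoc]
  | add a b ha hb => simp only [map_add, mul_add, ha, hb]

theorem mul_lTensor_mL (t : A ⊗[ℂ] B) (u : A) (y v : B) :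
    (u ⊗ₜ v) * LinearMap.lTensor A (mL y) t = (u ⊗ₜ (v * y)) * t := by
  induction t using TensorProduct.induction_on with
  | zero => simp
  | tmul a b => simp [mul_assoc]
  | add a b ha hb => simp only [map_add, mul_add, ha, hb]

theorem rTensor_mL_mul (s t : A ⊗[ℂ] B) (x : A) :
    LinearMap.rTensor B (mL x) t * s = LinearMap.rTensor B (mL x) (t * s) := by
  induction t using TensorProduct.induction_on with
  | zero => simp
  | add a b ha hb => simp only [map_add, add_mul, ha, hb]
  | tmul a b =>
    induction s using TensorProduct.induction_on with
    | zero => simp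
    | tmul c d => simp [mul_assoc]
    | add a b ha hb => simp only [map_add, mul_add, ha, hb]

end MulTensor

namespace WeakMultiplierHopfAlgebra

/-! ### The canonical maps and the actions of `Δ(a)` -/

variable (H : WeakMultiplierHopfAlgebra A)

theorem nd (H : WeakMultiplierHopfAlgebra A) : IsNondegenerate A := H.nondegenerate

theorem nd2 (H : WeakMultiplierHopfAlgebra A) : IsNondegenerate (A ⊗[ℂ] A) := H.nd.tensor H.nd

/-- Left multiplication by `Δ(a)`. -/
noncomputable def dl (a : A) : A ⊗[ℂ] A →ₗ[ℂ] A ⊗[ℂ] A := (H.comul a).left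

/-- Right multiplication by `Δ(a)`. -/
noncomputable def dr (a : A) : A ⊗[ℂ] A →ₗ[ℂ] A ⊗[ℂ] A := (H.comul a).right

theorem dl_mul (a b : A) (t : A ⊗[ℂ] A) : H.dl (a * b) t = H.dl a (H.dl b t) := by
  rw [dl, map_mul, mul_left]; rfl

theorem dr_mul (a b : A) (t : A ⊗[ℂ] A) : H.dr (a * b) t = H.dr b (H.dr a t) := by
  rw [dr, map_mul, mul_right]; rfl

theorem dl_mul_right (a : A) (s t : A ⊗[ℂ] A) : H.dl a (s * t) = H.dl a s * t :=
  left_mul_right H.nd2 _ _ _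

theorem dr_mul_left (a : A) (s t : A ⊗[ℂ] A) : H.dr a (s * t) = s * H.dr a t :=
  right_mul_left H.nd2 _ _ _

theorem dr_mul_eq (a : A) (s t : A ⊗[ℂ] A) : H.dr a s * t = s * H.dl a t :=
  right_mul_eq _ _ _

theorem El_mul_right (s t : A ⊗[ℂ] A) : H.E.left (s * t) = H.E.left s * t :=
  left_mul_right H.nd2 _ _ _

theorem Er_mul_left (s t : A ⊗[ℂ] A) : H.E.right (s * t) = s * H.E.right t :=
  right_mul_left H.nd2 _ _ _

theorem T₁_mul (a b x y : A) : H.T₁ (a ⊗ₜ b) * (x ⊗ₜ y) = H.dl a (x ⊗ₜ (b * y)) := by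
  have := congrArg (fun m => Multiplier.left m (x ⊗ₜ[ℂ] y)) (H.T₁_spec a b)
  simpa [incl_left, mul_left, tmul_left, one_left, dl] using this

theorem mul_T₂ (c a x y : A) : (x ⊗ₜ y) * H.T₂ (c ⊗ₜ a) = H.dr a ((x * c) ⊗ₜ y) := by
  have := congrArg (fun m => Multiplier.right m (x ⊗ₜ[ℂ] y)) (H.T₂_spec c a)
  simpa [incl_right, mul_right, tmul_right, one_right, dr] using this

theorem dl_tmul (a x b : A) : H.dl a (x ⊗ₜ b) = LinearMap.rTensor A (mR x) (H.T₁ (a ⊗ₜ b)) := by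
  apply eq_of_mul_tmul H.nd H.nd
  intro u v
  rw [← dl_mul_right, rTensor_mR_mul, T₁_mul]
  simp

theorem dr_tmul (a c y : A) : H.dr a (c ⊗ₜ y) = LinearMap.lTensor A (mL y) (H.T₂ (c ⊗ₜ a)) := by
  apply eq_of_tmul_mul H.nd H.nd
  intro u v
  rw [← dr_mul_left, mul_lTensor_mL, mul_T₂]
  simp

theorem T₂_mul (c a : A) (t : A ⊗[ℂ] A) :
    H.T₂ (c ⊗ₜ a) * t = LinearMap.rTensor A (mL c) (H.dl a t) := by
  apply eq_of_tmul_mul H.nd H.nd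
  intro u v
  rw [← mul_assoc, mul_T₂, dr_mul_eq, mul_rTensor_mL]

theorem T₁_mul_left (a b c : A) : H.T₁ ((a * b) ⊗ₜ c) = H.dl a (H.T₁ (b ⊗ₜ c)) := by
  apply eq_of_mul_tmul H.nd H.nd
  intro x y
  rw [← dl_mul_right, T₁_mul, T₁_mul, dl_mul]

theorem T₂_mul_right (c a b : A) : H.T₂ (c ⊗ₜ (a * b)) = H.dr b (H.T₂ (c ⊗ₜ a)) := by
  apply eq_of_tmul_mul H.nd H.nd
  intro x y
  rw [← dr_mul_left, mul_T₂, mul_T₂, dr_mul]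

/-- `(c ⊗ 1)(Δ(a)(1 ⊗ b)) = ((c ⊗ 1)Δ(a))(1 ⊗ b)`. -/
theorem rTensor_T₁ (a b c : A) : LinearMap.rTensor A (mL c) (H.T₁ (a ⊗ₜ b)) =
    LinearMap.lTensor A (mR b) (H.T₂ (c ⊗ₜ a)) := by
  apply eq_of_mul_tmul H.nd H.nd
  intro x y
  rw [rTensor_mL_mul, lTensor_mR_mul, T₁_mul, T₂_mul]

theorem El_El (t : A ⊗[ℂ] A) : H.E.left (H.E.left t) = H.E.left t := by
  rw [← mul_left, H.E_idem]

theorem Er_Er (t : A ⊗[ℂ] A) : H.E.right (H.E.right t) = H.E.right t := by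
  rw [← mul_right, H.E_idem]

theorem El_T₁ (t : A ⊗[ℂ] A) : H.E.left (H.T₁ t) = H.T₁ t := by
  have : H.T₁ t ∈ LinearMap.range H.E.left := by
    rw [← H.range_T₁]; exact ⟨t, rfl⟩
  obtain ⟨s, hs⟩ := this
  rw [← hs, El_El]

theorem Er_T₂ (t : A ⊗[ℂ] A) : H.E.right (H.T₂ t) = H.T₂ t := by
  have : H.T₂ t ∈ LinearMap.range H.E.right := by
    rw [← H.range_T₂]; exact ⟨t, rfl⟩
  obtain ⟨s, hs⟩ := this
  rw [← hs, Er_Er]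

/-- `E` fixes the range of T₁, and Δ(a)(x ⊗ bc) = T₁(a ⊗ b)(x ⊗ c); idempotence of A covers a
general second leg. -/
theorem El_dl (a : A) (t : A ⊗[ℂ] A) : H.E.left (H.dl a t) = H.dl a t := by
  induction t using TensorProduct.induction_on with
  | zero => simp
  | add x y hx hy => simp only [map_add, hx, hy]
  | tmul x y =>
    refine H.idempotent.induction (p := fun y => H.E.left (H.dl a (x ⊗ₜ y)) = H.dl a (x ⊗ₜ y))
      (by simp) (fun b c => ?_) (fun b c hb hc => ?_) y
    · rw [← T₁_mul, El_mul_right, El_T₁]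
    · simp only [TensorProduct.tmul_add, map_add, hb, hc]

theorem Er_dr (a : A) (t : A ⊗[ℂ] A) : H.E.right (H.dr a t) = H.dr a t := by
  induction t using TensorProduct.induction_on with
  | zero => simp
  | add x y hx hy => simp only [map_add, hx, hy]
  | tmul x y =>
    refine H.idempotent.induction (p := fun x => H.E.right (H.dr a (x ⊗ₜ y)) = H.dr a (x ⊗ₜ y))
      (by simp) (fun b c => ?_) (fun b c hb hc => ?_) x
    · rw [← mul_T₂, Er_mul_left, Er_T₂]
    · simp only [TensorProduct.add_tmul, map_add, hb, hc]

theorem E_mul_comul (a : A) : H.E * H.comul a = H.comul a :=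
  ext_left H.nd2 fun t => H.El_dl a t

theorem comul_mul_E (a : A) : H.comul a * H.E = H.comul a :=
  ext_right H.nd2 fun t => H.Er_dr a t

theorem dl_El (a : A) (t : A ⊗[ℂ] A) : H.dl a (H.E.left t) = H.dl a t := by
  rw [dl, ← mul_left, comul_mul_E]

theorem dr_Er (a : A) (t : A ⊗[ℂ] A) : H.dr a (H.E.right t) = H.dr a t := by
  rw [dr, ← mul_right, E_mul_comul]

theorem slL_counit_T₁ (t : A ⊗[ℂ] A) : slL H.counit (H.T₁ t) = LinearMap.mul' ℂ A t := by
  induction t using TensorProduct.induction_on with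
  | zero => simp
  | add x y hx hy => simp only [map_add, hx, hy]
  | tmul x y => exact H.counit_left x y

theorem slR_counit_T₂ (t : A ⊗[ℂ] A) : slR H.counit (H.T₂ t) = LinearMap.mul' ℂ A t := by
  induction t using TensorProduct.induction_on with
  | zero => simp
  | add x y hx hy => simp only [map_add, hx, hy]
  | tmul x y => exact H.counit_right x y

/-- The left leg of `Δ` is all of `A`: a functional that kills it is zero. -/
theorem dual_eq_zero_of_slL_T₁ (κ : Module.Dual ℂ A) (h : ∀ a b, slL κ (H.T₁ (a ⊗ₜ b)) = 0) :
    κ = 0 := by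
  have : LinearMap.ker κ = ⊤ := H.full.1 _ fun a b => mem_range_of_slR fun ω => by
    rw [LinearMap.mem_ker, ← LinearMap.mem_ker, LinearMap.mem_ker, ← apply_slL_comm, h, map_zero]
  exact LinearMap.ker_eq_top.1 this

theorem dual_eq_zero_of_slR_T₂ (κ : Module.Dual ℂ A) (h : ∀ c a, slR κ (H.T₂ (c ⊗ₜ a)) = 0) :
    κ = 0 := by
  have : LinearMap.ker κ = ⊤ := H.full.2 _ fun a b => mem_range_of_slL fun ω => by
    rw [LinearMap.mem_ker, apply_slL_comm, h, map_zero]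
  exact LinearMap.ker_eq_top.1 this

/-! ### The co-opposite -/

/-- `H'` has the opposite coproduct of `H`. -/
def IsCop (H H' : WeakMultiplierHopfAlgebra A) : Prop := ∀ a, H'.comul a = flip (H.comul a)

namespace IsCop

variable {H} {H' : WeakMultiplierHopfAlgebra A} (h : H.IsCop H')

include h

theorem symm : H'.IsCop H := fun a => by rw [h a, Multiplier.flip_flip]

theorem dl (a : A) (t : A ⊗[ℂ] A) :
    H'.dl a t = TensorProduct.comm ℂ A A (H.dl a (TensorProduct.comm ℂ A A t)) := by
  rw [WeakMultiplierHopfAlgebra.dl, h a, flip_left]; rfl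

theorem dr (a : A) (t : A ⊗[ℂ] A) :
    H'.dr a t = TensorProduct.comm ℂ A A (H.dr a (TensorProduct.comm ℂ A A t)) := by
  rw [WeakMultiplierHopfAlgebra.dr, h a, flip_right]; rfl

/-- The ranges of `E` on the two sides come from Δ(A)(A ⊗ A) and (A ⊗ A)Δ(A), which the flip carries
to those of H'. Each of the two idempotents therefore fixes the range of the other, on the left and
on the right. -/
theorem E : H'.E = flip H.E := by
  have hl : ∀ {K K' : WeakMultiplierHopfAlgebra A}, K.IsCop K' → ∀ t,
      K'.E.left (TensorProduct.comm ℂ A A (K.E.left t)) = TensorProduct.comm ℂ A A (K.E.left t) := by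
    intro K K' h t
    have key : ∀ s u, K'.E.left (TensorProduct.comm ℂ A A (K.T₁ s * u)) =
        TensorProduct.comm ℂ A A (K.T₁ s * u) := by
      intro s u
      induction s using TensorProduct.induction_on with
      | zero => simp
      | add x y hx hy => simp only [map_add, add_mul, hx, hy]
      | tmul a b =>
        induction u using TensorProduct.induction_on with
        | zero => simp
        | add x y hx hy => simp only [map_add, mul_add, hx, hy]
        | tmul x y =>
          rw [T₁_mul]
          have := h.dl a (TensorProduct.comm ℂ A A (x ⊗ₜ[ℂ] (b * y)))
          simp only [TensorProduct.comm_tmul] at this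
          rw [← this, El_dl]
    rw [← sub_eq_zero]
    rw [← LinearEquiv.map_eq_zero_iff (TensorProduct.comm ℂ A A)]
    apply (K.nd2).1
    intro u
    obtain ⟨s, hs⟩ : K.E.left t ∈ LinearMap.range K.T₁ := by
      rw [K.range_T₁]; exact ⟨t, rfl⟩
    have hk := key s u
    rw [Multiplier.comm_mul, El_mul_right, hs] at hk
    have := congrArg (TensorProduct.comm ℂ A A) hk
    simp only [Multiplier.comm_mul] at this
    rw [map_sub, sub_mul, sub_eq_zero]
    simpa using this
  have hr : ∀ {K K' : WeakMultiplierHopfAlgebra A}, K.IsCop K' → ∀ t,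
      K'.E.right (TensorProduct.comm ℂ A A (K.E.right t)) =
        TensorProduct.comm ℂ A A (K.E.right t) := by
    intro K K' h t
    have key : ∀ s u, K'.E.right (TensorProduct.comm ℂ A A (u * K.T₂ s)) =
        TensorProduct.comm ℂ A A (u * K.T₂ s) := by
      intro s u
      induction s using TensorProduct.induction_on with
      | zero => simp
      | add x y hx hy => simp only [map_add, mul_add, hx, hy]
      | tmul a b =>
        induction u using TensorProduct.induction_on with
        | zero => simp
        | add x y hx hy => simp only [map_add, add_mul, hx, hy]
        | tmul x y =>
          rw [mul_T₂]
          have := h.dr b (TensorProduct.comm ℂ A A ((x * a) ⊗ₜ[ℂ] y))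
          simp only [TensorProduct.comm_tmul] at this
          rw [← this, Er_dr]
    rw [← sub_eq_zero]
    rw [← LinearEquiv.map_eq_zero_iff (TensorProduct.comm ℂ A A)]
    apply (K.nd2).2
    intro u
    obtain ⟨s, hs⟩ : K.E.right t ∈ LinearMap.range K.T₂ := by
      rw [K.range_T₂]; exact ⟨t, rfl⟩
    have hk := key s u
    rw [Multiplier.comm_mul, Er_mul_left, hs] at hk
    have := congrArg (TensorProduct.comm ℂ A A) hk
    simp only [Multiplier.comm_mul] at this
    rw [map_sub, mul_sub, sub_eq_zero]
    simpa using this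
  -- `E' (flip E) = flip E` and `(flip E) E' = E'`
  have h1 : flip H.E * H'.E = H'.E := by
    apply ext_left H.nd2
    intro t
    rw [Multiplier.mul_left, flip_left, hl h.symm]
    simp
  have h2 : flip H.E * H'.E = flip H.E := by
    apply ext_right H.nd2
    intro t
    rw [Multiplier.mul_right, flip_right, hr h]
  rw [← h1, h2]

theorem El (t : A ⊗[ℂ] A) :
    H'.E.left t = TensorProduct.comm ℂ A A (H.E.left (TensorProduct.comm ℂ A A t)) := by
  rw [h.E, flip_left]

theorem Er (t : A ⊗[ℂ] A) :
    H'.E.right t = TensorProduct.comm ℂ A A (H.E.right (TensorProduct.comm ℂ A A t)) := by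
  rw [h.E, flip_right]

/-- `((d ⊗ 1)Δ(a))(e ⊗ 1) = (d ⊗ 1)(Δ(a)(e ⊗ 1))`. -/
theorem rTensor_T₂ (d a e : A) : LinearMap.rTensor A (mR e) (H.T₂ (d ⊗ₜ a)) =
    LinearMap.rTensor A (mL d) (TensorProduct.comm ℂ A A (H'.T₁ (a ⊗ₜ e))) := by
  apply eq_of_mul_tmul H.nd H.nd
  intro x y
  rw [rTensor_mR_mul, rTensor_mL_mul, T₂_mul]
  congr 1
  have := H'.T₁_mul a e y x
  rw [h.dl] at this
  have := congrArg (TensorProduct.comm ℂ A A) this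
  simp only [Multiplier.comm_mul, TensorProduct.comm_tmul] at this
  rw [this]
  simp

theorem dl_tmul' (a b y : A) :
    H.dl a (b ⊗ₜ y) = LinearMap.lTensor A (mR y) (TensorProduct.comm ℂ A A (H'.T₁ (a ⊗ₜ b))) := by
  rw [h.symm.dl, TensorProduct.comm_tmul, H'.dl_tmul]
  simp [LinearMap.lTensor_def, LinearMap.rTensor_def, TensorProduct.map_comm]

theorem dr_tmul' (a x c : A) :
    H.dr a (x ⊗ₜ c) = LinearMap.rTensor A (mL x) (TensorProduct.comm ℂ A A (H'.T₂ (c ⊗ₜ a))) := by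
  rw [h.symm.dr, TensorProduct.comm_tmul, H'.dr_tmul]
  simp [LinearMap.lTensor_def, LinearMap.rTensor_def, TensorProduct.map_comm]

end IsCop

end WeakMultiplierHopfAlgebra

end WMHA

namespace WMHA

open Multiplier

variable {A : Type*} [NonUnitalRing A] [Module ℂ A] [IsScalarTower ℂ A A] [SMulCommClass ℂ A A]

/-! ### Operators on two of three legs -/

/-- `Y ⊗ ι` on `A ⊗ (A ⊗ A)`. -/
noncomputable def op12 (Y : Module.End ℂ (A ⊗[ℂ] A)) : Module.End ℂ (A ⊗[ℂ] (A ⊗[ℂ] A)) :=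
  (TensorProduct.assoc ℂ A A A).toLinearMap ∘ₗ LinearMap.rTensor A Y ∘ₗ
    (TensorProduct.assoc ℂ A A A).symm.toLinearMap

/-- `ι ⊗ X` on `A ⊗ (A ⊗ A)`. -/
noncomputable def op23 (X : Module.End ℂ (A ⊗[ℂ] A)) : Module.End ℂ (A ⊗[ℂ] (A ⊗[ℂ] A)) :=
  LinearMap.lTensor A X

theorem op12_tmul (Y : Module.End ℂ (A ⊗[ℂ] A)) (x y z : A) :
    op12 Y (x ⊗ₜ (y ⊗ₜ z)) = TensorProduct.assoc ℂ A A A (Y (x ⊗ₜ y) ⊗ₜ z) := by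
  simp [op12]

@[simp] theorem op23_tmul (X : Module.End ℂ (A ⊗[ℂ] A)) (x : A) (t : A ⊗[ℂ] A) :
    op23 X (x ⊗ₜ t) = x ⊗ₜ X t := by
  simp [op23]

theorem op12_mul (Y Z : Module.End ℂ (A ⊗[ℂ] A)) : op12 (Y * Z) = op12 Y * op12 Z := by
  ext x y z
  simp [op12]

/-- If `R` is a generalized inverse of `T` with `T R = E` and `R T = G`, then whatever commutes with
`T`, `E` and `G` commutes with `R`. -/
theorem commute_of_generalized_inverse {R : Type*} [Monoid R] {T S E G Z : R} (h₁ : T * S = E)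
    (h₂ : S * T = G) (h₃ : S * T * S = S) (hT : Commute Z T) (hE : Commute Z E)
    (hG : Commute Z G) : Commute Z S := by
  have e1 : G * S = S := by rw [← h₂, h₃]
  have e2 : S * E = S := by rw [← h₁, ← mul_assoc, h₃]
  calc Z * S = Z * (G * S) := by rw [e1]
    _ = G * (Z * S) := by rw [← mul_assoc, hG.eq, mul_assoc]
    _ = S * (T * Z) * S := by rw [← h₂]; simp only [mul_assoc]
    _ = S * (Z * T) * S := by rw [hT.eq]
    _ = S * (Z * E) := by rw [← h₁]; simp only [mul_assoc]
    _ = (S * E) * Z := by rw [hE.eq, mul_assoc]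
    _ = S * Z := by rw [e2]

namespace WeakMultiplierHopfAlgebra

variable (H : WeakMultiplierHopfAlgebra A)

/-! ### Slices of the coproduct with reduced functionals -/

/-- The map `a ↦ ∑ a₍₁₎ ω(d a₍₂₎ e)`. -/
noncomputable def lam (ω : Module.Dual ℂ A) (d e : A) : A →ₗ[ℂ] A :=
  slR (ω ∘ₗ mL d) ∘ₗ H.T₁ ∘ₗ (TensorProduct.mk ℂ A A).flip e

/-- The map `a ↦ ∑ ω(d a₍₁₎ e) a₍₂₎`. -/
noncomputable def rho (ω : Module.Dual ℂ A) (d e : A) : A →ₗ[ℂ] A :=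
  slL (ω ∘ₗ mR e) ∘ₗ H.T₂ ∘ₗ TensorProduct.mk ℂ A A d

theorem lam_apply (ω : Module.Dual ℂ A) (d e a : A) :
    H.lam ω d e a = slR (ω ∘ₗ mL d) (H.T₁ (a ⊗ₜ e)) := rfl

theorem rho_apply (ω : Module.Dual ℂ A) (d e a : A) :
    H.rho ω d e a = slL (ω ∘ₗ mR e) (H.T₂ (d ⊗ₜ a)) := rfl

/-- Both sides slice (d ⊗ 1)Δ(a)(e ⊗ 1) with ω in the first leg, bracketed differently. -/
theorem IsCop.lam {H H' : WeakMultiplierHopfAlgebra A} (h : H.IsCop H') (ω : Module.Dual ℂ A)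
    (d e : A) : H'.lam ω d e = H.rho ω d e := by
  ext a
  rw [lam_apply, rho_apply, ← slL_rTensor, h.rTensor_T₂, slL_rTensor, slL_comm]

theorem IsCop.rho {H H' : WeakMultiplierHopfAlgebra A} (h : H.IsCop H') (ω : Module.Dual ℂ A)
    (d e : A) : H'.rho ω d e = H.lam ω d e := (h.symm.lam ω d e).symm

theorem mul_lam (ω : Module.Dual ℂ A) (c d e a : A) :
    c * H.lam ω d e a = slR (ω ∘ₗ mL d ∘ₗ mR e) (H.T₂ (c ⊗ₜ a)) := by
  have := slR_rTensor (ω ∘ₗ mL d) (mL c) (H.T₁ (a ⊗ₜ e))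
  rw [rTensor_T₁, slR_lTensor] at this
  exact this.symm

theorem rho_mul (ω : Module.Dual ℂ A) (c d e a : A) :
    H.rho ω d e a * c = slL (ω ∘ₗ mL d ∘ₗ mR e) (H.T₁ (a ⊗ₜ c)) := by
  have := slL_lTensor (ω ∘ₗ mR e) (mR c) (H.T₂ (d ⊗ₜ a))
  rw [← rTensor_T₁, slL_rTensor] at this
  rw [← LinearMap.mulRight_apply (R := ℂ), rho_apply, ← this]
  congr 2
  ext x; simp [mul_assoc]

theorem counit_lam (ω : Module.Dual ℂ A) (d e a : A) : H.counit (H.lam ω d e a) = ω (d * (a * e)) := by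
  rw [lam_apply, ← apply_slL_comm, slL_counit_T₁]
  simp

theorem counit_rho (ω : Module.Dual ℂ A) (d e a : A) : H.counit (H.rho ω d e a) = ω (d * a * e) := by
  rw [rho_apply, apply_slL_comm, slR_counit_T₂]
  simp

theorem slL_assoc (κ : Module.Dual ℂ A) (t : (A ⊗[ℂ] A) ⊗[ℂ] A) :
    slL κ (TensorProduct.assoc ℂ A A A t) = LinearMap.rTensor A (slL κ) t := by
  induction t using TensorProduct.induction_on with
  | zero => simp
  | add x y hx hy => simp only [map_add, hx, hy]
  | tmul x y =>
    induction x using TensorProduct.induction_on with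
    | zero => simp
    | add x y hx hy => simp only [TensorProduct.add_tmul, map_add, hx, hy]
    | tmul a b => simp [TensorProduct.smul_tmul']

theorem lTensor_slR_assoc (κ : Module.Dual ℂ A) (t : (A ⊗[ℂ] A) ⊗[ℂ] A) :
    LinearMap.lTensor A (slR κ) (TensorProduct.assoc ℂ A A A t) = slR κ t := by
  induction t using TensorProduct.induction_on with
  | zero => simp
  | add x y hx hy => simp only [map_add, hx, hy]
  | tmul x y =>
    induction x using TensorProduct.induction_on with
    | zero => simp
    | add x y hx hy => simp only [TensorProduct.add_tmul, map_add, hx, hy]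
    | tmul a b => simp

theorem slL_op12_T₂ (ω : Module.Dual ℂ A) (d e : A) (t : A ⊗[ℂ] A) :
    slL (ω ∘ₗ mR e) (op12 H.T₂ (d ⊗ₜ t)) = LinearMap.rTensor A (H.rho ω d e) t := by
  induction t using TensorProduct.induction_on with
  | zero => simp
  | add x y hx hy => simp only [TensorProduct.tmul_add, map_add, hx, hy]
  | tmul x y => rw [op12_tmul, slL_assoc]; simp [rho_apply]

theorem lTensor_slR_op23_T₁ (ω : Module.Dual ℂ A) (d e : A) (t : A ⊗[ℂ] A) :
    LinearMap.lTensor A (slR (ω ∘ₗ mL d)) (op23 H.T₁ (TensorProduct.assoc ℂ A A A (t ⊗ₜ e))) =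
      LinearMap.lTensor A (H.lam ω d e) t := by
  induction t using TensorProduct.induction_on with
  | zero => simp
  | add x y hx hy => simp only [TensorProduct.add_tmul, map_add, hx, hy]
  | tmul x y => simp [lam_apply]

/-! ### Separation of tensors by reduced functionals -/

theorem eq_of_slL_mR (H : WeakMultiplierHopfAlgebra A) {N : Type*} [AddCommGroup N] [Module ℂ N]
    {s t : A ⊗[ℂ] N} (h : ∀ (ω : Module.Dual ℂ A) e, slL (ω ∘ₗ mR e) s = slL (ω ∘ₗ mR e) t) : s = t := by
  rw [← sub_eq_zero]
  apply eq_zero_of_rTensor_mR H.nd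
  intro d
  apply eq_zero_of_slL
  intro ω
  rw [slL_rTensor, map_sub, h, sub_self]

theorem eq_of_slL_mL (H : WeakMultiplierHopfAlgebra A) {N : Type*} [AddCommGroup N] [Module ℂ N]
    {s t : A ⊗[ℂ] N} (h : ∀ (ω : Module.Dual ℂ A) e, slL (ω ∘ₗ mL e) s = slL (ω ∘ₗ mL e) t) : s = t := by
  rw [← sub_eq_zero]
  apply eq_zero_of_rTensor_mL H.nd
  intro d
  apply eq_zero_of_slL
  intro ω
  rw [slL_rTensor, map_sub, h, sub_self]

theorem eq_of_slR_mL (H : WeakMultiplierHopfAlgebra A) {N : Type*} [AddCommGroup N] [Module ℂ N]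
    {s t : N ⊗[ℂ] A} (h : ∀ (ω : Module.Dual ℂ A) d, slR (ω ∘ₗ mL d) s = slR (ω ∘ₗ mL d) t) : s = t := by
  rw [← sub_eq_zero]
  apply eq_zero_of_lTensor_mL H.nd
  intro d
  apply eq_zero_of_slR
  intro ω
  rw [slR_lTensor, map_sub, h, sub_self]

theorem eq_of_slR_mR (H : WeakMultiplierHopfAlgebra A) {N : Type*} [AddCommGroup N] [Module ℂ N]
    {s t : N ⊗[ℂ] A} (h : ∀ (ω : Module.Dual ℂ A) d, slR (ω ∘ₗ mR d) s = slR (ω ∘ₗ mR d) t) : s = t := by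
  rw [← sub_eq_zero]
  apply eq_zero_of_lTensor_mR H.nd
  intro d
  apply eq_zero_of_slR
  intro ω
  rw [slR_lTensor, map_sub, h, sub_self]

theorem eq_of_slL_mL_mR (H : WeakMultiplierHopfAlgebra A) {N : Type*} [AddCommGroup N] [Module ℂ N]
    {s t : A ⊗[ℂ] N}
    (h : ∀ (ω : Module.Dual ℂ A) d e, slL (ω ∘ₗ mL d ∘ₗ mR e) s = slL (ω ∘ₗ mL d ∘ₗ mR e) t) :
    s = t :=
  H.eq_of_slL_mR fun ω e => by
    have hh : LinearMap.rTensor N (mR e) s = LinearMap.rTensor N (mR e) t :=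
      H.eq_of_slL_mL fun ω d => by
        rw [slL_rTensor, slL_rTensor]
        exact h ω d e
    rw [← slL_rTensor, ← slL_rTensor, hh]

theorem eq_of_slR_mL_mR (H : WeakMultiplierHopfAlgebra A) {N : Type*} [AddCommGroup N] [Module ℂ N]
    {s t : N ⊗[ℂ] A}
    (h : ∀ (ω : Module.Dual ℂ A) d e, slR (ω ∘ₗ mL d ∘ₗ mR e) s = slR (ω ∘ₗ mL d ∘ₗ mR e) t) :
    s = t :=
  H.eq_of_slR_mR fun ω e => by
    have hh : LinearMap.lTensor N (mR e) s = LinearMap.lTensor N (mR e) t :=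
      H.eq_of_slR_mL fun ω d => by
        rw [slR_lTensor, slR_lTensor]
        exact h ω d e
    rw [← slR_lTensor, ← slR_lTensor, hh]

theorem eq_of_lTensor_slR (H : WeakMultiplierHopfAlgebra A) {s t : A ⊗[ℂ] (A ⊗[ℂ] A)}
    (h : ∀ (ω : Module.Dual ℂ A) d, LinearMap.lTensor A (slR (ω ∘ₗ mL d)) s =
      LinearMap.lTensor A (slR (ω ∘ₗ mL d)) t) : s = t := by
  obtain ⟨s, rfl⟩ := (TensorProduct.assoc ℂ A A A).surjective s
  obtain ⟨t, rfl⟩ := (TensorProduct.assoc ℂ A A A).surjective t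
  exact congrArg _ (H.eq_of_slR_mL fun ω d => by simpa only [lTensor_slR_assoc] using h ω d)

/-- The elements `lam ω d e c` span `A`. -/
theorem lam_hom_ext {N : Type*} [AddCommGroup N] [Module ℂ N] {f g : A →ₗ[ℂ] N}
    (h : ∀ ω d e c, f (H.lam ω d e c) = g (H.lam ω d e c)) : f = g := by
  have : LinearMap.ker (f - g) = ⊤ := H.full.1 _ fun a b => mem_range_of_slR fun ω => by
    have key : LinearMap.rTensor A (f - g) (H.T₁ (a ⊗ₜ b)) = 0 := H.eq_of_slR_mL fun ω d => by
      rw [slR_rTensor, map_zero, ← lam_apply, LinearMap.sub_apply, h, sub_self]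
    rw [LinearMap.mem_ker, ← slR_rTensor, key, map_zero]
  exact sub_eq_zero.1 (LinearMap.ker_eq_top.1 this)

theorem rho_hom_ext {N : Type*} [AddCommGroup N] [Module ℂ N] {f g : A →ₗ[ℂ] N}
    (h : ∀ ω d e c, f (H.rho ω d e c) = g (H.rho ω d e c)) : f = g := by
  have : LinearMap.ker (f - g) = ⊤ := H.full.2 _ fun a b => mem_range_of_slL fun ω => by
    have key : LinearMap.lTensor A (f - g) (H.T₂ (a ⊗ₜ b)) = 0 := H.eq_of_slL_mR fun ω d => by
      rw [slL_lTensor, map_zero, ← rho_apply, LinearMap.sub_apply, h, sub_self]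
    rw [LinearMap.mem_ker, ← slL_lTensor, key, map_zero]
  exact sub_eq_zero.1 (LinearMap.ker_eq_top.1 this)

/-! ### Operators that are colinear in one leg -/

/-- `X` commutes with all `rho ω d e ⊗ ι`. -/
def Comm1 (X : Module.End ℂ (A ⊗[ℂ] A)) : Prop :=
  ∀ ω d e, Commute (LinearMap.rTensor A (H.rho ω d e) : Module.End ℂ (A ⊗[ℂ] A)) X

/-- `Y` commutes with all `ι ⊗ lam ω d e`. -/
def Comm2 (Y : Module.End ℂ (A ⊗[ℂ] A)) : Prop :=
  ∀ ω d e, Commute (LinearMap.lTensor A (H.lam ω d e) : Module.End ℂ (A ⊗[ℂ] A)) Y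

/-- `σ X σ`. -/
noncomputable def conj (X : Module.End ℂ (A ⊗[ℂ] A)) : Module.End ℂ (A ⊗[ℂ] A) :=
  (TensorProduct.comm ℂ A A).toLinearMap ∘ₗ X ∘ₗ (TensorProduct.comm ℂ A A).toLinearMap

theorem conj_apply (X : Module.End ℂ (A ⊗[ℂ] A)) (t : A ⊗[ℂ] A) :
    conj X t = TensorProduct.comm ℂ A A (X (TensorProduct.comm ℂ A A t)) := rfl

variable {H}

theorem Comm1.apply {X : Module.End ℂ (A ⊗[ℂ] A)} (hX : H.Comm1 X) (ω : Module.Dual ℂ A) (d e : A)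
    (t : A ⊗[ℂ] A) : X (LinearMap.rTensor A (H.rho ω d e) t) =
      LinearMap.rTensor A (H.rho ω d e) (X t) :=
  (LinearMap.congr_fun (hX ω d e).eq t).symm

theorem Comm2.apply {X : Module.End ℂ (A ⊗[ℂ] A)} (hX : H.Comm2 X) (ω : Module.Dual ℂ A) (d e : A)
    (t : A ⊗[ℂ] A) : X (LinearMap.lTensor A (H.lam ω d e) t) =
      LinearMap.lTensor A (H.lam ω d e) (X t) :=
  (LinearMap.congr_fun (hX ω d e).eq t).symm

theorem Comm1.intro {X : Module.End ℂ (A ⊗[ℂ] A)} (h : ∀ ω d e a b,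
    X (H.rho ω d e a ⊗ₜ b) = LinearMap.rTensor A (H.rho ω d e) (X (a ⊗ₜ b))) : H.Comm1 X := by
  intro ω d e
  change _ * _ = _ * _
  ext a b
  simp [h]

theorem Comm2.intro {X : Module.End ℂ (A ⊗[ℂ] A)} (h : ∀ ω d e a b,
    X (a ⊗ₜ H.lam ω d e b) = LinearMap.lTensor A (H.lam ω d e) (X (a ⊗ₜ b))) : H.Comm2 X := by
  intro ω d e
  change _ * _ = _ * _
  ext a b
  simp [h]

/-- The slice of T₂ ⊗ ι at d by ω(· e) in the first leg is rho ω d e ⊗ ι, and these slices separate.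
-/
theorem Comm1.op (X : Module.End ℂ (A ⊗[ℂ] A)) (hX : H.Comm1 X) :
    Commute (op12 H.T₂) (op23 X) := by
  change _ * _ = _ * _
  apply LinearMap.ext
  intro t
  induction t using TensorProduct.induction_on with
  | zero => simp
  | add x y hx hy => simp only [map_add, hx, hy]
  | tmul d t =>
    apply H.eq_of_slL_mR
    intro ω e
    simp only [Module.End.mul_apply]
    rw [op23_tmul, slL_op12_T₂, op23, slL_lTensor, slL_op12_T₂, hX.apply]

theorem Comm1.of_op {X : Module.End ℂ (A ⊗[ℂ] A)}
    (h : ∀ d t, op12 H.T₂ (d ⊗ₜ X t) = op23 X (op12 H.T₂ (d ⊗ₜ t))) : H.Comm1 X := by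
  apply Comm1.intro
  intro ω d e a b
  rw [← slL_op12_T₂, h, op23, slL_lTensor, slL_op12_T₂, LinearMap.rTensor_tmul]

theorem Comm2.op (X : Module.End ℂ (A ⊗[ℂ] A)) (hX : H.Comm2 X) :
    Commute (op12 X) (op23 H.T₁) := by
  change _ * _ = _ * _
  apply TensorProduct.ext_threefold'
  intro x y z
  apply H.eq_of_lTensor_slR
  intro ω d
  have h1 : ∀ t : A ⊗[ℂ] (A ⊗[ℂ] A), LinearMap.lTensor A (slR (ω ∘ₗ mL d)) (op12 X t) =
      X (LinearMap.lTensor A (slR (ω ∘ₗ mL d)) t) := by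
    intro t
    obtain ⟨t, rfl⟩ := (TensorProduct.assoc ℂ A A A).surjective t
    simp only [op12, LinearMap.comp_apply, LinearEquiv.coe_coe, LinearEquiv.symm_apply_apply]
    rw [lTensor_slR_assoc, lTensor_slR_assoc, slR_rTensor]
  simp only [Module.End.mul_apply]
  rw [h1, op12_tmul, lTensor_slR_op23_T₁]
  simp only [op23_tmul, LinearMap.lTensor_tmul, ← lam_apply]
  rw [← hX.apply, LinearMap.lTensor_tmul]

/-- This is the coassociativity axiom. -/
theorem comm1_T₁ : H.Comm1 H.T₁ := by
  apply Comm1.of_op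
  intro d t
  induction t using TensorProduct.induction_on with
  | zero => simp
  | add x y hx hy => simp only [map_add, TensorProduct.tmul_add, hx, hy]
  | tmul x y => rw [op12_tmul]; exact H.coassoc d x y

theorem lam_rho (ω ω' : Module.Dual ℂ A) (d e d' e' a : A) :
    H.lam ω' d' e' (H.rho ω d e a) = H.rho ω d e (H.lam ω' d' e' a) := by
  rw [lam_apply, lam_apply, ← LinearMap.rTensor_tmul, comm1_T₁.apply, slR_rTensor]

theorem comm2_T₂ : H.Comm2 H.T₂ := by
  apply Comm2.intro
  intro ω d e a b
  apply H.eq_of_slL_mR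
  intro κ x
  rw [slL_lTensor, ← rho_apply, ← rho_apply, lam_rho]

namespace IsCop

variable {H' : WeakMultiplierHopfAlgebra A} (h : H.IsCop H')

include h

theorem comm2_conj {X : Module.End ℂ (A ⊗[ℂ] A)} (hX : H'.Comm1 X) : H.Comm2 (conj X) := by
  apply Comm2.intro
  intro ω d e a b
  have := hX.apply ω d e (b ⊗ₜ a)
  simp only [conj_apply, TensorProduct.comm_tmul]
  rw [LinearMap.rTensor_tmul, h.rho] at this
  rw [this]
  simp [LinearMap.lTensor_def, LinearMap.rTensor_def, TensorProduct.map_comm]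

theorem comm1_conj {X : Module.End ℂ (A ⊗[ℂ] A)} (hX : H'.Comm2 X) : H.Comm1 (conj X) := by
  apply Comm1.intro
  intro ω d e a b
  have := hX.apply ω d e (b ⊗ₜ a)
  simp only [conj_apply, TensorProduct.comm_tmul]
  rw [LinearMap.lTensor_tmul, h.lam] at this
  rw [this]
  simp [LinearMap.lTensor_def, LinearMap.rTensor_def, TensorProduct.map_comm]

end IsCop

end WeakMultiplierHopfAlgebra

end WMHA

namespace WMHA

open Multiplier

variable {A : Type*} [NonUnitalRing A] [Module ℂ A] [IsScalarTower ℂ A A] [SMulCommClass ℂ A A]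

theorem assoc_mul (s t : (A ⊗[ℂ] A) ⊗[ℂ] A) : TensorProduct.assoc ℂ A A A (s * t) =
    TensorProduct.assoc ℂ A A A s * TensorProduct.assoc ℂ A A A t := by
  apply (TensorProduct.assoc ℂ A A A).symm.injective
  rw [assoc_symm_mul]
  simp

namespace Multiplier

@[simp] theorem left_zero : (0 : Multiplier A).left = 0 := rfl

@[simp] theorem right_zero : (0 : Multiplier A).right = 0 := rfl

end Multiplier

namespace WeakMultiplierHopfAlgebra

variable (H : WeakMultiplierHopfAlgebra A)

/-! ### Colinearity of the canonical idempotent -/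

theorem comul_left (a : A) : (H.comul a).left = H.dl a := rfl

theorem comul_right (a : A) : (H.comul a).right = H.dr a := rfl

theorem comulId_tmul (a b : A) : H.comulId (a ⊗ₜ b) = tmul (H.comul a) (incl b) := rfl

theorem leg12_E_mul_comulId (t : A ⊗[ℂ] A) : leg12 H.E * H.comulId t = H.comulId t := by
  apply ext_left (H.nd2.tensor H.nd)
  intro u
  induction t using TensorProduct.induction_on with
  | zero => simp
  | add x y hx hy => simp only [map_add, mul_add, left_add, LinearMap.add_apply, hx, hy]
  | tmul a b =>
    induction u using TensorProduct.induction_on with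
    | zero => simp
    | add x y hx hy => simp only [map_add, hx, hy]
    | tmul x y =>
      rw [mul_left, comulId_tmul, leg12, tmul_left, tmul_left]
      simp only [TensorProduct.map_tmul]
      rw [comul_left, El_dl, one_left]

theorem comulId_mul_leg12_E (t : A ⊗[ℂ] A) : H.comulId t * leg12 H.E = H.comulId t := by
  apply ext_right (H.nd2.tensor H.nd)
  intro u
  induction t using TensorProduct.induction_on with
  | zero => simp
  | add x y hx hy => simp only [map_add, add_mul, right_add, LinearMap.add_apply, hx, hy]
  | tmul a b =>
    induction u using TensorProduct.induction_on with
    | zero => simp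
    | add x y hx hy => simp only [map_add, hx, hy]
    | tmul x y =>
      rw [mul_right, comulId_tmul, leg12, tmul_right, tmul_right]
      simp only [TensorProduct.map_tmul]
      rw [comul_right, Er_dr, one_right]

/-- The extension of Δ ⊗ ι sends E to (E ⊗ 1)(1 ⊗ E), and the factor E ⊗ 1 is absorbed by (Δ ⊗
ι)(t). This is what makes multiplication by `E` colinear in the first leg (`comm1_El`). -/
theorem leg23_E_mul_comulId (t : A ⊗[ℂ] A) :
    leg23 H.E * H.comulId t = H.comulId (H.E.left t) := by
  have key : ∀ t, leg12 H.E * leg23 H.E * H.comulId t = H.comulId (H.E.left t) := by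
    intro t
    obtain ⟨-, -, h⟩ := H.comul_E
    exact (h t).1
  rw [← key, H.E_comm, mul_assoc, leg12_E_mul_comulId]

theorem comulId_mul_leg23_E (t : A ⊗[ℂ] A) :
    H.comulId t * leg23 H.E = H.comulId (H.E.right t) := by
  obtain ⟨-, -, h⟩ := H.comul_E
  rw [← (h t).2, ← mul_assoc, comulId_mul_leg12_E]

theorem assoc_leg23_left (m : Multiplier (A ⊗[ℂ] A)) (t : (A ⊗[ℂ] A) ⊗[ℂ] A) :
    TensorProduct.assoc ℂ A A A ((leg23 m).left t) =
      op23 m.left (TensorProduct.assoc ℂ A A A t) := by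
  simp only [leg23, transport, left_mk, LinearMap.comp_apply, LinearEquiv.coe_coe,
    LinearEquiv.symm_symm, LinearEquiv.apply_symm_apply]
  rfl

theorem assoc_leg23_right (m : Multiplier (A ⊗[ℂ] A)) (t : (A ⊗[ℂ] A) ⊗[ℂ] A) :
    TensorProduct.assoc ℂ A A A ((leg23 m).right t) =
      op23 m.right (TensorProduct.assoc ℂ A A A t) := by
  simp only [leg23, transport, right_mk, LinearMap.comp_apply, LinearEquiv.coe_coe,
    LinearEquiv.symm_symm, LinearEquiv.apply_symm_apply]
  rfl

theorem assoc_leg12_left (m : Multiplier (A ⊗[ℂ] A)) (t : (A ⊗[ℂ] A) ⊗[ℂ] A) :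
    TensorProduct.assoc ℂ A A A ((leg12 m).left t) =
      op12 m.left (TensorProduct.assoc ℂ A A A t) := by
  simp only [leg12, tmul_left, op12, LinearMap.comp_apply, LinearEquiv.coe_coe,
    LinearEquiv.symm_apply_apply]
  rfl

theorem assoc_leg12_right (m : Multiplier (A ⊗[ℂ] A)) (t : (A ⊗[ℂ] A) ⊗[ℂ] A) :
    TensorProduct.assoc ℂ A A A ((leg12 m).right t) =
      op12 m.right (TensorProduct.assoc ℂ A A A t) := by
  simp only [leg12, tmul_right, op12, LinearMap.comp_apply, LinearEquiv.coe_coe,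
    LinearEquiv.symm_apply_apply]
  rfl

theorem op12_El_op23_El : Commute (op12 H.E.left) (op23 H.E.left) := by
  change _ * _ = _ * _
  apply LinearMap.ext
  intro t
  obtain ⟨t, rfl⟩ := (TensorProduct.assoc ℂ A A A).surjective t
  simp only [Module.End.mul_apply]
  rw [← assoc_leg23_left, ← assoc_leg12_left, ← assoc_leg12_left, ← assoc_leg23_left,
    ← mul_left, ← mul_left, H.E_comm]

theorem op12_Er_op23_Er : Commute (op12 H.E.right) (op23 H.E.right) := by
  change _ * _ = _ * _
  apply LinearMap.ext
  intro t
  obtain ⟨t, rfl⟩ := (TensorProduct.assoc ℂ A A A).surjective t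
  simp only [Module.End.mul_apply]
  rw [← assoc_leg23_right, ← assoc_leg12_right, ← assoc_leg12_right, ← assoc_leg23_right,
    ← mul_right, ← mul_right, H.E_comm]

theorem op12_T₂_mul (d : A) (t : A ⊗[ℂ] A) (u : (A ⊗[ℂ] A) ⊗[ℂ] A) :
    op12 H.T₂ (d ⊗ₜ t) * TensorProduct.assoc ℂ A A A u =
      LinearMap.rTensor (A ⊗[ℂ] A) (mL d) (TensorProduct.assoc ℂ A A A ((H.comulId t).left u)) := by
  induction t using TensorProduct.induction_on with
  | zero => simp
  | add x y hx hy =>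
    simp only [map_add, TensorProduct.tmul_add, add_mul, left_add, LinearMap.add_apply, hx, hy]
  | tmul a b =>
    induction u using TensorProduct.induction_on with
    | zero => simp
    | add x y hx hy => simp only [map_add, mul_add, hx, hy]
    | tmul x y =>
      rw [op12_tmul, ← assoc_mul, Algebra.TensorProduct.tmul_mul_tmul, T₂_mul, comulId_tmul,
        tmul_left, TensorProduct.map_tmul, comul_left, incl_left]
      generalize H.dl a x = s
      induction s using TensorProduct.induction_on with
      | zero => simp
      | add x y hx hy => simp only [map_add, TensorProduct.add_tmul, hx, hy]
      | tmul p q => simp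

theorem mul_op12_T₂ (d x y z : A) (t : A ⊗[ℂ] A) :
    (x ⊗ₜ (y ⊗ₜ z)) * op12 H.T₂ (d ⊗ₜ t) =
      TensorProduct.assoc ℂ A A A ((H.comulId t).right (((x * d) ⊗ₜ y) ⊗ₜ z)) := by
  induction t using TensorProduct.induction_on with
  | zero => simp
  | add x y hx hy =>
    simp only [map_add, TensorProduct.tmul_add, mul_add, right_add, LinearMap.add_apply, hx, hy]
  | tmul a b =>
    rw [op12_tmul, ← TensorProduct.assoc_tmul, ← assoc_mul, Algebra.TensorProduct.tmul_mul_tmul,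
      mul_T₂, comulId_tmul, tmul_right, TensorProduct.map_tmul, comul_right, incl_right]

theorem op23_El_mul (s u : A ⊗[ℂ] (A ⊗[ℂ] A)) :
    op23 H.E.left s * u = op23 H.E.left (s * u) := by
  induction s using TensorProduct.induction_on with
  | zero => simp
  | add x y hx hy => simp only [map_add, add_mul, hx, hy]
  | tmul a b =>
    induction u using TensorProduct.induction_on with
    | zero => simp
    | add x y hx hy => simp only [map_add, mul_add, hx, hy]
    | tmul x y => simp [El_mul_right]

theorem mul_op23_Er (s u : A ⊗[ℂ] (A ⊗[ℂ] A)) :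
    u * op23 H.E.right s = op23 H.E.right (u * s) := by
  induction s using TensorProduct.induction_on with
  | zero => simp
  | add x y hx hy => simp only [map_add, mul_add, hx, hy]
  | tmul a b =>
    induction u using TensorProduct.induction_on with
    | zero => simp
    | add x y hx hy => simp only [map_add, add_mul, hx, hy]
    | tmul x y => simp [Er_mul_left]

theorem comm1_El : H.Comm1 H.E.left := by
  apply Comm1.of_op
  intro d t
  apply (H.nd.tensor H.nd2).eq_of_mul_right
  intro u
  obtain ⟨u, rfl⟩ := (TensorProduct.assoc ℂ A A A).surjective u
  rw [op12_T₂_mul, op23_El_mul, op12_T₂_mul, ← leg23_E_mul_comulId, mul_left, assoc_leg23_left]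
  rw [op23, rTensor_lTensor_apply]

theorem comm1_Er : H.Comm1 H.E.right := by
  apply Comm1.of_op
  intro d t
  apply eq_of_tmul_mul H.nd H.nd2
  intro x u
  induction u using TensorProduct.induction_on with
  | zero => simp
  | add x y hx hy => simp only [TensorProduct.tmul_add, add_mul, hx, hy]
  | tmul y z =>
    rw [mul_op12_T₂, mul_op23_Er, mul_op12_T₂, ← comulId_mul_leg23_E, mul_right, assoc_leg23_right]

-- The axiom on (Δ ⊗ ι)(E) for H', flipped, plays the role of a formula for (ι ⊗ Δ)(E). In this way
-- regularity supplies colinearity in the second leg.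
variable {H} in
theorem IsCop.comm2_El {H' : WeakMultiplierHopfAlgebra A} (h : H.IsCop H') :
    H.Comm2 H.E.left := by
  have := h.comm2_conj H'.comm1_El
  convert this using 1
  ext x y
  simp [conj_apply, h.El]

variable {H} in
theorem IsCop.comm2_Er {H' : WeakMultiplierHopfAlgebra A} (h : H.IsCop H') :
    H.Comm2 H.E.right := by
  have := h.comm2_conj H'.comm1_Er
  convert this using 1
  ext x y
  simp [conj_apply, h.Er]

/-! ### The maps `G₁` and `G₂` -/

/-- `w ⊗ e ↦ (c ↦ lam ω d e c ⊗ w)`. -/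
noncomputable def lamKernel (ω : Module.Dual ℂ A) (d : A) :
    A ⊗[ℂ] A →ₗ[ℂ] A →ₗ[ℂ] A ⊗[ℂ] A :=
  TensorProduct.lift (LinearMap.mk₂ ℂ
    (fun w e => (TensorProduct.mk ℂ A A).flip w ∘ₗ H.lam ω d e)
    (fun w w' e => by ext; simp)
    (fun c w e => by ext; simp)
    (fun w e e' => by ext; simp [lam_apply, TensorProduct.tmul_add])
    (fun c w e => by ext; simp [lam_apply]))

theorem lamKernel_tmul (ω : Module.Dual ℂ A) (d w e c : A) :
    H.lamKernel ω d (w ⊗ₜ e) c = H.lam ω d e c ⊗ₜ w := rfl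

/-- `d ⊗ b ↦ (c ↦ b ⊗ rho ω d e c)`. -/
noncomputable def rhoKernel (ω : Module.Dual ℂ A) (e : A) :
    A ⊗[ℂ] A →ₗ[ℂ] A →ₗ[ℂ] A ⊗[ℂ] A :=
  TensorProduct.lift (LinearMap.mk₂ ℂ
    (fun d b => TensorProduct.mk ℂ A A b ∘ₗ H.rho ω d e)
    (fun w e e' => by ext; simp [rho_apply, TensorProduct.tmul_add, TensorProduct.add_tmul])
    (fun c w e => by ext; simp [rho_apply, ← TensorProduct.smul_tmul'])
    (fun w w' e => by ext; simp)
    (fun c w e => by ext; simp [TensorProduct.smul_tmul']))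

theorem rhoKernel_tmul (ω : Module.Dual ℂ A) (e d b c : A) :
    H.rhoKernel ω e (d ⊗ₜ b) c = b ⊗ₜ H.rho ω d e c := rfl

theorem slR_T₁OnLegs13 (ω : Module.Dual ℂ A) (d c : A) (t : A ⊗[ℂ] A) :
    slR (ω ∘ₗ mL d) ((TensorProduct.assoc ℂ A A A).symm (H.T₁OnLegs13 (c ⊗ₜ t))) =
      H.lamKernel ω d t c := by
  induction t using TensorProduct.induction_on with
  | zero => simp
  | add x y hx hy => simp only [TensorProduct.tmul_add, map_add, hx, hy, LinearMap.add_apply]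
  | tmul w e =>
    rw [lamKernel_tmul, lam_apply]
    simp only [Coproduct.T₁OnLegs13, LinearMap.comp_apply, LinearEquiv.coe_coe,
      TensorProduct.leftComm_tmul, TensorProduct.map_tmul, LinearMap.id_apply]
    generalize H.T₁ (c ⊗ₜ e) = s
    induction s using TensorProduct.induction_on with
    | zero => simp
    | add x y hx hy => simp only [TensorProduct.tmul_add, map_add, hx, hy, TensorProduct.add_tmul]
    | tmul p q => simp [TensorProduct.smul_tmul']

theorem slL_T₂OnLegs13 (ω : Module.Dual ℂ A) (e c : A) (t : A ⊗[ℂ] A) :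
    slL (ω ∘ₗ mR e) (TensorProduct.assoc ℂ A A A (H.T₂OnLegs13 (t ⊗ₜ c))) =
      H.rhoKernel ω e t c := by
  induction t using TensorProduct.induction_on with
  | zero => simp
  | add x y hx hy => simp only [TensorProduct.add_tmul, map_add, hx, hy, LinearMap.add_apply]
  | tmul d b =>
    rw [rhoKernel_tmul, rho_apply]
    simp only [Coproduct.T₂OnLegs13, LinearMap.comp_apply, LinearEquiv.coe_coe,
      TensorProduct.rightComm_tmul, TensorProduct.map_tmul, LinearMap.id_apply]
    generalize H.T₂ (d ⊗ₜ c) = s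
    induction s using TensorProduct.induction_on with
    | zero => simp
    | add x y hx hy => simp only [TensorProduct.tmul_add, map_add, hx, hy, TensorProduct.add_tmul]
    | tmul p q => simp

/-- A slice of the defining identity of `G₁` in the third leg. It determines `G₁`, since the
elements `lam ω d e c` span A. -/
theorem G₁_lam (ω : Module.Dual ℂ A) (d e c w : A) :
    H.G₁ (H.lam ω d e c ⊗ₜ w) = H.lamKernel ω d (H.E.left (w ⊗ₜ e)) c := by
  have := congrArg (slR (ω ∘ₗ mL d)) (H.G₁_spec c w e)
  rw [slR_T₁OnLegs13] at this
  rw [← this]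
  change _ = slR (ω ∘ₗ mL d) (LinearMap.rTensor A H.G₁ _)
  rw [slR_rTensor, slR_T₁OnLegs13, lamKernel_tmul]

theorem G₂_rho (ω : Module.Dual ℂ A) (d e c b : A) :
    H.G₂ (b ⊗ₜ H.rho ω d e c) = H.rhoKernel ω e (H.E.right (d ⊗ₜ b)) c := by
  have := congrArg (slL (ω ∘ₗ mR e)) (H.G₂_spec d b c)
  rw [slL_T₂OnLegs13] at this
  rw [← this]
  change _ = slL (ω ∘ₗ mR e) (LinearMap.lTensor A H.G₂ _)
  rw [slL_lTensor, slL_T₂OnLegs13, rhoKernel_tmul]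

theorem comm1_G₁ : H.Comm1 H.G₁ := by
  apply Comm1.intro
  intro ω d e a b
  have key : H.G₁ ∘ₗ (TensorProduct.mk ℂ A A).flip b ∘ₗ H.rho ω d e =
      LinearMap.rTensor A (H.rho ω d e) ∘ₗ H.G₁ ∘ₗ (TensorProduct.mk ℂ A A).flip b := by
    apply H.lam_hom_ext
    intro ω' d' e' c
    simp only [LinearMap.comp_apply, LinearMap.flip_apply, TensorProduct.mk_apply]
    rw [← lam_rho, G₁_lam, G₁_lam]
    generalize H.E.left (b ⊗ₜ e') = s
    induction s using TensorProduct.induction_on with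
    | zero => simp
    | add x y hx hy => simp only [map_add, hx, hy, LinearMap.add_apply]
    | tmul p q => rw [lamKernel_tmul, lamKernel_tmul, LinearMap.rTensor_tmul, lam_rho]
  exact LinearMap.congr_fun key a

/-- On b ⊗ rho ω d e c the map `G₂` replaces d ⊗ b by (d ⊗ b)E and leaves c alone. The result is a
combination of maps `rho` applied to c, and X commutes with each of them. -/
theorem Comm1.op_G₂ {H : WeakMultiplierHopfAlgebra A} {X : Module.End ℂ (A ⊗[ℂ] A)}
    (hX : H.Comm1 X) : Commute (op12 H.G₂) (op23 X) := by
  have key : ∀ (b w : A), op12 H.G₂ ∘ₗ op23 X ∘ₗ TensorProduct.mk ℂ A (A ⊗[ℂ] A) b ∘ₗ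
      (TensorProduct.mk ℂ A A).flip w = op23 X ∘ₗ op12 H.G₂ ∘ₗ TensorProduct.mk ℂ A (A ⊗[ℂ] A) b ∘ₗ
      (TensorProduct.mk ℂ A A).flip w := by
    intro b w
    apply H.rho_hom_ext
    intro ω d e c
    simp only [LinearMap.comp_apply, LinearMap.flip_apply, TensorProduct.mk_apply, op23_tmul]
    rw [op12_tmul, G₂_rho]
    have h1 : ∀ t : A ⊗[ℂ] A, op12 H.G₂ (b ⊗ₜ LinearMap.rTensor A (H.rho ω d e) t) =
        TensorProduct.assoc ℂ A A A (LinearMap.rTensor A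
          (H.rhoKernel ω e (H.E.right (d ⊗ₜ b))) t) := by
      intro t
      induction t using TensorProduct.induction_on with
      | zero => simp
      | add x y hx hy => simp only [map_add, TensorProduct.tmul_add, hx, hy]
      | tmul p q => rw [LinearMap.rTensor_tmul, op12_tmul, G₂_rho, LinearMap.rTensor_tmul]
    rw [← LinearMap.rTensor_tmul, hX.apply, h1, ← LinearMap.rTensor_tmul]
    generalize H.E.right (d ⊗ₜ b) = s
    have h2 : ∀ (p q : A) (t : A ⊗[ℂ] A), TensorProduct.assoc ℂ A A A
        (LinearMap.rTensor A (H.rhoKernel ω e (p ⊗ₜ q)) t) =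
        q ⊗ₜ LinearMap.rTensor A (H.rho ω p e) t := by
      intro p q t
      induction t using TensorProduct.induction_on with
      | zero => simp
      | add x y hx hy => simp only [map_add, TensorProduct.tmul_add, hx, hy]
      | tmul x y => simp [rhoKernel_tmul]
    induction s using TensorProduct.induction_on with
    | zero => simp
    | add x y hx hy =>
      simp only [map_add, LinearMap.rTensor_add, LinearMap.add_apply, hx, hy]
    | tmul p q => rw [h2, h2, op23_tmul, hX.apply]
  change _ * _ = _ * _
  apply TensorProduct.ext_threefold'
  intro x y z
  exact LinearMap.congr_fun (key x z) y

theorem comm2_G₂ : H.Comm2 H.G₂ := by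
  apply Comm2.intro
  intro ω d e a b
  have key : H.G₂ ∘ₗ TensorProduct.mk ℂ A A a ∘ₗ H.lam ω d e =
      LinearMap.lTensor A (H.lam ω d e) ∘ₗ H.G₂ ∘ₗ TensorProduct.mk ℂ A A a := by
    apply H.rho_hom_ext
    intro ω' d' e' c
    simp only [LinearMap.comp_apply, TensorProduct.mk_apply]
    rw [lam_rho, G₂_rho, G₂_rho]
    generalize H.E.right (d' ⊗ₜ a) = s
    induction s using TensorProduct.induction_on with
    | zero => simp
    | add x y hx hy => simp only [map_add, hx, hy, LinearMap.add_apply]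
    | tmul p q => rw [rhoKernel_tmul, rhoKernel_tmul, LinearMap.lTensor_tmul, lam_rho]
  exact LinearMap.congr_fun key b

/-- Idempotence is inherited from `E` through `G₁_lam`. -/
theorem G₁_G₁ (t : A ⊗[ℂ] A) : H.G₁ (H.G₁ t) = H.G₁ t := by
  induction t using TensorProduct.induction_on with
  | zero => simp
  | add x y hx hy => simp only [map_add, hx, hy]
  | tmul a w =>
    have key : H.G₁ ∘ₗ H.G₁ ∘ₗ (TensorProduct.mk ℂ A A).flip w =
        H.G₁ ∘ₗ (TensorProduct.mk ℂ A A).flip w := by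
      apply H.lam_hom_ext
      intro ω d e c
      simp only [LinearMap.comp_apply, LinearMap.flip_apply, TensorProduct.mk_apply]
      rw [G₁_lam]
      conv_rhs => rw [← El_El]
      generalize H.E.left (w ⊗ₜ e) = s
      induction s using TensorProduct.induction_on with
      | zero => simp
      | add x y hx hy => simp only [map_add, hx, hy, LinearMap.add_apply]
      | tmul p q => rw [lamKernel_tmul, G₁_lam]
    exact LinearMap.congr_fun key a

theorem G₂_G₂ (t : A ⊗[ℂ] A) : H.G₂ (H.G₂ t) = H.G₂ t := by
  induction t using TensorProduct.induction_on with
  | zero => simp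
  | add x y hx hy => simp only [map_add, hx, hy]
  | tmul b a =>
    have key : H.G₂ ∘ₗ H.G₂ ∘ₗ TensorProduct.mk ℂ A A b = H.G₂ ∘ₗ TensorProduct.mk ℂ A A b := by
      apply H.rho_hom_ext
      intro ω d e c
      simp only [LinearMap.comp_apply, TensorProduct.mk_apply]
      rw [G₂_rho]
      conv_rhs => rw [← Er_Er]
      generalize H.E.right (d ⊗ₜ b) = s
      induction s using TensorProduct.induction_on with
      | zero => simp
      | add x y hx hy => simp only [map_add, hx, hy, LinearMap.add_apply]
      | tmul p q => rw [rhoKernel_tmul, G₂_rho]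
    exact LinearMap.congr_fun key a

end WeakMultiplierHopfAlgebra

/-! ### Generalized inverses -/

/-- Over a field T has a linear section f on its range. Projecting by E before f and by G after it
gives the inverse G f E with the prescribed products. -/
theorem exists_generalized_inverse {V : Type*} [AddCommGroup V] [Module ℂ V] {T E G : V →ₗ[ℂ] V}
    (hE : ∀ x, E (E x) = E x) (hG : ∀ x, G (G x) = G x)
    (hr : LinearMap.range T = LinearMap.range E)
    (hk : LinearMap.ker T = LinearMap.range (LinearMap.id - G)) :
    ∃ R : V →ₗ[ℂ] V, T ∘ₗ R = E ∧ R ∘ₗ T = G ∧ R ∘ₗ T ∘ₗ R = R := by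
  have hTG : ∀ x, T (G x) = T x := by
    intro x
    have : x - G x ∈ LinearMap.ker T := by rw [hk]; exact ⟨x, rfl⟩
    rw [LinearMap.mem_ker, map_sub, sub_eq_zero] at this
    exact this.symm
  have hker : ∀ x, T x = 0 → G x = 0 := by
    intro x hx
    obtain ⟨y, rfl⟩ : x ∈ LinearMap.range (LinearMap.id - G) := by rw [← hk]; exact hx
    simp [hG]
  obtain ⟨f, hf⟩ := (T.rangeRestrict).exists_rightInverse_of_surjective T.range_rangeRestrict
  have hf' : ∀ y : LinearMap.range T, T (f y) = y := fun y => by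
    have := LinearMap.congr_fun hf y
    exact congrArg Subtype.val this
  have hEr : ∀ x, E x ∈ LinearMap.range T := fun x => by rw [hr]; exact ⟨x, rfl⟩
  have hET : ∀ x, E (T x) = T x := by
    intro x
    obtain ⟨y, hy⟩ : T x ∈ LinearMap.range E := by rw [← hr]; exact ⟨x, rfl⟩
    rw [← hy, hE]
  let R : V →ₗ[ℂ] V := G ∘ₗ f ∘ₗ E.codRestrict (LinearMap.range T) hEr
  have h1 : ∀ x, T (R x) = E x := fun x => by
    simp only [R, LinearMap.comp_apply]
    rw [hTG, hf']; rfl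
  have h2 : ∀ x, R (T x) = G x := fun x => by
    have : T (f (E.codRestrict (LinearMap.range T) hEr (T x)) - x) = 0 := by
      rw [map_sub, hf', sub_eq_zero]; exact hET x
    have := hker _ this
    rw [map_sub, sub_eq_zero] at this
    exact this
  refine ⟨R, LinearMap.ext h1, LinearMap.ext h2, LinearMap.ext fun x => ?_⟩
  simp only [LinearMap.comp_apply]
  rw [h2]
  simp only [R, LinearMap.comp_apply, hG]

namespace WeakMultiplierHopfAlgebra

variable (H : WeakMultiplierHopfAlgebra A)

theorem exists_inverse₁ : ∃ R, H.IsInverse₁ R :=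
  exists_generalized_inverse H.El_El H.G₁_G₁ H.range_T₁ H.ker_T₁

theorem exists_inverse₂ : ∃ R, H.IsInverse₂ R :=
  exists_generalized_inverse H.Er_Er H.G₂_G₂ H.range_T₂ H.ker_T₂

/-- The generalized inverse of `T₁`. -/
noncomputable def R₁ : Module.End ℂ (A ⊗[ℂ] A) := H.exists_inverse₁.choose

/-- The generalized inverse of `T₂`. -/
noncomputable def R₂ : Module.End ℂ (A ⊗[ℂ] A) := H.exists_inverse₂.choose

theorem isInverse_R₁ : H.IsInverse₁ H.R₁ := H.exists_inverse₁.choose_spec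

theorem isInverse_R₂ : H.IsInverse₂ H.R₂ := H.exists_inverse₂.choose_spec

theorem T₁_R₁ (t : A ⊗[ℂ] A) : H.T₁ (H.R₁ t) = H.E.left t :=
  LinearMap.congr_fun H.isInverse_R₁.1 t

theorem R₁_T₁ (t : A ⊗[ℂ] A) : H.R₁ (H.T₁ t) = H.G₁ t :=
  LinearMap.congr_fun H.isInverse_R₁.2.1 t

theorem R₁_El (t : A ⊗[ℂ] A) : H.R₁ (H.E.left t) = H.R₁ t := by
  rw [← T₁_R₁]
  exact LinearMap.congr_fun H.isInverse_R₁.2.2 t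

theorem G₁_R₁ (t : A ⊗[ℂ] A) : H.G₁ (H.R₁ t) = H.R₁ t := by
  rw [← R₁_T₁, T₁_R₁, R₁_El]

theorem T₂_R₂ (t : A ⊗[ℂ] A) : H.T₂ (H.R₂ t) = H.E.right t :=
  LinearMap.congr_fun H.isInverse_R₂.1 t

theorem R₂_T₂ (t : A ⊗[ℂ] A) : H.R₂ (H.T₂ t) = H.G₂ t :=
  LinearMap.congr_fun H.isInverse_R₂.2.1 t

theorem R₂_Er (t : A ⊗[ℂ] A) : H.R₂ (H.E.right t) = H.R₂ t := by
  rw [← T₂_R₂]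
  exact LinearMap.congr_fun H.isInverse_R₂.2.2 t

theorem G₂_R₂ (t : A ⊗[ℂ] A) : H.G₂ (H.R₂ t) = H.R₂ t := by
  rw [← R₂_T₂, T₂_R₂, R₂_Er]

/-- Needed because `IsAntipode` only asserts that some generalized inverse exists; T R and R T
together determine R. -/
theorem eq_R₁ {R : A ⊗[ℂ] A →ₗ[ℂ] A ⊗[ℂ] A} (hR : H.IsInverse₁ R) : R = H.R₁ := by
  apply LinearMap.ext
  intro t
  have h1 := LinearMap.congr_fun hR.1 t
  have h2 := LinearMap.congr_fun hR.2.1 (H.R₁ t)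
  have h3 := LinearMap.congr_fun hR.2.2 t
  have h4 := LinearMap.congr_fun hR.2.1 (R t)
  simp only [LinearMap.comp_apply] at h1 h2 h3 h4
  rw [← h3, h1, ← T₁_R₁, h2, G₁_R₁]

theorem eq_R₂ {R : A ⊗[ℂ] A →ₗ[ℂ] A ⊗[ℂ] A} (hR : H.IsInverse₂ R) : R = H.R₂ := by
  apply LinearMap.ext
  intro t
  have h1 := LinearMap.congr_fun hR.1 t
  have h2 := LinearMap.congr_fun hR.2.1 (H.R₂ t)
  have h3 := LinearMap.congr_fun hR.2.2 t
  simp only [LinearMap.comp_apply] at h1 h2 h3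
  rw [← h3, h1, ← T₂_R₂, h2, G₂_R₂]

theorem comm1_R₁ : H.Comm1 H.R₁ := fun ω d e =>
  commute_of_generalized_inverse H.isInverse_R₁.1 H.isInverse_R₁.2.1 H.isInverse_R₁.2.2
    (H.comm1_T₁ ω d e) (H.comm1_El ω d e) (H.comm1_G₁ ω d e)

variable {H} in
theorem IsCop.comm2_R₂ {H' : WeakMultiplierHopfAlgebra A} (h : H.IsCop H') : H.Comm2 H.R₂ :=
  fun ω d e =>
  commute_of_generalized_inverse H.isInverse_R₂.1 H.isInverse_R₂.2.1 H.isInverse_R₂.2.2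
    (H.comm2_T₂ ω d e) (h.comm2_Er ω d e) (H.comm2_G₂ ω d e)

end WeakMultiplierHopfAlgebra

end WMHA

namespace WMHA

open Multiplier

variable {A : Type*} [NonUnitalRing A] [Module ℂ A] [IsScalarTower ℂ A A] [SMulCommClass ℂ A A]

theorem lTensor_slR_op12 (κ : Module.Dual ℂ A) (X : Module.End ℂ (A ⊗[ℂ] A))
    (t : A ⊗[ℂ] (A ⊗[ℂ] A)) :
    LinearMap.lTensor A (slR κ) (op12 X t) = X (LinearMap.lTensor A (slR κ) t) := by
  obtain ⟨t, rfl⟩ := (TensorProduct.assoc ℂ A A A).surjective t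
  simp only [op12, LinearMap.comp_apply, LinearEquiv.coe_coe, LinearEquiv.symm_apply_apply]
  rw [WeakMultiplierHopfAlgebra.lTensor_slR_assoc, WeakMultiplierHopfAlgebra.lTensor_slR_assoc,
    slR_rTensor]

theorem op12_assoc (X : Module.End ℂ (A ⊗[ℂ] A)) (t : A ⊗[ℂ] A) (e : A) :
    op12 X (TensorProduct.assoc ℂ A A A (t ⊗ₜ e)) = TensorProduct.assoc ℂ A A A (X t ⊗ₜ e) := by
  simp [op12]

namespace WeakMultiplierHopfAlgebra

variable (H : WeakMultiplierHopfAlgebra A)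

/-! ### Module properties of the canonical idempotent -/

theorem Er_lTensor_mL (p : A) (t : A ⊗[ℂ] A) :
    H.E.right (LinearMap.lTensor A (mL p) t) = LinearMap.lTensor A (mL p) (H.E.right t) := by
  apply eq_of_tmul_mul H.nd H.nd
  intro x y
  rw [← Er_mul_left, mul_lTensor_mL, mul_lTensor_mL, Er_mul_left]

theorem Er_rTensor_mL (p : A) (t : A ⊗[ℂ] A) :
    H.E.right (LinearMap.rTensor A (mL p) t) = LinearMap.rTensor A (mL p) (H.E.right t) := by
  apply eq_of_tmul_mul H.nd H.nd
  intro x y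
  rw [← Er_mul_left, mul_rTensor_mL, mul_rTensor_mL, Er_mul_left]

theorem El_rTensor_mR (b : A) (t : A ⊗[ℂ] A) :
    H.E.left (LinearMap.rTensor A (mR b) t) = LinearMap.rTensor A (mR b) (H.E.left t) := by
  apply eq_of_mul_tmul H.nd H.nd
  intro x y
  rw [← El_mul_right, rTensor_mR_mul, rTensor_mR_mul, El_mul_right]

theorem Er_mul_eq (s t : A ⊗[ℂ] A) : H.E.right s * t = s * H.E.left t := right_mul_eq _ _ _

/-- One operator multiplies from the right and the other from the left, so only associativity is
involved. -/
theorem op12_Er_op23_El : Commute (op12 H.E.right) (op23 H.E.left) := by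
  change _ * _ = _ * _
  apply TensorProduct.ext_threefold'
  intro x y z
  simp only [Module.End.mul_apply, op23_tmul]
  apply (H.nd.tensor H.nd2).eq_of_mul_right
  intro u
  induction u using TensorProduct.induction_on with
  | zero => simp
  | add x y hx hy => simp only [mul_add, hx, hy]
  | tmul f u =>
    induction u using TensorProduct.induction_on with
    | zero => simp
    | add x y hx hy => simp only [TensorProduct.tmul_add, mul_add, hx, hy]
    | tmul g k =>
      have h1 : ∀ (t s : A ⊗[ℂ] A), op12 H.E.right (x ⊗ₜ t) * (f ⊗ₜ (g ⊗ₜ k)) =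
          (x ⊗ₜ t) * TensorProduct.assoc ℂ A A A (H.E.left (f ⊗ₜ g) ⊗ₜ k) := by
        intro t _
        induction t using TensorProduct.induction_on with
        | zero => simp
        | add x y hx hy => simp only [TensorProduct.tmul_add, map_add, add_mul, hx, hy]
        | tmul y z =>
          rw [op12_tmul, ← TensorProduct.assoc_tmul, ← assoc_mul, ← TensorProduct.assoc_tmul,
            ← assoc_mul, Algebra.TensorProduct.tmul_mul_tmul, Algebra.TensorProduct.tmul_mul_tmul,
            Er_mul_eq]
      have h2 : ∀ t : A ⊗[ℂ] (A ⊗[ℂ] A), (x ⊗ₜ[ℂ] H.E.left (y ⊗ₜ z)) * t =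
          op23 H.E.left ((x ⊗ₜ[ℂ] (y ⊗ₜ z)) * t) := by
        intro t
        rw [← op23_El_mul, op23_tmul]
      rw [h1 _ 0, h2, op23_El_mul]
      congr 1
      rw [h1 _ 0]

theorem commute_op12_R₂ {Z : Module.End ℂ (A ⊗[ℂ] (A ⊗[ℂ] A))} (hT : Commute Z (op12 H.T₂))
    (hE : Commute Z (op12 H.E.right)) (hG : Commute Z (op12 H.G₂)) : Commute Z (op12 H.R₂) := by
  have e := H.isInverse_R₂
  refine commute_of_generalized_inverse (T := op12 H.T₂) (E := op12 H.E.right) (G := op12 H.G₂)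
    ?_ ?_ ?_ hT hE hG
  · rw [← op12_mul]; exact congrArg op12 e.1
  · rw [← op12_mul]; exact congrArg op12 e.2.1
  · rw [← op12_mul, ← op12_mul]; exact congrArg op12 e.2.2

theorem op12_R₂_op23_El : Commute (op12 H.R₂) (op23 H.E.left) :=
  (H.commute_op12_R₂ (H.comm1_El.op).symm H.op12_Er_op23_El.symm H.comm1_El.op_G₂.symm).symm

/-! ### The antipode and the source and target maps as bilinear maps -/

/-- `a ⊗ b ↦ S(a) b`. -/
noncomputable def S₁ : A ⊗[ℂ] A →ₗ[ℂ] A := slL H.counit ∘ₗ H.R₁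

/-- `b ⊗ a ↦ b S(a)`. -/
noncomputable def S₂ : A ⊗[ℂ] A →ₗ[ℂ] A := slR H.counit ∘ₗ H.R₂

/-- `a ⊗ b ↦ ε_s(a) b`. -/
noncomputable def es₁ : A ⊗[ℂ] A →ₗ[ℂ] A := slL H.counit ∘ₗ H.G₁

/-- `b ⊗ a ↦ b ε_s(a)`. -/
noncomputable def es₂ : A ⊗[ℂ] A →ₗ[ℂ] A := slR H.counit ∘ₗ H.E.right

/-- `a ⊗ b ↦ ε_t(a) b`. -/
noncomputable def et₁ : A ⊗[ℂ] A →ₗ[ℂ] A := slL H.counit ∘ₗ H.E.left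

/-- `b ⊗ a ↦ b ε_t(a)`. -/
noncomputable def et₂ : A ⊗[ℂ] A →ₗ[ℂ] A := slR H.counit ∘ₗ H.G₂

theorem S₁_apply (t : A ⊗[ℂ] A) : H.S₁ t = slL H.counit (H.R₁ t) := rfl
theorem S₂_apply (t : A ⊗[ℂ] A) : H.S₂ t = slR H.counit (H.R₂ t) := rfl
theorem es₁_apply (t : A ⊗[ℂ] A) : H.es₁ t = slL H.counit (H.G₁ t) := rfl
theorem es₂_apply (t : A ⊗[ℂ] A) : H.es₂ t = slR H.counit (H.E.right t) := rfl
theorem et₁_apply (t : A ⊗[ℂ] A) : H.et₁ t = slL H.counit (H.E.left t) := rfl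
theorem et₂_apply (t : A ⊗[ℂ] A) : H.et₂ t = slR H.counit (H.G₂ t) := rfl

theorem S₁_T₁ (t : A ⊗[ℂ] A) : H.S₁ (H.T₁ t) = H.es₁ t := by rw [S₁_apply, R₁_T₁, es₁_apply]
theorem S₂_T₂ (t : A ⊗[ℂ] A) : H.S₂ (H.T₂ t) = H.et₂ t := by rw [S₂_apply, R₂_T₂, et₂_apply]
theorem es₁_R₁ (t : A ⊗[ℂ] A) : H.es₁ (H.R₁ t) = H.S₁ t := by rw [S₁_apply, es₁_apply, G₁_R₁]
theorem et₂_R₂ (t : A ⊗[ℂ] A) : H.et₂ (H.R₂ t) = H.S₂ t := by rw [S₂_apply, et₂_apply, G₂_R₂]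
theorem S₁_El (t : A ⊗[ℂ] A) : H.S₁ (H.E.left t) = H.S₁ t := by rw [S₁_apply, R₁_El, S₁_apply]
theorem S₂_Er (t : A ⊗[ℂ] A) : H.S₂ (H.E.right t) = H.S₂ t := by rw [S₂_apply, R₂_Er, S₂_apply]

theorem mul_R₂ (t : A ⊗[ℂ] A) : LinearMap.mul' ℂ A (H.R₂ t) = H.es₂ t := by
  rw [← slR_counit_T₂, T₂_R₂, es₂_apply]

/-- The counit applied to `G₁_lam`: the multipliers ε_s(a) are slices of `E` onto its left leg. -/
theorem es₁_lam (ω : Module.Dual ℂ A) (d e c w : A) :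
    H.es₁ (H.lam ω d e c ⊗ₜ w) = slR (ω ∘ₗ mL (d * c)) (H.E.left (w ⊗ₜ e)) := by
  rw [es₁_apply, G₁_lam]
  generalize H.E.left (w ⊗ₜ e) = s
  induction s using TensorProduct.induction_on with
  | zero => simp
  | add x y hx hy => simp only [map_add, LinearMap.add_apply, hx, hy]
  | tmul p q => simp [lamKernel_tmul, counit_lam]

theorem et₂_rho (ω : Module.Dual ℂ A) (d e c b : A) :
    H.et₂ (b ⊗ₜ H.rho ω d e c) = slL (ω ∘ₗ mR (c * e)) (H.E.right (d ⊗ₜ b)) := by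
  rw [et₂_apply, G₂_rho]
  generalize H.E.right (d ⊗ₜ b) = s
  induction s using TensorProduct.induction_on with
  | zero => simp
  | add x y hx hy => simp only [map_add, LinearMap.add_apply, hx, hy]
  | tmul p q => simp [rhoKernel_tmul, counit_rho, mul_assoc]

/-- For a = rho ω d e c both sides are (ω(· e) ⊗ ι)((d ⊗ x)E(c ⊗ w)), and such a span A. -/
theorem mul_et₁ (x a w : A) : x * H.et₁ (a ⊗ₜ w) = H.et₂ (x ⊗ₜ a) * w := by
  have key : mL x ∘ₗ H.et₁ ∘ₗ (TensorProduct.mk ℂ A A).flip w =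
      mR w ∘ₗ H.et₂ ∘ₗ TensorProduct.mk ℂ A A x := by
    apply H.rho_hom_ext
    intro ω d e c
    simp only [LinearMap.comp_apply, LinearMap.flip_apply, TensorProduct.mk_apply,
      LinearMap.mulLeft_apply, LinearMap.mulRight_apply]
    rw [et₂_rho, et₁_apply, ← LinearMap.rTensor_tmul, H.comm1_El.apply, slL_rTensor]
    have h1 : ∀ s : A ⊗[ℂ] A, slL (ω ∘ₗ mR (c * e)) s * w = slL (ω ∘ₗ mR e) (s * (c ⊗ₜ w)) := by
      intro s
      induction s using TensorProduct.induction_on with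
      | zero => simp
      | add x y hx hy => simp only [map_add, add_mul, hx, hy]
      | tmul p q => simp [mul_assoc, smul_mul_assoc]
    have h2 : ∀ s : A ⊗[ℂ] A, x * slL (H.counit ∘ₗ H.rho ω d e) s =
        slL (ω ∘ₗ mR e) ((d ⊗ₜ x) * s) := by
      intro s
      induction s using TensorProduct.induction_on with
      | zero => simp
      | add x y hx hy => simp only [map_add, mul_add, hx, hy]
      | tmul p q => simp [counit_rho, mul_smul_comm]
    rw [h1, h2, Er_mul_eq]
  exact LinearMap.congr_fun key a

namespace IsCop

variable {H} {H' : WeakMultiplierHopfAlgebra A} (h : H.IsCop H')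

include h

theorem mul_es₁ (x a w : A) : x * H.es₁ (a ⊗ₜ w) = H.es₂ (x ⊗ₜ a) * w := by
  have key : mL x ∘ₗ H.es₁ ∘ₗ (TensorProduct.mk ℂ A A).flip w =
      mR w ∘ₗ H.es₂ ∘ₗ TensorProduct.mk ℂ A A x := by
    apply H.lam_hom_ext
    intro ω d e c
    simp only [LinearMap.comp_apply, LinearMap.flip_apply, TensorProduct.mk_apply,
      LinearMap.mulLeft_apply, LinearMap.mulRight_apply]
    rw [es₁_lam, es₂_apply, ← LinearMap.lTensor_tmul, h.comm2_Er.apply, slR_lTensor]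
    have h1 : ∀ s : A ⊗[ℂ] A, x * slR (ω ∘ₗ mL (d * c)) s = slR (ω ∘ₗ mL d) ((x ⊗ₜ c) * s) := by
      intro s
      induction s using TensorProduct.induction_on with
      | zero => simp
      | add x y hx hy => simp only [map_add, mul_add, hx, hy]
      | tmul p q => simp [mul_smul_comm]
    have h2 : ∀ s : A ⊗[ℂ] A, slR (H.counit ∘ₗ H.lam ω d e) s * w =
        slR (ω ∘ₗ mL d) (s * (w ⊗ₜ e)) := by
      intro s
      induction s using TensorProduct.induction_on with
      | zero => simp
      | add x y hx hy => simp only [map_add, add_mul, hx, hy]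
      | tmul p q => simp [counit_lam, smul_mul_assoc]
    rw [h1, h2, Er_mul_eq]
  exact LinearMap.congr_fun key a

theorem op12_R₂_op23_T₁ : Commute (op12 H.R₂) (op23 H.T₁) := h.comm2_R₂.op

end IsCop

/-- `d ⊗ y ⊗ z ↦ d X(ε(y) z)`. -/
noncomputable def counitMul (X : A →ₗ[ℂ] A) : A ⊗[ℂ] (A ⊗[ℂ] A) →ₗ[ℂ] A :=
  LinearMap.mul' ℂ A ∘ₗ LinearMap.lTensor A (X ∘ₗ slL H.counit)

theorem counitMul_tmul (X : A →ₗ[ℂ] A) (d : A) (t : A ⊗[ℂ] A) :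
    H.counitMul X (d ⊗ₜ t) = d * X (slL H.counit t) := by
  simp [counitMul]

theorem counitMul_assoc (X : A →ₗ[ℂ] A) (t : A ⊗[ℂ] A) (z : A) :
    H.counitMul X (TensorProduct.assoc ℂ A A A (t ⊗ₜ z)) = slR H.counit t * X z := by
  induction t using TensorProduct.induction_on with
  | zero => simp
  | add x y hx hy => simp only [TensorProduct.add_tmul, map_add, add_mul, hx, hy]
  | tmul p q => simp [counitMul_tmul, mul_smul_comm, smul_mul_assoc]

theorem counitMul_op23_T₁ (X : A →ₗ[ℂ] A) (t : A ⊗[ℂ] A) (s : A) :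
    H.counitMul X (op23 H.T₁ (TensorProduct.assoc ℂ A A A (t ⊗ₜ s))) =
      LinearMap.mul' ℂ A (LinearMap.lTensor A (X ∘ₗ mR s) t) := by
  induction t using TensorProduct.induction_on with
  | zero => simp
  | add x y hx hy => simp only [TensorProduct.add_tmul, map_add, hx, hy]
  | tmul p q => simp [counitMul_tmul, slL_counit_T₁]

namespace IsCop

variable {H} {H' : WeakMultiplierHopfAlgebra A} (h : H.IsCop H')

include h

theorem counitMul_R₂_T₁ (X : A →ₗ[ℂ] A) (d q s : A) :
    H.counitMul X (op12 H.R₂ (d ⊗ₜ H.T₁ (q ⊗ₜ s))) =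
      LinearMap.mul' ℂ A (LinearMap.lTensor A (X ∘ₗ mR s) (H.R₂ (d ⊗ₜ q))) := by
  have := LinearMap.congr_fun h.op12_R₂_op23_T₁.eq (d ⊗ₜ (q ⊗ₜ s))
  simp only [Module.End.mul_apply] at this
  rw [op23_tmul, op12_tmul] at this
  rw [this, counitMul_op23_T₁]

/-- For t = p ⊗ q this is d ε_s(p) q = ∑ d S(p₍₁₎) p₍₂₎ q, where R₂(d ⊗ p) stands for ∑ d S(p₍₁₎) ⊗
p₍₂₎. -/
theorem mul_es₁_eq (d : A) (t : A ⊗[ℂ] A) :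
    d * H.es₁ t = H.counitMul LinearMap.id (op12 H.R₂ (d ⊗ₜ H.T₁ t)) := by
  induction t using TensorProduct.induction_on with
  | zero => simp
  | add x y hx hy => simp only [TensorProduct.tmul_add, map_add, mul_add, hx, hy]
  | tmul p q =>
    rw [h.counitMul_R₂_T₁, h.mul_es₁, ← mul_R₂]
    generalize H.R₂ (d ⊗ₜ p) = s
    induction s using TensorProduct.induction_on with
    | zero => simp
    | add x y hx hy => simp only [map_add, add_mul, hx, hy]
    | tmul x y => simp [mul_assoc]

/-- `d (S(a) w) = (d S(a)) w`. -/
theorem mul_S₁ (d a w : A) : d * H.S₁ (a ⊗ₜ w) = H.S₂ (d ⊗ₜ a) * w := by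
  -- Taking R₁(a ⊗ w) for t produces T₁R₁ = E on the last two legs, which commutes with R₂ ⊗ ι. What
  -- is left is ε_t, and `mul_et₁` moves it to the other side.
  rw [← es₁_R₁, h.mul_es₁_eq, T₁_R₁, ← op23_tmul]
  have := LinearMap.congr_fun H.op12_R₂_op23_El.eq (d ⊗ₜ (a ⊗ₜ w))
  simp only [Module.End.mul_apply] at this
  rw [this, op12_tmul, ← et₂_R₂]
  generalize H.R₂ (d ⊗ₜ a) = s
  induction s using TensorProduct.induction_on with
  | zero => simp
  | add x y hx hy => simp only [TensorProduct.add_tmul, map_add, add_mul, hx, hy]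
  | tmul x y =>
    rw [TensorProduct.assoc_tmul, op23_tmul, counitMul_tmul, ← mul_et₁, et₁_apply]; rfl

theorem S₁_mul (a w x : A) : H.S₁ (a ⊗ₜ (w * x)) = H.S₁ (a ⊗ₜ w) * x := by
  apply H.nd.eq_of_mul_left
  intro d
  rw [h.mul_S₁, ← mul_assoc, ← mul_assoc, h.mul_S₁]

theorem mul_S₁_lTensor_T₁ (X : A →ₗ[ℂ] A) (d q s : A) :
    d * H.S₁ (LinearMap.lTensor A X (H.T₁ (q ⊗ₜ s))) =
      LinearMap.mul' ℂ A (LinearMap.lTensor A (X ∘ₗ mR s) (H.R₂ (d ⊗ₜ q))) := by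
  rw [← h.counitMul_R₂_T₁]
  generalize H.T₁ (q ⊗ₜ s) = t
  induction t using TensorProduct.induction_on with
  | zero => simp
  | add x y hx hy => simp only [TensorProduct.tmul_add, map_add, mul_add, hx, hy]
  | tmul x y => rw [LinearMap.lTensor_tmul, h.mul_S₁, op12_tmul, counitMul_assoc, S₂_apply]

end IsCop

/-! ### Anti-multiplicativity of the antipode -/

/-- In Sweedler notation, d ε_s(pq) = ∑ d S(q₍₁₎) ε_s(p) q₍₂₎. -/
theorem es₂_mul (d p q : A) : H.es₂ (d ⊗ₜ (p * q)) =
    LinearMap.mul' ℂ A (LinearMap.rTensor A (H.es₂ ∘ₗ (TensorProduct.mk ℂ A A).flip p)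
      (H.R₂ (d ⊗ₜ q))) := by
  have h1 : H.E.right (d ⊗ₜ (p * q)) = LinearMap.lTensor A (mL p) (H.T₂ (H.R₂ (d ⊗ₜ q))) := by
    rw [T₂_R₂, ← Er_lTensor_mL]; simp
  rw [es₂_apply, h1]
  generalize H.R₂ (d ⊗ₜ q) = t
  induction t using TensorProduct.induction_on with
  | zero => simp
  | add x y hx hy => simp only [map_add, hx, hy]
  | tmul u v =>
    rw [← dr_tmul, ← dr_Er, ← T₂_R₂]
    simp only [LinearMap.rTensor_tmul, LinearMap.mul'_apply, LinearMap.comp_apply,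
      LinearMap.flip_apply, TensorProduct.mk_apply]
    rw [← mul_R₂]
    generalize H.R₂ (u ⊗ₜ p) = s
    induction s using TensorProduct.induction_on with
    | zero => simp
    | add x y hx hy => simp only [map_add, add_mul, hx, hy]
    | tmul x y => rw [← T₂_mul_right, slR_counit_T₂]; simp [mul_assoc]

/-- Since ε_s(p) is a slice of `E`, commutation of 1 ⊗ ε_s(p) with `E` is a slice of the axiom that
E ⊗ 1 and 1 ⊗ E commute. -/
theorem lTensor_es₁_El (p : A) (t : A ⊗[ℂ] A) :
    LinearMap.lTensor A (H.es₁ ∘ₗ TensorProduct.mk ℂ A A p) (H.E.left t) =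
      H.E.left (LinearMap.lTensor A (H.es₁ ∘ₗ TensorProduct.mk ℂ A A p) t) := by
  have key : ∀ (b r : A),
      (LinearMap.applyₗ (H.E.left (b ⊗ₜ r))) ∘ₗ (LinearMap.lTensorHom A) ∘ₗ
        TensorProduct.curry H.es₁ =
      H.E.left ∘ₗ (LinearMap.applyₗ (b ⊗ₜ r)) ∘ₗ (LinearMap.lTensorHom A) ∘ₗ
        TensorProduct.curry H.es₁ := by
    intro b r
    apply H.lam_hom_ext
    intro ω d e c
    simp only [LinearMap.comp_apply, LinearMap.applyₗ_apply_apply, LinearMap.coe_lTensorHom]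
    have h1 : ∀ t : A ⊗[ℂ] A,
        LinearMap.lTensor A (TensorProduct.curry H.es₁ (H.lam ω d e c)) t =
        LinearMap.lTensor A (slR (ω ∘ₗ mL (d * c)))
          (op23 H.E.left (TensorProduct.assoc ℂ A A A (t ⊗ₜ e))) := by
      intro t
      induction t using TensorProduct.induction_on with
      | zero => simp
      | add x y hx hy => simp only [TensorProduct.add_tmul, map_add, hx, hy]
      | tmul x y => simp [es₁_lam]
    rw [h1, h1, ← lTensor_slR_op12, ← op12_assoc]
    have := LinearMap.congr_fun H.op12_El_op23_El.eq
      (TensorProduct.assoc ℂ A A A ((b ⊗ₜ r) ⊗ₜ e))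
    simp only [Module.End.mul_apply] at this
    rw [this]
  induction t using TensorProduct.induction_on with
  | zero => simp
  | add x y hx hy => simp only [map_add, hx, hy]
  | tmul b r => exact LinearMap.congr_fun (key b r) p

namespace IsCop

variable {H} {H' : WeakMultiplierHopfAlgebra A} (h : H.IsCop H')

include h

theorem es₁_mul (p q s : A) : H.es₁ ((p * q) ⊗ₜ s) =
    H.S₁ (LinearMap.lTensor A (H.es₁ ∘ₗ TensorProduct.mk ℂ A A p) (H.T₁ (q ⊗ₜ s))) := by
  apply H.nd.eq_of_mul_left
  intro d
  rw [h.mul_es₁, h.mul_S₁_lTensor_T₁, es₂_mul]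
  generalize H.R₂ (d ⊗ₜ q) = t
  induction t using TensorProduct.induction_on with
  | zero => simp
  | add x y hx hy => simp only [map_add, add_mul, hx, hy]
  | tmul x y => simp [h.mul_es₁, mul_assoc]

/-- The antipode is anti-multiplicative: `S(ab) w = S(b) S(a) w`. -/
theorem S₁_mul_left (a b w : A) : H.S₁ ((a * b) ⊗ₜ w) = H.S₁ (b ⊗ₜ H.S₁ (a ⊗ₜ w)) := by
  -- `S₁` does not see `E`, so ab ⊗ w may be replaced by E(ab ⊗ w), which is a combination of
  -- elements Δ(p)(b ⊗ r).
  have h1 : H.E.left ((a * b) ⊗ₜ w) = LinearMap.rTensor A (mR b) (H.T₁ (H.R₁ (a ⊗ₜ w))) := by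
    rw [T₁_R₁, ← El_rTensor_mR]; simp
  have h2 : ∀ (p : A) (t : A ⊗[ℂ] A), H.S₁ (H.dl p (H.T₁ t)) =
      H.S₁ (LinearMap.lTensor A (H.es₁ ∘ₗ TensorProduct.mk ℂ A A p) (H.T₁ t)) := by
    intro p t
    induction t using TensorProduct.induction_on with
    | zero => simp
    | add x y hx hy => simp only [map_add, hx, hy]
    | tmul q s => rw [← T₁_mul_left, S₁_T₁, h.es₁_mul]
  -- Write Δ(p)(b ⊗ r) = Δ(p)E(b ⊗ r). Under `S₁` the factor Δ(p) acts as 1 ⊗ ε_s(p), which passes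
  -- through `E`.
  have h3 : ∀ t : A ⊗[ℂ] A, H.S₁ (LinearMap.rTensor A (mR b) (H.T₁ t)) =
      H.S₁ (b ⊗ₜ H.es₁ t) := by
    intro t
    induction t using TensorProduct.induction_on with
    | zero => simp
    | add x y hx hy => simp only [TensorProduct.tmul_add, map_add, hx, hy]
    | tmul p r =>
      rw [← dl_tmul, ← dl_El, ← T₁_R₁, h2, T₁_R₁, lTensor_es₁_El, S₁_El]
      simp
  rw [← S₁_El, h1, h3, es₁_R₁]

end IsCop

end WeakMultiplierHopfAlgebra

end WMHA

namespace WMHA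

open Multiplier

variable {A : Type*} [NonUnitalRing A] [Module ℂ A] [IsScalarTower ℂ A A] [SMulCommClass ℂ A A]

/-! ### Reversing the legs -/

/-- `x ⊗ y ⊗ z ↦ z ⊗ y ⊗ x`. -/
noncomputable def reverse : A ⊗[ℂ] (A ⊗[ℂ] A) ≃ₗ[ℂ] A ⊗[ℂ] (A ⊗[ℂ] A) :=
  (TensorProduct.congr (LinearEquiv.refl ℂ A) (TensorProduct.comm ℂ A A)).trans
    ((TensorProduct.comm ℂ A (A ⊗[ℂ] A)).trans (TensorProduct.assoc ℂ A A A))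

theorem reverse_tmul (x y z : A) : reverse (x ⊗ₜ[ℂ] (y ⊗ₜ[ℂ] z)) = z ⊗ₜ (y ⊗ₜ x) := by
  simp [reverse]

namespace WeakMultiplierHopfAlgebra

theorem reverse_op12 (Y : Module.End ℂ (A ⊗[ℂ] A)) (t : A ⊗[ℂ] (A ⊗[ℂ] A)) :
    reverse (op12 Y t) = op23 (conj Y) (reverse t) := by
  have : reverse.toLinearMap ∘ₗ op12 Y = op23 (conj Y) ∘ₗ reverse.toLinearMap := by
    apply TensorProduct.ext_threefold'
    intro x y z
    simp only [LinearMap.comp_apply, LinearEquiv.coe_coe, reverse_tmul, op12_tmul, op23_tmul,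
      conj_apply, TensorProduct.comm_tmul]
    generalize Y (x ⊗ₜ y) = s
    induction s using TensorProduct.induction_on with
    | zero => simp
    | add x y hx hy => simp only [TensorProduct.add_tmul, TensorProduct.tmul_add, map_add, hx, hy]
    | tmul x y => simp [reverse_tmul]
  exact LinearMap.congr_fun this t

theorem reverse_op23 (Y : Module.End ℂ (A ⊗[ℂ] A)) (t : A ⊗[ℂ] (A ⊗[ℂ] A)) :
    reverse (op23 Y t) = op12 (conj Y) (reverse t) := by
  have : reverse.toLinearMap ∘ₗ op23 Y = op12 (conj Y) ∘ₗ reverse.toLinearMap := by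
    apply TensorProduct.ext_threefold'
    intro x y z
    simp only [LinearMap.comp_apply, LinearEquiv.coe_coe, reverse_tmul, op12_tmul, op23_tmul,
      conj_apply, TensorProduct.comm_tmul]
    generalize Y (y ⊗ₜ z) = s
    induction s using TensorProduct.induction_on with
    | zero => simp
    | add x y hx hy => simp only [TensorProduct.add_tmul, TensorProduct.tmul_add, map_add, hx, hy]
    | tmul x y => simp [reverse_tmul]
  exact LinearMap.congr_fun this t

theorem commute_conj {Y Z : Module.End ℂ (A ⊗[ℂ] A)} (hYZ : Commute (op12 Y) (op23 Z)) :
    Commute (op12 (conj Z)) (op23 (conj Y)) := by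
  change _ * _ = _ * _
  apply LinearMap.ext
  intro t
  obtain ⟨t, rfl⟩ := reverse.surjective t
  simp only [Module.End.mul_apply]
  rw [← reverse_op12, ← reverse_op23, ← reverse_op23, ← reverse_op12]
  exact congrArg reverse (LinearMap.congr_fun hYZ.eq.symm t)

variable (H : WeakMultiplierHopfAlgebra A)

/-! ### Cancellation -/

/-- As Δ(a) absorbs `E`, the hypothesis kills Δ(a)(1 ⊗ y), whose counit slice is ay. -/
theorem eq_zero_of_El_tmul {y : A} (h : ∀ e, H.E.left (e ⊗ₜ y) = 0) : y = 0 := by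
  apply H.nd.2
  intro a
  have : H.T₁ (a ⊗ₜ y) = 0 := by
    apply eq_zero_of_rTensor_mR H.nd
    intro u
    rw [← dl_tmul, ← dl_El, h, map_zero]
  have h2 := H.slL_counit_T₁ (a ⊗ₜ y)
  rw [this] at h2
  simpa using h2.symm

/-- Colinearity of `R₁` in sliced form: R₁(c ⊗ x) = ∑ c₍₁₎ ⊗ S(c₍₂₎)x. -/
theorem S₁_rho (ω : Module.Dual ℂ A) (d e c x : A) :
    H.S₁ (H.rho ω d e c ⊗ₜ x) = slL (ω ∘ₗ mL d ∘ₗ mR e) (H.R₁ (c ⊗ₜ x)) := by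
  rw [S₁_apply, ← LinearMap.rTensor_tmul, H.comm1_R₁.apply, slL_rTensor]
  congr 2
  ext a
  simp [counit_rho, mul_assoc]

theorem eq_zero_of_S₁_tmul {x : A} (h : ∀ u, H.S₁ (u ⊗ₜ x) = 0) : x = 0 := by
  apply H.eq_zero_of_El_tmul
  intro c
  rw [← T₁_R₁]
  have : H.R₁ (c ⊗ₜ x) = 0 := by
    apply H.eq_of_slL_mL_mR
    intro ω d e
    rw [← S₁_rho, h, map_zero]
  rw [this, map_zero]

/-- Slices of T₁ = E T₁ span A, slices of `E` have the form ε_s(a)w, and these are values of S₁ ∘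
T₁. Idempotence lets d be a product dc', as `es₁_lam` requires. -/
theorem S₁_hom_ext {N : Type*} [AddCommGroup N] [Module ℂ N] {f g : A →ₗ[ℂ] N}
    (h : ∀ t, f (H.S₁ t) = g (H.S₁ t)) : f = g := by
  apply H.lam_hom_ext
  intro ω d e c
  refine H.idempotent.induction (p := fun d => f (H.lam ω d e c) = g (H.lam ω d e c)) ?_ ?_ ?_ d
  · have h0 : ∀ t : A ⊗[ℂ] A, slR (ω ∘ₗ mL (0 : A)) t = 0 := by
      intro t
      rw [← slR_lTensor]
      simp
    rw [lam_apply, h0, map_zero, map_zero]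
  · intro d c'
    rw [lam_apply, ← El_T₁]
    generalize H.T₁ (c ⊗ₜ e) = t
    induction t using TensorProduct.induction_on with
    | zero => simp
    | add x y hx hy => simp only [map_add, hx, hy]
    | tmul w e => rw [← es₁_lam, ← S₁_T₁, h]
  · intro d d' hd hd'
    have : H.lam ω (d + d') e c = H.lam ω d e c + H.lam ω d' e c := by
      simp only [lam_apply]
      rw [← slR_lTensor, ← slR_lTensor, ← slR_lTensor, ← map_add, ← LinearMap.add_apply,
        ← LinearMap.lTensor_add]
      congr 3
      ext x; simp [add_mul]
    rw [this, map_add, map_add, hd, hd']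

theorem S₁_surjective : Function.Surjective H.S₁ := by
  rw [← LinearMap.range_eq_top, ← Submodule.ker_mkQ (LinearMap.range H.S₁),
    LinearMap.ker_eq_top]
  apply H.S₁_hom_ext
  intro t
  simp

/-! ### The source maps of `H` and H', and the composite of the two antipodes -/

namespace IsCop

variable {H} {H' : WeakMultiplierHopfAlgebra A} (h : H.IsCop H')

include h

theorem conj_Er : conj H'.E.right = H.E.right := by
  ext x y
  simp [conj_apply, h.Er]

/-- The two maps stand for c ↦ S(c₍₁₎) ⊗ c₍₂₎ and c ↦ c₍₁₎ ⊗ S'(c₍₂₎), which act on opposite sides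
of the middle leg: coassociativity passed on to the generalized inverses. -/
theorem op12_R₂_conj_R₂ : Commute (op12 H.R₂) (op23 (conj H'.R₂)) := by
  have hc : H.Comm1 (conj H'.R₂) := h.comm1_conj h.symm.comm2_R₂
  have h1 : Commute (op23 H'.E.right) (op12 H'.R₂) :=
    H'.commute_op12_R₂ H'.comm1_Er.op.symm H'.op12_Er_op23_Er.symm H'.comm1_Er.op_G₂.symm
  have h2 := commute_conj h1.symm
  rw [h.conj_Er] at h2
  exact (H.commute_op12_R₂ hc.op.symm h2.symm hc.op_G₂.symm).symm

/-- `(x ε_s(c) ⊗ y) E = (x ⊗ y ε_s'(c)) E`. -/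
theorem Er_es₂_tmul (x c y : A) :
    H.E.right (H.es₂ (x ⊗ₜ c) ⊗ₜ y) = H.E.right (x ⊗ₜ H'.es₂ (y ⊗ₜ c)) := by
  -- Both sides arise by applying the two commuting inverses to x ⊗ c ⊗ y, then T₂ ⊗ ι, and then m,
  -- the opposite product of the last two legs. The order of the inverses decides which side
  -- appears.
  set m : A ⊗[ℂ] A →ₗ[ℂ] A := LinearMap.mul' ℂ A ∘ₗ (TensorProduct.comm ℂ A A).toLinearMap with hm
  have hm1 : ∀ (t : A ⊗[ℂ] A) (y : A), LinearMap.lTensor A m (TensorProduct.assoc ℂ A A A (t ⊗ₜ y)) =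
      LinearMap.lTensor A (mL y) t := by
    intro t y
    induction t using TensorProduct.induction_on with
    | zero => simp
    | add x y hx hy => simp only [TensorProduct.add_tmul, map_add, hx, hy]
    | tmul p q => simp [hm]
  have hm2 : ∀ (t : A) (s : A ⊗[ℂ] A), LinearMap.lTensor A m (op12 H.T₂ (t ⊗ₜ s)) =
      LinearMap.rTensor A (mL t) (conj H'.T₂ s) := by
    intro t s
    induction s using TensorProduct.induction_on with
    | zero => simp
    | add x y hx hy => simp only [TensorProduct.tmul_add, map_add, hx, hy]
    | tmul c y =>
      rw [op12_tmul, hm1, ← dr_tmul, h.dr_tmul', conj_apply, TensorProduct.comm_tmul]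
  have e1 : LinearMap.lTensor A m (op12 H.T₂ (op12 H.R₂ (op23 (conj H'.R₂) (x ⊗ₜ (c ⊗ₜ y))))) =
      H.E.right (x ⊗ₜ H'.es₂ (y ⊗ₜ c)) := by
    rw [op23_tmul, conj_apply, TensorProduct.comm_tmul, ← mul_R₂]
    generalize H'.R₂ (y ⊗ₜ c) = s
    induction s using TensorProduct.induction_on with
    | zero => simp
    | add x y hx hy => simp only [TensorProduct.tmul_add, map_add, hx, hy]
    | tmul p q =>
      rw [TensorProduct.comm_tmul, op12_tmul, op12_assoc, T₂_R₂, hm1, ← Er_lTensor_mL]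
      simp
  have e2 : LinearMap.lTensor A m (op12 H.T₂ (op23 (conj H'.R₂) (op12 H.R₂ (x ⊗ₜ (c ⊗ₜ y))))) =
      H.E.right (H.es₂ (x ⊗ₜ c) ⊗ₜ y) := by
    rw [op12_tmul, ← mul_R₂]
    generalize H.R₂ (x ⊗ₜ c) = s
    induction s using TensorProduct.induction_on with
    | zero => simp
    | add x y hx hy => simp only [TensorProduct.add_tmul, map_add, hx, hy]
    | tmul p q =>
      have : conj H'.T₂ (conj H'.R₂ (q ⊗ₜ y)) = H.E.right (q ⊗ₜ y) := by
        rw [← h.conj_Er, conj_apply, conj_apply, conj_apply, TensorProduct.comm_comm, T₂_R₂]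
      rw [TensorProduct.assoc_tmul, op23_tmul, hm2, this, ← Er_rTensor_mL]
      simp
  rw [← e1, ← e2]
  have := LinearMap.congr_fun h.op12_R₂_conj_R₂.eq (x ⊗ₜ (c ⊗ₜ y))
  simp only [Module.End.mul_apply] at this
  rw [this]

theorem S₂_es₂ (x c y : A) : H.S₂ (H.es₂ (x ⊗ₜ c) ⊗ₜ y) = H.S₂ (x ⊗ₜ H'.es₂ (y ⊗ₜ c)) := by
  rw [← S₂_Er, h.Er_es₂_tmul, S₂_Er]

theorem S₁_es₂ (a c w : A) : H.S₁ (H'.es₂ (a ⊗ₜ c) ⊗ₜ w) = H.es₁ (c ⊗ₜ H.S₁ (a ⊗ₜ w)) := by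
  apply H.nd.eq_of_mul_left
  intro d
  rw [h.mul_S₁, ← h.S₂_es₂, ← h.mul_S₁, h.mul_es₁]

/-- When the last argument is S(a)w, and such elements span A, both sides become S(a ε_s'(y) x)w,
where ε_s' is the source map of H'. -/
theorem S₁_es₁ (x y w : A) : H.S₁ (x ⊗ₜ H.es₁ (y ⊗ₜ w)) = H.S₁ (H'.es₁ (y ⊗ₜ x) ⊗ₜ w) := by
  have key : H.S₁ ∘ₗ TensorProduct.mk ℂ A A x ∘ₗ H.es₁ ∘ₗ TensorProduct.mk ℂ A A y =
      H.S₁ ∘ₗ TensorProduct.mk ℂ A A (H'.es₁ (y ⊗ₜ x)) := by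
    apply H.S₁_hom_ext
    intro t
    induction t using TensorProduct.induction_on with
    | zero => simp
    | add x y hx hy => simp only [map_add, hx, hy]
    | tmul a w =>
      simp only [LinearMap.comp_apply, TensorProduct.mk_apply]
      rw [← h.S₁_mul_left, h.symm.mul_es₁, h.S₁_mul_left, h.S₁_es₂]
  exact LinearMap.congr_fun key w

/-- `S(S'(v)u) = S(u) v`. -/
theorem S₁_S₁ (u v w : A) : H.S₁ (H'.S₁ (v ⊗ₜ u) ⊗ₜ w) = H.S₁ (u ⊗ₜ v) * w := by
  have h1 : ∀ t : A ⊗[ℂ] A, H.S₁ t * w = H.S₁ (LinearMap.lTensor A (mR w) t) := by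
    intro t
    induction t using TensorProduct.induction_on with
    | zero => simp
    | add x y hx hy => simp only [map_add, add_mul, hx, hy]
    | tmul a b => simp [h.S₁_mul]
  have h2 : ∀ (x : A) (t : A ⊗[ℂ] A), H.S₁ (LinearMap.rTensor A (mR x) t) = H.S₁ (x ⊗ₜ H.S₁ t) := by
    intro x t
    induction t using TensorProduct.induction_on with
    | zero => simp
    | add x y hx hy => simp only [map_add, TensorProduct.tmul_add, hx, hy]
    | tmul a b => simp [h.S₁_mul_left]
  -- The element Δ(y)(x ⊗ w) read in two ways: as the flip of T₁'(y ⊗ x) times 1 ⊗ w, and as T₁(y ⊗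
  -- w)(x ⊗ 1).
  have h3 : ∀ t : A ⊗[ℂ] A, H.S₁ (TensorProduct.comm ℂ A A (H'.T₁ t)) * w =
      H.S₁ (H'.es₁ t ⊗ₜ w) := by
    intro t
    induction t using TensorProduct.induction_on with
    | zero => simp
    | add x y hx hy => simp only [map_add, add_mul, TensorProduct.add_tmul, hx, hy]
    | tmul y x => rw [h1, ← h.dl_tmul', dl_tmul, h2, S₁_T₁, h.S₁_es₁]
  -- This choice gives T₁'R₁' = E', whose flip `E` is invisible to `S₁`.
  have h4 := h3 (H'.R₁ (v ⊗ₜ u))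
  rw [T₁_R₁, h.El, TensorProduct.comm_tmul, TensorProduct.comm_comm, S₁_El, es₁_R₁] at h4
  exact h4.symm

/-! ### The antipode -/

/-- So far S(a) is only a multiplier. Elements S'(v)u span A, and `S₁_S₁` identifies S(S'(v)u) with
S(u)v, an element of A. A linear section of the surjection `H'.S₁` makes the choice linear in a. -/
theorem exists_antipode : ∃ S : A →ₗ[ℂ] A, ∀ a w, S a * w = H.S₁ (a ⊗ₜ w) := by
  obtain ⟨s, hs⟩ := LinearMap.exists_rightInverse_of_surjective _
    (LinearMap.range_eq_top.2 H'.S₁_surjective)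
  refine ⟨H.S₁ ∘ₗ (TensorProduct.comm ℂ A A).toLinearMap ∘ₗ s, fun a w => ?_⟩
  have h1 : ∀ t : A ⊗[ℂ] A, H.S₁ (TensorProduct.comm ℂ A A t) * w = H.S₁ (H'.S₁ t ⊗ₜ w) := by
    intro t
    induction t using TensorProduct.induction_on with
    | zero => simp
    | add x y hx hy => simp only [map_add, add_mul, TensorProduct.add_tmul, hx, hy]
    | tmul v u => simp [h.S₁_S₁]
  have h2 := LinearMap.congr_fun hs a
  simp only [LinearMap.comp_apply, LinearMap.id_apply] at h2
  rw [LinearMap.comp_apply, LinearMap.comp_apply, LinearEquiv.coe_coe, h1, h2]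

theorem isAntipode_antipode : H.IsAntipode H.antipode := by
  have hex : ∃ S : A →ₗ[ℂ] A, H.IsAntipode S := by
    obtain ⟨S, hS⟩ := h.exists_antipode
    refine ⟨S, ⟨H.R₁, H.isInverse_R₁, hS⟩, H.R₂, H.isInverse_R₂, fun a b => ?_⟩
    apply H.nd.eq_of_mul_right
    intro w
    rw [mul_assoc, hS, h.mul_S₁]
    rfl
  rw [antipode, dif_pos hex]
  exact hex.choose_spec

theorem antipode_mul (a b : A) : H.antipode a * b = H.S₁ (a ⊗ₜ b) := by
  obtain ⟨⟨R, hR, e⟩, -⟩ := h.isAntipode_antipode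
  rw [e, H.eq_R₁ hR]
  rfl

theorem mul_antipode (b a : A) : b * H.antipode a = H.S₂ (b ⊗ₜ a) := by
  obtain ⟨-, R, hR, e⟩ := h.isAntipode_antipode
  rw [e, H.eq_R₂ hR]
  rfl

theorem antipode_anti (a b : A) : H.antipode (a * b) = H.antipode b * H.antipode a := by
  apply H.nd.eq_of_mul_right
  intro w
  rw [mul_assoc, h.antipode_mul, h.antipode_mul, h.antipode_mul, h.S₁_mul_left]

/-- S(u)S(S'(a)) = S(S'(a)u) = S(u)a for all u, and the factors S(u) can be cancelled. -/
theorem antipode_antipode (a : A) : H.antipode (H'.antipode a) = a := by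
  rw [← sub_eq_zero]
  apply H.eq_zero_of_S₁_tmul
  intro u
  rw [TensorProduct.tmul_sub, map_sub, sub_eq_zero]
  apply H.nd.eq_of_mul_right
  intro w
  rw [← h.S₁_S₁ u a w, ← h.antipode_mul, ← h.antipode_mul, ← h.symm.antipode_mul,
    h.antipode_anti]

end IsCop

end WeakMultiplierHopfAlgebra

end WMHA

namespace WMHA

open Multiplier

variable {A : Type*} [NonUnitalRing A] [Module ℂ A] [IsScalarTower ℂ A A] [SMulCommClass ℂ A A]

namespace Multiplier

theorem flip_mul (m n : Multiplier (A ⊗[ℂ] A)) : flip (m * n) = flip m * flip n := by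
  apply ext'
  · ext x y; simp [flip_left, mul_left]
  · ext x y; simp [flip_right, mul_right]

theorem flip_tmul (m n : Multiplier A) : flip (tmul m n) = tmul n m := by
  apply ext'
  · ext x y; simp [flip_left, tmul_left]
  · ext x y; simp [flip_right, tmul_right]

theorem incl_comm (t : A ⊗[ℂ] A) : incl (TensorProduct.comm ℂ A A t) = flip (incl t) := by
  apply ext'
  · apply LinearMap.ext; intro x; rw [flip_left, incl_left, incl_left, comm_mul]; simp
  · apply LinearMap.ext; intro x; rw [flip_right, incl_right, incl_right, comm_mul]; simp

/-- `x ↦ x.left` as a linear map. -/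
noncomputable def leftHom : Multiplier A →ₗ[ℂ] Module.End ℂ A where
  toFun := Multiplier.left
  map_add' := left_add
  map_smul' := left_smul

/-- `x ↦ x.right` as a linear map. -/
noncomputable def rightHom : Multiplier A →ₗ[ℂ] Module.End ℂ A where
  toFun := Multiplier.right
  map_add' := right_add
  map_smul' := right_smul

end Multiplier

namespace WeakMultiplierHopfAlgebra

variable (H : WeakMultiplierHopfAlgebra A)

/-! ### The source and target algebras -/

/-- The multiplier `(ω(d · e) ⊗ ι)E`. -/
noncomputable def sliceE (ω : Module.Dual ℂ A) (d e : A) : Multiplier A :=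
  Multiplier.mk (slL (ω ∘ₗ mL d) ∘ₗ H.E.left ∘ₗ TensorProduct.mk ℂ A A e)
    (slL (ω ∘ₗ mR e) ∘ₗ H.E.right ∘ₗ TensorProduct.mk ℂ A A d) (fun b w => by
      have h1 : ∀ s : A ⊗[ℂ] A, slL (ω ∘ₗ mR e) s * w = slL ω (s * (e ⊗ₜ w)) := by
        intro s
        induction s using TensorProduct.induction_on with
        | zero => simp
        | add x y hx hy => simp only [map_add, add_mul, hx, hy]
        | tmul p q => simp [smul_mul_assoc]
      have h2 : ∀ s : A ⊗[ℂ] A, b * slL (ω ∘ₗ mL d) s = slL ω ((d ⊗ₜ b) * s) := by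
        intro s
        induction s using TensorProduct.induction_on with
        | zero => simp
        | add x y hx hy => simp only [map_add, mul_add, hx, hy]
        | tmul p q => simp [mul_smul_comm]
      simp only [LinearMap.comp_apply, TensorProduct.mk_apply]
      rw [h1, h2, Er_mul_eq])

theorem sliceE_left (ω : Module.Dual ℂ A) (d e w : A) :
    (H.sliceE ω d e).left w = slL (ω ∘ₗ mL d) (H.E.left (e ⊗ₜ w)) := rfl

theorem sliceE_right (ω : Module.Dual ℂ A) (d e b : A) :
    (H.sliceE ω d e).right b = slL (ω ∘ₗ mR e) (H.E.right (d ⊗ₜ b)) := rfl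

/-- The span of the right leg of `E`. -/
noncomputable def legE : Submodule ℂ (Multiplier A) :=
  Submodule.span ℂ {x | ∃ ω d e, x = H.sliceE ω d e}

theorem sliceE_mem (ω : Module.Dual ℂ A) (d e : A) : H.sliceE ω d e ∈ H.legE :=
  Submodule.subset_span ⟨ω, d, e, rfl⟩

theorem rho_mem {V : Submodule ℂ A} (h : ∀ ω d e c, H.rho ω d e c ∈ V) (a : A) : a ∈ V := by
  have : V.mkQ = 0 := H.rho_hom_ext fun ω d e c => by
    rw [LinearMap.zero_apply, Submodule.mkQ_apply, Submodule.Quotient.mk_eq_zero]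
    exact h ω d e c
  rw [← Submodule.Quotient.mk_eq_zero, ← Submodule.mkQ_apply, this, LinearMap.zero_apply]

theorem slL_mR_mul_add (ω : Module.Dual ℂ A) (e e' : A) (t : A ⊗[ℂ] A) :
    slL (ω ∘ₗ mR (e + e')) t = slL (ω ∘ₗ mR e) t + slL (ω ∘ₗ mR e') t := by
  induction t using TensorProduct.induction_on with
  | zero => simp
  | add x y hx hy => simp only [map_add, hx, hy]; abel
  | tmul p q => simp [mul_add, add_smul]

theorem slL_mL_mul_add (ω : Module.Dual ℂ A) (e e' : A) (t : A ⊗[ℂ] A) :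
    slL (ω ∘ₗ mL (e + e')) t = slL (ω ∘ₗ mL e) t + slL (ω ∘ₗ mL e') t := by
  induction t using TensorProduct.induction_on with
  | zero => simp
  | add x y hx hy => simp only [map_add, hx, hy]; abel
  | tmul p q => simp [add_mul, add_smul]

theorem slL_mR_zero (ω : Module.Dual ℂ A) (t : A ⊗[ℂ] A) : slL (ω ∘ₗ mR (0 : A)) t = 0 := by
  rw [← slL_rTensor]; simp

theorem slL_mL_zero (ω : Module.Dual ℂ A) (t : A ⊗[ℂ] A) : slL (ω ∘ₗ mL (0 : A)) t = 0 := by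
  rw [← slL_rTensor]; simp

variable {H} in
theorem sliceE_induction {p : Multiplier A → Prop} (h0 : p 0) (hadd : ∀ x y, p x → p y → p (x + y))
    (hsmul : ∀ (k : ℂ) x, p x → p (k • x)) (hE : ∀ ω d e, p (H.sliceE ω d e)) {x : Multiplier A}
    (hx : x ∈ H.legE) : p x := by
  refine Submodule.span_induction (p := fun x _ => p x) ?_ h0 (fun x y _ _ => hadd x y)
    (fun k x _ => hsmul k x) hx
  rintro x ⟨ω, d, e, rfl⟩
  exact hE ω d e

namespace IsCop

variable {H} {H' : WeakMultiplierHopfAlgebra A} (h : H.IsCop H')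

include h

theorem mem_targetAlgebra {x : Multiplier A} :
    x ∈ H.targetAlgebra ↔ ∃ a, ∀ c, x.right c = H.et₂ (c ⊗ₜ a) := by
  have : ∀ t : A ⊗[ℂ] A, LinearMap.mul' ℂ A (TensorProduct.map LinearMap.id H.antipode t) =
      H.S₂ t := by
    intro t
    induction t using TensorProduct.induction_on with
    | zero => simp
    | add x y hx hy => simp only [map_add, hx, hy]
    | tmul p q => simp [h.mul_antipode]
  simp only [targetAlgebra, this, S₂_T₂]
  rfl

theorem mem_sourceAlgebra {x : Multiplier A} :
    x ∈ H.sourceAlgebra ↔ ∃ a, ∀ c, x.left c = H.es₁ (a ⊗ₜ c) := by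
  have : ∀ t : A ⊗[ℂ] A, LinearMap.mul' ℂ A (TensorProduct.map H.antipode LinearMap.id t) =
      H.S₁ t := by
    intro t
    induction t using TensorProduct.induction_on with
    | zero => simp
    | add x y hx hy => simp only [map_add, hx, hy]
    | tmul p q => simp [h.antipode_mul]
  simp only [sourceAlgebra, this, S₁_T₁]
  rfl

/-- By `et₂_rho`, ε_t(rho ω d e c) is the slice of `E` for (ω, d, ce). Idempotence of A shows that
all slices arise in this way. -/
theorem targetAlgebra_eq : H.targetAlgebra = H.legE := by
  ext x
  rw [h.mem_targetAlgebra]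
  constructor
  · rintro ⟨a, ha⟩
    let f : A →ₗ[ℂ] Module.End ℂ A := (TensorProduct.curry H.et₂).flip
    have : f a ∈ H.legE.map rightHom := H.rho_mem (V := (H.legE.map rightHom).comap f)
      (fun ω d e c => ⟨_, H.sliceE_mem ω d (c * e), by
        ext b; simp [f, rightHom, et₂_rho, sliceE_right]⟩) a
    obtain ⟨y, hy, e⟩ := this
    have : x = y := ext_right H.nd fun c => by
      rw [ha]
      exact (LinearMap.congr_fun e c).symm
    rwa [this]
  · intro hx
    refine sliceE_induction (p := fun x => ∃ a, ∀ c, x.right c = H.et₂ (c ⊗ₜ a))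
      ⟨0, fun c => by simp⟩ ?_ ?_ ?_ hx
    · rintro x y ⟨a, ha⟩ ⟨b, hb⟩
      exact ⟨a + b, fun c => by simp [ha, hb, TensorProduct.tmul_add]⟩
    · rintro k x ⟨a, ha⟩
      exact ⟨k • a, fun c => by simp [ha]⟩
    · intro ω d e
      simp only [sliceE_right]
      refine H.idempotent.induction (p := fun e => ∃ a, ∀ c,
        slL (ω ∘ₗ mR e) (H.E.right (d ⊗ₜ c)) = H.et₂ (c ⊗ₜ a)) ?_ ?_ ?_ e
      · exact ⟨0, fun c => by rw [slL_mR_zero]; simp⟩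
      · exact fun c e => ⟨H.rho ω d e c, fun b => (H.et₂_rho ω d e c b).symm⟩
      · rintro e e' ⟨a, ha⟩ ⟨b, hb⟩
        exact ⟨a + b, fun c => by
          rw [slL_mR_mul_add, ha, hb, TensorProduct.tmul_add, map_add]⟩

theorem es₁_rho (ω : Module.Dual ℂ A) (d e c w : A) :
    H'.es₁ (H.rho ω d e c ⊗ₜ w) = (H.sliceE ω (d * c) e).left w := by
  rw [← h.lam, es₁_lam, h.El, slR_comm, TensorProduct.comm_tmul, sliceE_left]

theorem sourceAlgebra_eq : H'.sourceAlgebra = H.legE := by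
  ext x
  rw [h.symm.mem_sourceAlgebra]
  constructor
  · rintro ⟨a, ha⟩
    let f : A →ₗ[ℂ] Module.End ℂ A := TensorProduct.curry H'.es₁
    have : f a ∈ H.legE.map leftHom := H.rho_mem (V := (H.legE.map leftHom).comap f)
      (fun ω d e c => ⟨_, H.sliceE_mem ω (d * c) e, by
        ext b; simp [f, leftHom, h.es₁_rho]⟩) a
    obtain ⟨y, hy, e⟩ := this
    have : x = y := ext_left H.nd fun c => by
      rw [ha]
      exact (LinearMap.congr_fun e c).symm
    rwa [this]
  · intro hx
    refine sliceE_induction (p := fun x => ∃ a, ∀ c, x.left c = H'.es₁ (a ⊗ₜ c))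
      ⟨0, fun c => by simp⟩ ?_ ?_ ?_ hx
    · rintro x y ⟨a, ha⟩ ⟨b, hb⟩
      exact ⟨a + b, fun c => by simp [ha, hb, TensorProduct.add_tmul]⟩
    · rintro k x ⟨a, ha⟩
      exact ⟨k • a, fun c => by simp [ha, ← TensorProduct.smul_tmul']⟩
    · intro ω d e
      simp only [sliceE_left]
      refine H.idempotent.induction (p := fun d => ∃ a, ∀ c,
        slL (ω ∘ₗ mL d) (H.E.left (e ⊗ₜ c)) = H'.es₁ (a ⊗ₜ c)) ?_ ?_ ?_ d
      · exact ⟨0, fun c => by rw [slL_mL_zero]; simp⟩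
      · exact fun d c => ⟨H.rho ω d e c, fun w => (h.es₁_rho ω d e c w).symm⟩
      · rintro e e' ⟨a, ha⟩ ⟨b, hb⟩
        exact ⟨a + b, fun c => by
          rw [slL_mL_mul_add, ha, hb, TensorProduct.add_tmul, map_add]⟩

/-- The target algebra of `H` and the source algebra of H' are both the right leg of `E`. -/
theorem At_eq : H.At = H'.As := by
  rw [At, As, h.targetAlgebra_eq, h.sourceAlgebra_eq]

end IsCop

/-! ### The multiplier algebra of the target algebra -/

/-- The left and right actions of `z` commute with all maps `a ↦ ∑ a₍₁₎ ω(d a₍₂₎ e)`. -/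
def CommLam (z : Multiplier A) : Prop :=
  (∀ ω d e a, H.lam ω d e (z.left a) = z.left (H.lam ω d e a)) ∧
    ∀ ω d e a, H.lam ω d e (z.right a) = z.right (H.lam ω d e a)

variable {H}

/-- With `CommLam.T₂_right` this reads Δ(za) = (z ⊗ 1)Δ(a) and Δ(az) = Δ(a)(z ⊗ 1), the
characteristic property of elements of A_t. -/
theorem CommLam.T₂_left {z : Multiplier A} (hz : H.CommLam z) (c a : A) :
    H.T₂ (c ⊗ₜ z.left a) = H.T₂ (z.right c ⊗ₜ a) := by
  apply H.eq_of_slR_mL_mR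
  intro ω d e
  rw [← mul_lam, ← mul_lam, hz.1, right_mul_eq]

theorem CommLam.T₂_right {z : Multiplier A} (hz : H.CommLam z) (c a : A) :
    H.T₂ (c ⊗ₜ z.right a) = LinearMap.rTensor A z.right (H.T₂ (c ⊗ₜ a)) := by
  apply H.eq_of_slR_mL_mR
  intro ω d e
  rw [slR_rTensor, ← mul_lam, ← mul_lam, hz.2, right_mul_left H.nd]

theorem CommLam.T₁_left {z : Multiplier A} (hz : H.CommLam z) (a c : A) :
    H.T₁ (z.left a ⊗ₜ c) = LinearMap.rTensor A z.left (H.T₁ (a ⊗ₜ c)) := by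
  apply H.eq_of_slR_mL
  intro ω d
  rw [slR_rTensor, ← lam_apply, ← lam_apply, hz.1]

/-- Multiplication by z ⊗ 1 preserves the ranges of T₁ and T₂, on the left and on the right
respectively, so (z ⊗ 1)E and E(z ⊗ 1) both equal E(z ⊗ 1)E. -/
theorem CommLam.Er_rTensor {z : Multiplier A} (hz : H.CommLam z) (t : A ⊗[ℂ] A) :
    H.E.right (LinearMap.rTensor A z.right t) = LinearMap.rTensor A z.right (H.E.right t) := by
  have e1 : H.E * (tmul z 1 * H.E) = tmul z 1 * H.E := ext_left H.nd2 fun t => by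
    simp only [Multiplier.mul_left]
    rw [← H.T₁_R₁ t]
    generalize H.R₁ t = s
    induction s using TensorProduct.induction_on with
    | zero => simp
    | add x y hx hy => simp only [map_add, hx, hy]
    | tmul a c =>
      have : (tmul z (1 : Multiplier A)).left (H.T₁ (a ⊗ₜ c)) = H.T₁ (z.left a ⊗ₜ c) :=
        (hz.T₁_left a c).symm
      rw [this, El_T₁]
  have e2 : H.E * tmul z 1 * H.E = H.E * tmul z 1 := ext_right H.nd2 fun t => by
    simp only [Multiplier.mul_right]
    rw [← H.T₂_R₂ t]
    generalize H.R₂ t = s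
    induction s using TensorProduct.induction_on with
    | zero => simp
    | add x y hx hy => simp only [map_add, hx, hy]
    | tmul a c =>
      have : (tmul z (1 : Multiplier A)).right (H.T₂ (a ⊗ₜ c)) = H.T₂ (a ⊗ₜ z.right c) :=
        (hz.T₂_right a c).symm
      rw [this, Er_T₂]
  rw [← mul_assoc, e2] at e1
  exact (congrArg (fun m => Multiplier.right m t) e1).symm

/-- The reason is ε_t(A)A = A: the product ab is the counit slice of T₁(a ⊗ b) = E T₁(a ⊗ b). -/
theorem sliceE_hom_ext_left {N : Type*} [AddCommGroup N] [Module ℂ N] {f g : A →ₗ[ℂ] N}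
    (hfg : ∀ ω d e w, f ((H.sliceE ω d e).left w) = g ((H.sliceE ω d e).left w)) : f = g := by
  apply H.idempotent.hom_ext
  intro a b
  have h1 : LinearMap.lTensor A f (H.T₁ (a ⊗ₜ b)) = LinearMap.lTensor A g (H.T₁ (a ⊗ₜ b)) := by
    apply H.eq_of_slL_mL
    intro ω d
    rw [slL_lTensor, slL_lTensor, ← El_T₁]
    generalize H.T₁ (a ⊗ₜ b) = t
    induction t using TensorProduct.induction_on with
    | zero => simp
    | add x y hx hy => simp only [map_add, hx, hy]
    | tmul e w => exact hfg ω d e w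
  have h2 := congrArg (slL H.counit) h1
  rwa [slL_lTensor, slL_lTensor, slL_counit_T₁] at h2

theorem sliceE_hom_ext_right {N : Type*} [AddCommGroup N] [Module ℂ N] {f g : A →ₗ[ℂ] N}
    (hfg : ∀ ω d e w, f ((H.sliceE ω d e).right w) = g ((H.sliceE ω d e).right w)) : f = g := by
  apply H.rho_hom_ext
  intro ω d e c
  rw [rho_apply, ← Er_T₂]
  generalize H.T₂ (d ⊗ₜ c) = t
  induction t using TensorProduct.induction_on with
  | zero => simp
  | add x y hx hy => simp only [map_add, hx, hy]
  | tmul p q => exact hfg ω p e q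

namespace IsCop

variable {H' : WeakMultiplierHopfAlgebra A} (h : H.IsCop H')

include h

theorem commLam_sliceE (ω : Module.Dual ℂ A) (d e : A) : H.CommLam (H.sliceE ω d e) := by
  constructor
  · intro κ x y a
    rw [sliceE_left, sliceE_left, ← LinearMap.lTensor_tmul, h.comm2_El.apply, slL_lTensor]
  · intro κ x y a
    rw [sliceE_right, sliceE_right, ← LinearMap.lTensor_tmul, h.comm2_Er.apply, slL_lTensor]

theorem commLam_of_mem {x : Multiplier A} (hx : x ∈ H.legE) : H.CommLam x := by
  refine sliceE_induction (p := H.CommLam) ?_ ?_ ?_ h.commLam_sliceE hx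
  · constructor
    · intro ω d e a
      change H.lam ω d e 0 = 0
      simp
    · intro ω d e a
      change H.lam ω d e 0 = 0
      simp
  · intro x y hx hy
    exact ⟨fun ω d e a => by simp [hx.1, hy.1], fun ω d e a => by simp [hx.2, hy.2]⟩
  · intro k x hx
    exact ⟨fun ω d e a => by simp [hx.1], fun ω d e a => by simp [hx.2]⟩

theorem T₁_right {z : Multiplier A} (hz : H.CommLam z) (a c : A) :
    H'.T₁ (z.right a ⊗ₜ c) = H'.T₁ (a ⊗ₜ z.left c) := by
  apply H'.eq_of_slL_mL_mR
  intro ω d e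
  rw [← rho_mul, ← rho_mul, h.rho, hz.2, right_mul_eq]

/-- The multiplier algebra of `ε_t(A)`. -/
theorem mem_At {z : Multiplier A} : z ∈ H.At ↔ H.CommLam z := by
  constructor
  · intro hz
    rw [At, h.targetAlgebra_eq] at hz
    constructor
    · intro ω d e a
      -- For y in the target algebra, zy lies there too, so both y and zy commute with `lam`. As the
      -- vectors yw span A, so does z.
      have : H.lam ω d e ∘ₗ z.left = z.left ∘ₗ H.lam ω d e := by
        apply sliceE_hom_ext_left (H := H)
        intro κ x y w
        have h1 := (h.commLam_of_mem (hz _ (H.sliceE_mem κ x y)).1).1 ω d e w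
        simp only [Multiplier.mul_left] at h1
        rw [LinearMap.comp_apply, LinearMap.comp_apply, h1, (h.commLam_sliceE κ x y).1]
      exact LinearMap.congr_fun this a
    · intro ω d e a
      have : H.lam ω d e ∘ₗ z.right = z.right ∘ₗ H.lam ω d e := by
        apply sliceE_hom_ext_right (H := H)
        intro κ x y w
        have h1 := (h.commLam_of_mem (hz _ (H.sliceE_mem κ x y)).2).2 ω d e w
        simp only [Multiplier.mul_right] at h1
        rw [LinearMap.comp_apply, LinearMap.comp_apply, h1, (h.commLam_sliceE κ x y).2]
      exact LinearMap.congr_fun this a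
  -- On one side zε_t(a) = ε_t(za). For the other, y is written as ε_s'(a) in the source algebra of
  -- H', where ε_s'(a)z = ε_s'(az).
  · intro hz y hy
    constructor
    · rw [h.mem_targetAlgebra] at hy ⊢
      obtain ⟨a, ha⟩ := hy
      refine ⟨z.left a, fun c => ?_⟩
      rw [Multiplier.mul_right, ha, ← S₂_T₂, ← S₂_T₂, hz.T₂_left]
    · rw [h.targetAlgebra_eq, ← h.sourceAlgebra_eq, h.symm.mem_sourceAlgebra] at hy ⊢
      obtain ⟨a, ha⟩ := hy
      refine ⟨z.right a, fun c => ?_⟩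
      rw [Multiplier.mul_left, ha, ← S₁_T₁, ← S₁_T₁, h.T₁_right hz]

/-! ### Integrals -/

theorem incl_comm_T₁ (a b : A) : incl (TensorProduct.comm ℂ A A (H'.T₁ (a ⊗ₜ b))) =
    H.comul a * tmul (incl b) 1 := by
  rw [incl_comm, H'.T₁_spec, flip_mul, flip_tmul, h a, Multiplier.flip_flip]

theorem incl_comm_T₂ (c a : A) : incl (TensorProduct.comm ℂ A A (H'.T₂ (c ⊗ₜ a))) =
    tmul 1 (incl c) * H.comul a := by
  rw [incl_comm, H'.T₂_spec, flip_mul, flip_tmul, h a, Multiplier.flip_flip]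

theorem isRightSlice_iff {φ : Module.Dual ℂ A} {a : A} {x : Multiplier A} :
    H.IsRightSlice φ a x ↔ ∀ b, x.left b = slL φ (H'.T₁ (a ⊗ₜ b)) ∧
      x.right b = slR φ (H.T₂ (b ⊗ₜ a)) := by
  constructor
  · intro hx b
    refine ⟨?_, (hx b _).2 (H.T₂_spec b a)⟩
    rw [(hx b _).1 (h.incl_comm_T₁ a b)]
    exact slR_comm _ _
  · intro hx b t
    constructor
    · intro ht
      rw [← h.incl_comm_T₁] at ht
      rw [(hx b).1, incl_injective H.nd2 ht]
      exact (slR_comm _ _).symm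
    · intro ht
      rw [← H.T₂_spec] at ht
      rw [(hx b).2, incl_injective H.nd2 ht]
      rfl

theorem isLeftSlice_iff {φ : Module.Dual ℂ A} {a : A} {x : Multiplier A} :
    H.IsLeftSlice φ a x ↔ ∀ b, x.left b = slL φ (H.T₁ (a ⊗ₜ b)) ∧
      x.right b = slR φ (H'.T₂ (b ⊗ₜ a)) := by
  constructor
  · intro hx b
    refine ⟨(hx b _).1 (H.T₁_spec a b), ?_⟩
    rw [(hx b _).2 (h.incl_comm_T₂ b a)]
    exact slL_comm _ _
  · intro hx b t
    constructor
    · intro ht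
      rw [← H.T₁_spec] at ht
      rw [(hx b).1, incl_injective H.nd2 ht]
      rfl
    · intro ht
      rw [← h.incl_comm_T₂] at ht
      rw [(hx b).2, incl_injective H.nd2 ht]
      exact (slL_comm _ _).symm

theorem isLeftIntegral_iff {φ : Module.Dual ℂ A} : H.IsLeftIntegral φ ↔ φ ≠ 0 ∧
    ∀ a, ∃ z : Multiplier A, H.CommLam z ∧ ∀ b, z.left b = slL φ (H'.T₁ (a ⊗ₜ b)) ∧
      z.right b = slR φ (H.T₂ (b ⊗ₜ a)) := by
  simp only [IsLeftIntegral, h.mem_At, h.isRightSlice_iff]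

/-- The flip exchanges left and right slices of the coproduct, and A_s of `H` is A_t of H'. -/
theorem isRightIntegral_iff {ψ : Module.Dual ℂ A} : H.IsRightIntegral ψ ↔ H'.IsLeftIntegral ψ := by
  simp only [IsRightIntegral, IsLeftIntegral, h.symm.At_eq, h.isLeftSlice_iff,
    h.symm.isRightSlice_iff]

end IsCop

end WeakMultiplierHopfAlgebra

end WMHA

namespace WMHA

open Multiplier

variable {A : Type*} [NonUnitalRing A] [Module ℂ A] [IsScalarTower ℂ A A] [SMulCommClass ℂ A A]

namespace WeakMultiplierHopfAlgebra

variable (H : WeakMultiplierHopfAlgebra A)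

/-! ### The iterated coproduct -/

theorem eq_of_lTensor_slR_mL_mR (H : WeakMultiplierHopfAlgebra A) {s t : A ⊗[ℂ] (A ⊗[ℂ] A)}
    (h : ∀ (ω : Module.Dual ℂ A) d e, LinearMap.lTensor A (slR (ω ∘ₗ mL d ∘ₗ mR e)) s =
      LinearMap.lTensor A (slR (ω ∘ₗ mL d ∘ₗ mR e)) t) : s = t := by
  obtain ⟨s, rfl⟩ := (TensorProduct.assoc ℂ A A A).surjective s
  obtain ⟨t, rfl⟩ := (TensorProduct.assoc ℂ A A A).surjective t
  exact congrArg _ (H.eq_of_slR_mL_mR fun ω d e => by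
    simpa only [lTensor_slR_assoc] using h ω d e)

/-- The map `s ⊗ b ↦ (s ⊗ b ⊗ 1)(ι ⊗ Δ)Δ(v)`. -/
noncomputable def comul₂ (v : A) : A ⊗[ℂ] A →ₗ[ℂ] A ⊗[ℂ] (A ⊗[ℂ] A) :=
  op23 H.T₂ ∘ₗ LinearMap.lTensor A (TensorProduct.comm ℂ A A).toLinearMap ∘ₗ
    (TensorProduct.assoc ℂ A A A).toLinearMap ∘ₗ
      LinearMap.rTensor A (H.T₂ ∘ₗ (TensorProduct.mk ℂ A A).flip v)

theorem lTensor_slR_comul₂_tmul (κ : Module.Dual ℂ A) (v s b : A) :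
    LinearMap.lTensor A (slR κ) (H.comul₂ v (s ⊗ₜ b)) =
      LinearMap.lTensor A (slR κ ∘ₗ H.T₂ ∘ₗ TensorProduct.mk ℂ A A b) (H.T₂ (s ⊗ₜ v)) := by
  have : H.comul₂ v (s ⊗ₜ b) = op23 H.T₂ (LinearMap.lTensor A
      (TensorProduct.comm ℂ A A).toLinearMap (TensorProduct.assoc ℂ A A A (H.T₂ (s ⊗ₜ v) ⊗ₜ b))) := by
    simp [comul₂]
  rw [this]
  generalize H.T₂ (s ⊗ₜ v) = t
  induction t using TensorProduct.induction_on with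
  | zero => simp
  | add x y hx hy => simp only [TensorProduct.add_tmul, map_add, hx, hy]
  | tmul p q => simp

theorem lTensor_slR_comul₂ (ω : Module.Dual ℂ A) (d e v : A) (t : A ⊗[ℂ] A) :
    LinearMap.lTensor A (slR (ω ∘ₗ mL d ∘ₗ mR e)) (H.comul₂ v t) = H.dr (H.lam ω d e v) t := by
  induction t using TensorProduct.induction_on with
  | zero => simp
  | add x y hx hy => simp only [map_add, hx, hy]
  | tmul s b =>
    have : slR (ω ∘ₗ mL d ∘ₗ mR e) ∘ₗ H.T₂ ∘ₗ TensorProduct.mk ℂ A A b =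
        mL b ∘ₗ H.lam ω d e := by
      ext q; simp [mul_lam]
    rw [lTensor_slR_comul₂_tmul, this, dr_tmul, LinearMap.lTensor_comp, LinearMap.comp_apply,
      ← H.comm2_T₂.apply, LinearMap.lTensor_tmul]

theorem comul₂_Er (v : A) (t : A ⊗[ℂ] A) : H.comul₂ v (H.E.right t) = H.comul₂ v t := by
  apply H.eq_of_lTensor_slR_mL_mR
  intro ω d e
  rw [lTensor_slR_comul₂, lTensor_slR_comul₂, dr_Er]

theorem comul₂_T₂ (v c d : A) : H.comul₂ v (H.T₂ (c ⊗ₜ d)) = op12 H.T₂ (c ⊗ₜ H.T₂ (d ⊗ₜ v)) := by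
  apply H.eq_of_lTensor_slR_mL_mR
  intro ω x y
  rw [lTensor_slR_comul₂, lTensor_slR_op12, ← T₂_mul_right, LinearMap.lTensor_tmul, mul_lam]

/-- `∑ q ⊗ S(p) u`, over `(x ⊗ 1)Δ(a) = ∑ q ⊗ p`, is `(x · ⊗ ι) R₁(a ⊗ u)`. -/
theorem lTensor_S₁_T₂ (x a u : A) :
    LinearMap.lTensor A (H.S₁ ∘ₗ (TensorProduct.mk ℂ A A).flip u) (H.T₂ (x ⊗ₜ a)) =
      LinearMap.rTensor A (mL x) (H.R₁ (a ⊗ₜ u)) := by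
  apply H.eq_of_slL_mR
  intro ω e
  rw [slL_lTensor, slL_rTensor, ← rho_apply]
  simp only [LinearMap.comp_apply, LinearMap.flip_apply, TensorProduct.mk_apply]
  rw [S₁_rho]
  congr 2
  ext y
  simp [mul_assoc]

namespace IsCop

variable {H} {H' : WeakMultiplierHopfAlgebra A} (h : H.IsCop H')

include h

/-! ### The antipode formula for integrals -/

/-- `(s z(v) ⊗ b)E = ∑ p ⊗ b z(q)`, over `(s ⊗ 1)Δ(v) = ∑ p ⊗ q`, where `z(v) = (ι ⊗ φ)Δ(v)`. -/
theorem Er_right_tmul {φ : Module.Dual ℂ A} {v : A} {z : Multiplier A} (hz : H.CommLam z)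
    (hr : ∀ b, z.right b = slR φ (H.T₂ (b ⊗ₜ v))) (s b : A) :
    H.E.right (z.right s ⊗ₜ b) =
      LinearMap.lTensor A (slR φ ∘ₗ H.T₂ ∘ₗ TensorProduct.mk ℂ A A b) (H.T₂ (s ⊗ₜ v)) := by
  -- The φ-slice of the iterated coproduct absorbs `E` on s ⊗ b, and (s ⊗ b)E = T₂R₂(s ⊗ b). On T₂(c
  -- ⊗ d) coassociativity turns the slice into T₂(c ⊗ dz), which is T₂(c ⊗ d)(z ⊗ 1).
  rw [← lTensor_slR_comul₂_tmul, ← comul₂_Er, ← LinearMap.rTensor_tmul, hz.Er_rTensor,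
    ← T₂_R₂]
  generalize H.R₂ (s ⊗ₜ b) = t
  induction t using TensorProduct.induction_on with
  | zero => simp
  | add x y hx hy => simp only [map_add, hx, hy]
  | tmul c d =>
    rw [comul₂_T₂, lTensor_slR_op12, LinearMap.lTensor_tmul, ← hr, hz.T₂_right]

theorem S₂_comm_Er (t : A ⊗[ℂ] A) : H'.S₂ (TensorProduct.comm ℂ A A (H.E.right t)) =
    H'.S₂ (TensorProduct.comm ℂ A A t) := by
  rw [← H'.S₂_Er (TensorProduct.comm ℂ A A t), h.Er, TensorProduct.comm_comm]

/-- `S⁻¹((ι ⊗ φ)((1 ⊗ x)Δ(a))) = (ι ⊗ φ)(Δ(x)(1 ⊗ a))` for a left integral `φ`; here `H'.antipode`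
is the inverse of the antipode. -/
theorem antipode_slL {φ : Module.Dual ℂ A} (hφ : H.IsLeftIntegral φ) (x a : A) :
    H'.antipode (slL φ (H'.T₂ (x ⊗ₜ a))) = slR φ (H.T₁ (x ⊗ₜ a)) := by
  choose z hz hzl hzr using (h.isLeftIntegral_iff.1 hφ).2
  -- The identity S'(s z(v)) = ∑ z(v₍₂₎) S'(s v₍₁₎): inserting `E` does not change S₂', and
  -- `Er_right_tmul` then expands (s z(v) ⊗ b)E.
  have h1 : ∀ (b : A) (τ : A ⊗[ℂ] A), b * H'.antipode (slR φ (H.T₂ τ)) =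
      LinearMap.mul' ℂ A (TensorProduct.map (slR φ ∘ₗ H.T₂ ∘ₗ TensorProduct.mk ℂ A A b) H'.antipode
        (TensorProduct.comm ℂ A A (H.T₂ τ))) := by
    intro b τ
    induction τ using TensorProduct.induction_on with
    | zero => simp
    | add x y hx hy => simp only [map_add, mul_add, hx, hy]
    | tmul s v =>
      rw [← hzr, h.symm.mul_antipode, ← TensorProduct.comm_tmul, ← h.S₂_comm_Er,
        h.Er_right_tmul (hz v) (hzr v)]
      generalize H.T₂ (s ⊗ₜ v) = t
      induction t using TensorProduct.induction_on with
      | zero => simp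
      | add x y hx hy => simp only [map_add, hx, hy]
      | tmul p q => simp [h.symm.mul_antipode]
  -- The element (1 ⊗ x)Δ(a) is fixed by `E`, hence in the range of T₂, where the previous identity
  -- applies.
  have h2 : TensorProduct.comm ℂ A A (H'.T₂ (x ⊗ₜ a)) =
      H.T₂ (H.R₂ (TensorProduct.comm ℂ A A (H'.T₂ (x ⊗ₜ a)))) := by
    rw [T₂_R₂, h.symm.Er, TensorProduct.comm_comm, Er_T₂]
  apply H.nd.eq_of_mul_right
  intro u
  have h3 : H'.antipode (slL φ (H'.T₂ (x ⊗ₜ a))) * u = slL φ (H'.T₁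
      (LinearMap.lTensor A (H'.S₁ ∘ₗ (TensorProduct.mk ℂ A A).flip u) (H'.T₂ (x ⊗ₜ a)))) := by
    apply H.nd.eq_of_mul_left
    intro b
    rw [← mul_assoc, ← slR_comm, h2, h1, ← h2, TensorProduct.comm_comm]
    generalize H'.T₂ (x ⊗ₜ a) = t
    induction t using TensorProduct.induction_on with
    | zero => simp
    | add x y hx hy => simp only [map_add, add_mul, mul_add, hx, hy]
    | tmul q p =>
      simp only [TensorProduct.map_tmul, LinearMap.mul'_apply, LinearMap.comp_apply,
        TensorProduct.mk_apply, LinearMap.lTensor_tmul, LinearMap.flip_apply]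
      rw [← hzr, ← (hzl _ _), ← right_mul_eq, mul_assoc, h.symm.antipode_mul]
  have h4 : ∀ t : A ⊗[ℂ] A, H'.T₁ (LinearMap.rTensor A (mL x) t) = H'.dl x (H'.T₁ t) := by
    intro t
    induction t using TensorProduct.induction_on with
    | zero => simp
    | add x y hx hy => simp only [map_add, hx, hy]
    | tmul p q => simp [T₁_mul_left]
  -- The sum is a slice of Δ'(x)T₁'R₁'(a ⊗ u), where Δ' is the flipped coproduct. Here T₁'R₁' = E'
  -- is absorbed by Δ'(x).
  rw [h3, lTensor_S₁_T₂, h4, T₁_R₁, dl_El, h.dl, TensorProduct.comm_tmul, slL_comm, dl_tmul,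
    slR_rTensor]
  rfl

end IsCop

end WeakMultiplierHopfAlgebra

end WMHA

namespace WMHA

open Multiplier

variable {A : Type*} [NonUnitalRing A] [Module ℂ A] [IsScalarTower ℂ A A] [SMulCommClass ℂ A A]

namespace WeakMultiplierHopfAlgebra

variable (H : WeakMultiplierHopfAlgebra A)

/-! ### Spanning sets obtained from faithful families of functionals -/

/-- If κ kills these slices, faithfulness gives (ι ⊗ κ)((c ⊗ 1)Δ(a)) = 0, and fullness gives κ = 0.
-/
theorem span_slL_T₂ {F : Set (Module.Dual ℂ A)} (hF : ∀ x, (∀ f ∈ F, ∀ b, f (b * x) = 0) → x = 0) :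
    Submodule.span ℂ {y | ∃ f ∈ F, ∃ b a, y = slL f (H.T₂ (b ⊗ₜ a))} = ⊤ := by
  apply submodule_eq_top_of_dual
  intro κ hκ
  apply H.dual_eq_zero_of_slR_T₂
  intro c a
  apply hF
  intro f hf b
  have h1 : H.T₂ ((b * c) ⊗ₜ a) = LinearMap.rTensor A (mL b) (H.T₂ (c ⊗ₜ a)) := by
    apply eq_of_mul_tmul H.nd H.nd
    intro x y
    rw [rTensor_mL_mul, T₂_mul, T₂_mul]
    generalize H.dl a (x ⊗ₜ y) = t
    induction t using TensorProduct.induction_on with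
    | zero => simp
    | add x y hx hy => simp only [map_add, hx, hy]
    | tmul x y => simp
  rw [← LinearMap.mulLeft_apply (R := ℂ), ← slR_rTensor, ← h1, ← apply_slL_comm]
  exact hκ _ (Submodule.subset_span ⟨f, hf, _, _, rfl⟩)

theorem span_slR_T₁ {F : Set (Module.Dual ℂ A)} (hF : ∀ x, (∀ f ∈ F, ∀ b, f (x * b) = 0) → x = 0) :
    Submodule.span ℂ {y | ∃ f ∈ F, ∃ a b, y = slR f (H.T₁ (a ⊗ₜ b))} = ⊤ := by
  apply submodule_eq_top_of_dual
  intro κ hκ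
  apply H.dual_eq_zero_of_slL_T₁
  intro a c
  apply hF
  intro f hf b
  have h1 : H.T₁ (a ⊗ₜ (c * b)) = LinearMap.lTensor A (mR b) (H.T₁ (a ⊗ₜ c)) := by
    apply eq_of_mul_tmul H.nd H.nd
    intro x y
    rw [lTensor_mR_mul, T₁_mul, T₁_mul, mul_assoc]
  rw [← LinearMap.mulRight_apply (R := ℂ), ← slL_lTensor, ← h1, apply_slL_comm]
  exact hκ _ (Submodule.subset_span ⟨f, hf, _, _, rfl⟩)

namespace IsCop

variable {H} {H' : WeakMultiplierHopfAlgebra A} (h : H.IsCop H')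

include h

/-! ### The antipode and the coproduct -/

theorem comp_antipode_eq (ω : Module.Dual ℂ A) (d e : A) :
    (ω ∘ₗ mL d ∘ₗ mR e) ∘ₗ H'.antipode =
      (ω ∘ₗ H'.antipode) ∘ₗ mL (H.antipode e) ∘ₗ mR (H.antipode d) := by
  ext m
  simp [h.symm.antipode_anti, h.symm.antipode_antipode, mul_assoc]

/-- On elements of this form `antipode_slL` evaluates both sides. Coassociativity then produces the
same kind of slice in the second leg of Δ(x), where the formula is used again. -/
theorem lam_antipode_slL {φ : Module.Dual ℂ A} (hφ : H.IsLeftIntegral φ) (ω : Module.Dual ℂ A)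
    (d e x a : A) :
    H.lam ω d e (H'.antipode (slL φ (H'.T₂ (x ⊗ₜ a)))) = H'.antipode
      (H.rho (ω ∘ₗ H'.antipode) (H.antipode e) (H.antipode d) (slL φ (H'.T₂ (x ⊗ₜ a)))) := by
  -- Colinearity of T₂' moves `rho` onto a, so the argument keeps its form.
  have e2 : H.rho (ω ∘ₗ H'.antipode) (H.antipode e) (H.antipode d) (slL φ (H'.T₂ (x ⊗ₜ a))) =
      slL φ (H'.T₂ (x ⊗ₜ H.rho (ω ∘ₗ H'.antipode) (H.antipode e) (H.antipode d) a)) := by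
    rw [← h.lam, ← LinearMap.lTensor_tmul, H'.comm2_T₂.apply, slL_lTensor]
  rw [e2, h.antipode_slL hφ, h.antipode_slL hφ]
  apply H.nd.eq_of_mul_left
  intro c
  have h1 := LinearMap.congr_fun H.comm1_T₁.op.eq (c ⊗ₜ (x ⊗ₜ a))
  simp only [Module.End.mul_apply] at h1
  rw [op23_tmul, op12_tmul] at h1
  rw [mul_lam, ← LinearMap.lTensor_tmul, ← lTensor_slR_op12, h1, ← LinearMap.mulLeft_apply (R := ℂ),
    ← slR_rTensor, rTensor_T₁]
  generalize H.T₂ (c ⊗ₜ x) = t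
  induction t using TensorProduct.induction_on with
  | zero => simp
  | add x y hx hy => simp only [TensorProduct.add_tmul, map_add, hx, hy]
  | tmul p q =>
    have h2 : (ω ∘ₗ mL d ∘ₗ mR e) (slR φ (H.T₁ (q ⊗ₜ a))) =
        φ (q * H.rho (ω ∘ₗ H'.antipode) (H.antipode e) (H.antipode d) a) := by
      rw [← h.antipode_slL hφ, ← LinearMap.comp_apply, h.comp_antipode_eq, apply_slL_comm, ← h.lam,
        mul_lam]
    rw [TensorProduct.assoc_tmul, op23_tmul, LinearMap.lTensor_tmul, slR_tmul, h2,
      LinearMap.lTensor_tmul, slR_tmul, LinearMap.mulRight_apply]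

/-- Anti-comultiplicativity of S' in sliced form. By faithfulness the elements treated in
`lam_antipode_slL` span A. -/
theorem lam_antipode (hf : H.HasFaithfulIntegrals) (ω : Module.Dual ℂ A) (d e y : A) :
    H.lam ω d e (H'.antipode y) = H'.antipode
      (H.rho (ω ∘ₗ H'.antipode) (H.antipode e) (H.antipode d) y) := by
  have key : H.lam ω d e ∘ₗ H'.antipode =
      H'.antipode ∘ₗ H.rho (ω ∘ₗ H'.antipode) (H.antipode e) (H.antipode d) := by
    refine LinearMap.ext_on (H'.span_slL_T₂ (F := {φ | H.IsLeftIntegral φ}) hf.2) ?_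
    rintro y ⟨φ, hφ, x, a, rfl⟩
    exact h.lam_antipode_slL hφ ω d e x a
  exact LinearMap.congr_fun key y

theorem rho_antipode (hf : H.HasFaithfulIntegrals) (ω : Module.Dual ℂ A) (d e y : A) :
    H.rho ω d e y = H.antipode (H.lam (ω ∘ₗ H.antipode) (H'.antipode e) (H'.antipode d)
      (H'.antipode y)) := by
  have e1 : (ω ∘ₗ H.antipode) ∘ₗ H'.antipode = ω := by
    ext m; simp [h.antipode_antipode]
  rw [h.lam_antipode hf, h.antipode_antipode, h.antipode_antipode, h.antipode_antipode, e1]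

theorem T₂_antipode (hf : H.HasFaithfulIntegrals) (a b : A) :
    H.T₂ (H'.antipode b ⊗ₜ H'.antipode a) = TensorProduct.map H'.antipode H'.antipode
      (TensorProduct.comm ℂ A A (H.T₁ (a ⊗ₜ b))) := by
  apply H.eq_of_slR_mL_mR
  intro ω d e
  rw [← mul_lam, h.lam_antipode hf, ← h.symm.antipode_anti, rho_mul, ← h.comp_antipode_eq]
  generalize H.T₁ (a ⊗ₜ b) = t
  induction t using TensorProduct.induction_on with
  | zero => simp
  | add x y hx hy => simp only [map_add, hx, hy]
  | tmul p q => simp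

theorem T₁_antipode (hf : H.HasFaithfulIntegrals) (a b : A) :
    H'.T₁ (H'.antipode a ⊗ₜ H'.antipode b) = TensorProduct.map H'.antipode H'.antipode
      (TensorProduct.comm ℂ A A (H'.T₂ (b ⊗ₜ a))) := by
  apply H.eq_of_slL_mL_mR
  intro ω d e
  rw [← rho_mul, h.rho, h.lam_antipode hf, ← h.symm.antipode_anti, ← h.lam, mul_lam,
    ← h.comp_antipode_eq]
  generalize H'.T₂ (b ⊗ₜ a) = t
  induction t using TensorProduct.induction_on with
  | zero => simp
  | add x y hx hy => simp only [map_add, hx, hy]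
  | tmul p q => simp

/-! ### Transport of integrals and faithfulness by the antipode -/

theorem antipode_ne_zero {φ : Module.Dual ℂ A} (hφ : φ ≠ 0) : φ ∘ₗ H'.antipode ≠ 0 := by
  intro h0
  apply hφ
  ext x
  rw [← h.symm.antipode_antipode x, ← LinearMap.comp_apply, h0]
  rfl

/-- If `φ` is a left integral, then `φ ∘ S⁻¹` is a right integral. -/
theorem isRightIntegral_comp (hf : H.HasFaithfulIntegrals) {φ : Module.Dual ℂ A}
    (hφ : H.IsLeftIntegral φ) : H.IsRightIntegral (φ ∘ₗ H'.antipode) := by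
  rw [h.isRightIntegral_iff, h.symm.isLeftIntegral_iff]
  choose z hz hzl hzr using (h.isLeftIntegral_iff.1 hφ).2
  refine ⟨h.antipode_ne_zero hφ.1, fun v => ?_⟩
  -- The slice of Δ(v) by φ ∘ S' is S applied to z(S'(v)). As S reverses products, the conjugated
  -- left action of z becomes the right action.
  have hmul : ∀ a b : A, (H.antipode ∘ₗ (z (H'.antipode v)).left ∘ₗ H'.antipode) a * b =
      a * (H.antipode ∘ₗ (z (H'.antipode v)).right ∘ₗ H'.antipode) b := by
    intro a b
    simp only [LinearMap.comp_apply]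
    conv_lhs => rw [← h.antipode_antipode b]
    conv_rhs => rw [← h.antipode_antipode a]
    rw [← h.antipode_anti, ← h.antipode_anti, right_mul_eq]
  refine ⟨Multiplier.mk _ _ hmul, ⟨fun ω d e a => ?_, fun ω d e a => ?_⟩, fun b => ⟨?_, ?_⟩⟩
  · rw [left_mk, h.lam, h.rho_antipode hf, h.rho_antipode hf]
    simp only [LinearMap.comp_apply]
    rw [h.symm.antipode_antipode, h.symm.antipode_antipode, (hz _).2]
  · rw [right_mk, h.lam, h.rho_antipode hf, h.rho_antipode hf]
    simp only [LinearMap.comp_apply]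
    rw [h.symm.antipode_antipode, h.symm.antipode_antipode, (hz _).1]
  · rw [left_mk]
    simp only [LinearMap.comp_apply]
    rw [hzr, h.T₂_antipode hf]
    generalize H.T₁ (v ⊗ₜ b) = t
    induction t using TensorProduct.induction_on with
    | zero => simp
    | add x y hx hy => simp only [map_add, hx, hy]
    | tmul p q => simp [h.antipode_antipode]
  · rw [right_mk]
    simp only [LinearMap.comp_apply]
    rw [hzl, h.T₁_antipode hf]
    generalize H'.T₂ (b ⊗ₜ v) = t
    induction t using TensorProduct.induction_on with
    | zero => simp
    | add x y hx hy => simp only [map_add, hx, hy]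
    | tmul p q => simp [h.antipode_antipode]

theorem eq_zero_of_antipode {x : A} (hx : H.antipode x = 0) : x = 0 := by
  rw [← h.symm.antipode_antipode x, hx, map_zero]

/-- The functionals φ ∘ S' are left integrals of H'. Since S' reverses products, the two halves of
faithfulness change places. -/
theorem hasFaithfulIntegrals (hf : H.HasFaithfulIntegrals) : H'.HasFaithfulIntegrals := by
  constructor
  · intro x hx
    apply h.symm.eq_zero_of_antipode
    apply hf.2
    intro φ hφ a
    have := hx _ (h.isRightIntegral_iff.1 (h.isRightIntegral_comp hf hφ)) (H.antipode a)
    rwa [LinearMap.comp_apply, h.symm.antipode_anti, h.symm.antipode_antipode] at this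
  · intro x hx
    apply h.symm.eq_zero_of_antipode
    apply hf.1
    intro φ hφ a
    have := hx _ (h.isRightIntegral_iff.1 (h.isRightIntegral_comp hf hφ)) (H.antipode a)
    rwa [LinearMap.comp_apply, h.symm.antipode_anti, h.symm.antipode_antipode] at this

end IsCop

end WeakMultiplierHopfAlgebra

end WMHA

namespace WMHA

open Multiplier

variable {A : Type*} [NonUnitalRing A] [Module ℂ A] [IsScalarTower ℂ A A] [SMulCommClass ℂ A A]

theorem apply_mem_of_span_eq_top {M N : Type*} [AddCommGroup M] [Module ℂ M] [AddCommGroup N]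
    [Module ℂ N] {s : Set M} (hs : Submodule.span ℂ s = ⊤) (f : M →ₗ[ℂ] N) {V : Submodule ℂ N}
    (h : ∀ y ∈ s, f y ∈ V) (c : M) : f c ∈ V := by
  have hle : Submodule.span ℂ s ≤ V.comap f := Submodule.span_le.2 h
  rw [hs] at hle
  exact hle trivial

namespace WeakMultiplierHopfAlgebra

variable (H : WeakMultiplierHopfAlgebra A)

/-! ### Comparison of the functionals obtained from left and right integrals -/

/-- Both sides are `(φ ⊗ κ)((x ⊗ 1)Δ(a)(1 ⊗ b))`. -/
theorem apply_slL_T₂_mul (φ κ : Module.Dual ℂ A) (x a b : A) :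
    κ (slL φ (H.T₂ (x ⊗ₜ a)) * b) = φ (x * slR κ (H.T₁ (a ⊗ₜ b))) := by
  rw [← LinearMap.mulRight_apply (R := ℂ), ← slL_lTensor, ← rTensor_T₁, apply_slL_comm,
    slR_rTensor, LinearMap.mulLeft_apply]

/-- The span of the functionals `φ(a ·)`, with `φ` a left integral. -/
def dualSpaceLeft : Submodule ℂ (Module.Dual ℂ A) :=
  Submodule.span ℂ {ω | ∃ φ, H.IsLeftIntegral φ ∧ ∃ a : A, ω = mulLeftFunctional φ a}

theorem mulRightFunctional_mem {φ : Module.Dual ℂ A} (hφ : H.IsLeftIntegral φ) (a : A) :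
    mulRightFunctional φ a ∈ H.dualSpace :=
  Submodule.subset_span ⟨φ, hφ, a, rfl⟩

theorem mulLeftFunctional_mem {φ : Module.Dual ℂ A} (hφ : H.IsLeftIntegral φ) (a : A) :
    mulLeftFunctional φ a ∈ H.dualSpaceLeft :=
  Submodule.subset_span ⟨φ, hφ, a, rfl⟩

/-- `a ↦ φ(· a)` as a linear map. -/
def mulRightHom (φ : Module.Dual ℂ A) : A →ₗ[ℂ] Module.Dual ℂ A where
  toFun := mulRightFunctional φ
  map_add' a b := by ext x; simp [mulRightFunctional, mul_add]
  map_smul' k a := by ext x; simp [mulRightFunctional, mul_smul_comm]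

/-- `a ↦ φ(a ·)` as a linear map. -/
def mulLeftHom (φ : Module.Dual ℂ A) : A →ₗ[ℂ] Module.Dual ℂ A where
  toFun := mulLeftFunctional φ
  map_add' a b := by ext x; simp [mulLeftFunctional, add_mul]
  map_smul' k a := by ext x; simp [mulLeftFunctional, smul_mul_assoc]

namespace IsCop

variable {H} {H' : WeakMultiplierHopfAlgebra A} (h : H.IsCop H')

include h

/-- Both sides are `(κ ⊗ φ)((b ⊗ x)Δ(a))`. -/
theorem apply_mul_slL_T₂ (φ κ : Module.Dual ℂ A) (x a b : A) :
    κ (b * slL φ (H'.T₂ (x ⊗ₜ a))) = φ (x * slL κ (H.T₂ (b ⊗ₜ a))) := by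
  rw [← LinearMap.mulLeft_apply (R := ℂ), ← slR_comm, ← slR_rTensor, ← h.dr_tmul', dr_tmul,
    ← apply_slL_comm, slL_lTensor, LinearMap.mulLeft_apply]

theorem faithful_left {F : Set (Module.Dual ℂ A)}
    (hF : ∀ x, (∀ f ∈ F, ∀ a, f (x * a) = 0) → x = 0) :
    ∀ x, (∀ f ∈ (fun f : Module.Dual ℂ A => f ∘ₗ H'.antipode) '' F, ∀ b, f (b * x) = 0) →
      x = 0 := by
  intro x hx
  apply h.symm.eq_zero_of_antipode
  apply hF
  intro f hf a
  have := hx _ ⟨f, hf, rfl⟩ (H.antipode a)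
  rwa [LinearMap.comp_apply, h.symm.antipode_anti, h.symm.antipode_antipode] at this

theorem faithful_right {F : Set (Module.Dual ℂ A)}
    (hF : ∀ x, (∀ f ∈ F, ∀ a, f (a * x) = 0) → x = 0) :
    ∀ x, (∀ f ∈ (fun f : Module.Dual ℂ A => f ∘ₗ H'.antipode) '' F, ∀ b, f (x * b) = 0) →
      x = 0 := by
  intro x hx
  apply h.symm.eq_zero_of_antipode
  apply hF
  intro f hf a
  have := hx _ ⟨f, hf, rfl⟩ (H.antipode a)
  rwa [LinearMap.comp_apply, h.symm.antipode_anti, h.symm.antipode_antipode] at this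

/-- By `antipode_slL` the slice of Δ(x)(1 ⊗ a) is a value of S', so the factor S'(b) can be taken
inside S'. Reading the slices in the other order then isolates x. -/
theorem apply_slR_dl {φ : Module.Dual ℂ A} (hφ : H.IsLeftIntegral φ) (ψ : Module.Dual ℂ A)
    (x b a : A) : ψ (slR φ (H.dl x (H'.antipode b ⊗ₜ a))) =
      φ (x * slL (ψ ∘ₗ H'.antipode) (H.T₂ (b ⊗ₜ a))) := by
  rw [dl_tmul, slR_rTensor, LinearMap.mulRight_apply, ← h.antipode_slL hφ,
    ← h.symm.antipode_anti, ← LinearMap.comp_apply, h.apply_mul_slL_T₂]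

/-- Both sides are (ψ ⊗ φ)(Δ(x)(S'(b) ⊗ S(a))), evaluated through φ and through ψ. -/
theorem apply_mul_slL_antipode {φ ψ : Module.Dual ℂ A} (hφ : H.IsLeftIntegral φ)
    (hψ : H'.IsLeftIntegral ψ) (x a b : A) :
    φ (x * slL (ψ ∘ₗ H'.antipode) (H.T₂ (b ⊗ₜ H.antipode a))) =
      ψ (x * slL (φ ∘ₗ H.antipode) (H'.T₂ (a ⊗ₜ H'.antipode b))) := by
  rw [← h.apply_slR_dl hφ, ← h.symm.apply_slR_dl hψ, h.dl, TensorProduct.comm_tmul, slR_comm,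
    apply_slL_comm]

/-- Both sides are (ψ ⊗ φ)((S'(b) ⊗ 1)Δ(x)(1 ⊗ S'(a))). The left one needs `antipode_slL` for φ, the
right one its mirror image for ψ. -/
theorem apply_mul_slR_antipode {φ ψ : Module.Dual ℂ A} (hφ : H.IsLeftIntegral φ)
    (hψ : H'.IsLeftIntegral ψ) (x a b : A) :
    φ (x * slR (ψ ∘ₗ H'.antipode) (H'.T₁ (H'.antipode a ⊗ₜ b))) =
      ψ (slL (φ ∘ₗ H'.antipode) (H'.T₂ (a ⊗ₜ H'.antipode b)) * x) := by
  rw [← apply_slL_T₂_mul, LinearMap.comp_apply, h.symm.antipode_anti, h.antipode_slL hφ,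
    ← apply_slL_T₂_mul, apply_slL_T₂_mul H' (φ ∘ₗ H'.antipode), ← h.symm.antipode_slL hψ,
    LinearMap.comp_apply, h.symm.antipode_anti, h.symm.antipode_antipode]

/-! ### Equality of the spans -/

theorem dualSpace_le (hf : H.HasFaithfulIntegrals) : H.dualSpace ≤ H'.dualSpace := by
  refine Submodule.span_le.2 ?_
  rintro _ ⟨φ, hφ, c, rfl⟩
  -- Right integrals composed with S' are faithful, so c may be taken to be a slice of Δ by one of
  -- them. For such c the functional φ(· c) has the form ψ(· c').
  refine apply_mem_of_span_eq_top (H.span_slL_T₂ (h.faithful_left (h.hasFaithfulIntegrals hf).1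
    (F := {ψ | H'.IsLeftIntegral ψ}))) (mulRightHom φ) ?_ c
  rintro _ ⟨_, ⟨ψ, hψ, rfl⟩, b, a, rfl⟩
  have : mulRightHom φ (slL (ψ ∘ₗ H'.antipode) (H.T₂ (b ⊗ₜ a))) = mulRightFunctional ψ
      (slL (φ ∘ₗ H.antipode) (H'.T₂ (H'.antipode a ⊗ₜ H'.antipode b))) := by
    ext x
    have := h.apply_mul_slL_antipode hφ hψ x (H'.antipode a) b
    rwa [h.antipode_antipode] at this
  rw [this]
  exact H'.mulRightFunctional_mem hψ _

theorem dualSpace_eq (hf : H.HasFaithfulIntegrals) : H.dualSpace = H'.dualSpace :=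
  le_antisymm (h.dualSpace_le hf) (h.symm.dualSpace_le (h.hasFaithfulIntegrals hf))

theorem dualSpace_eq_dualSpaceLeft (hf : H.HasFaithfulIntegrals) :
    H.dualSpace = H'.dualSpaceLeft := by
  apply le_antisymm
  · refine Submodule.span_le.2 ?_
    rintro _ ⟨φ, hφ, c, rfl⟩
    refine apply_mem_of_span_eq_top (H'.span_slR_T₁ (h.faithful_right
      (h.hasFaithfulIntegrals hf).2 (F := {ψ | H'.IsLeftIntegral ψ}))) (mulRightHom φ) ?_ c
    rintro _ ⟨_, ⟨ψ, hψ, rfl⟩, a, b, rfl⟩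
    have : mulRightHom φ (slR (ψ ∘ₗ H'.antipode) (H'.T₁ (a ⊗ₜ b))) = mulLeftFunctional ψ
        (slL (φ ∘ₗ H'.antipode) (H'.T₂ (H.antipode a ⊗ₜ H'.antipode b))) := by
      ext x
      have := h.apply_mul_slR_antipode hφ hψ x (H.antipode a) b
      rwa [h.symm.antipode_antipode] at this
    rw [this]
    exact H'.mulLeftFunctional_mem hψ _
  -- The same identity read backwards, with c now a slice by some φ ∘ S'.
  · refine Submodule.span_le.2 ?_
    rintro _ ⟨ψ, hψ, c, rfl⟩
    refine apply_mem_of_span_eq_top (H'.span_slL_T₂ (h.faithful_left hf.1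
      (F := {φ | H.IsLeftIntegral φ}))) (mulLeftHom ψ) ?_ c
    rintro _ ⟨_, ⟨φ, hφ, rfl⟩, a, b, rfl⟩
    have : mulLeftHom ψ (slL (φ ∘ₗ H'.antipode) (H'.T₂ (a ⊗ₜ b))) = mulRightFunctional φ
        (slR (ψ ∘ₗ H'.antipode) (H'.T₁ (H'.antipode a ⊗ₜ H.antipode b))) := by
      ext x
      have := h.apply_mul_slR_antipode hφ hψ x a (H.antipode b)
      rw [h.symm.antipode_antipode] at this
      exact this.symm
    rw [this]
    exact H.mulRightFunctional_mem hφ _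

end IsCop

end WeakMultiplierHopfAlgebra

end WMHA

theorem mainTheorem11 {A : Type*} [NonUnitalRing A] [Module ℂ A] [IsScalarTower ℂ A A]
    [SMulCommClass ℂ A A] (H : WMHA.WeakMultiplierHopfAlgebra A) (hreg : H.IsRegular)
    (hfaithful : H.HasFaithfulIntegrals) :
    (∀ φ, H.IsLeftIntegral φ → ∀ a : A,
      WMHA.mulRightFunctional φ a ∈ H.dualSpace ∧ WMHA.mulLeftFunctional φ a ∈ H.dualSpace) ∧
    (∀ ψ, H.IsRightIntegral ψ → ∀ a : A,
      WMHA.mulRightFunctional ψ a ∈ H.dualSpace ∧ WMHA.mulLeftFunctional ψ a ∈ H.dualSpace) ∧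
    H.dualSpace = Submodule.span ℂ
      {ω | ∃ φ, H.IsLeftIntegral φ ∧ ∃ a : A, ω = WMHA.mulRightFunctional φ a} ∧
    H.dualSpace = Submodule.span ℂ
      {ω | ∃ φ, H.IsLeftIntegral φ ∧ ∃ a : A, ω = WMHA.mulLeftFunctional φ a} ∧
    H.dualSpace = Submodule.span ℂ
      {ω | ∃ ψ, H.IsRightIntegral ψ ∧ ∃ a : A, ω = WMHA.mulRightFunctional ψ a} ∧
    H.dualSpace = Submodule.span ℂ
      {ω | ∃ ψ, H.IsRightIntegral ψ ∧ ∃ a : A, ω = WMHA.mulLeftFunctional ψ a} := by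
  obtain ⟨H', h⟩ := hreg
  replace h : H.IsCop H' := h
  have e1 : H.dualSpace = H'.dualSpace := h.dualSpace_eq hfaithful
  have e2 : H.dualSpace = H'.dualSpaceLeft := h.dualSpace_eq_dualSpaceLeft hfaithful
  -- The comparison with exchanged sides, applied to H' in place of `H`, leads back to the left
  -- integrals of `H`.
  have e3 : H.dualSpace = H.dualSpaceLeft :=
    e1.trans (h.symm.dualSpace_eq_dualSpaceLeft (h.hasFaithfulIntegrals hfaithful))
  simp only [h.isRightIntegral_iff]
  refine ⟨fun φ hφ a => ⟨H.mulRightFunctional_mem hφ a, ?_⟩, fun ψ hψ a => ⟨?_, ?_⟩, rfl, e3, e1, e2⟩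
  · rw [e3]; exact H.mulLeftFunctional_mem hφ a
  · rw [e1]; exact H'.mulRightFunctional_mem hψ a
  · rw [e2]; exact H'.mulLeftFunctional_mem hψ a
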